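/- An \emph{Ordinal Turing Machine (OTM)} has finitely many (at least one) tapes. The cells of each tape are indexed by the ordinals, each cell contains $0$ or $1$, and each tape has its own read-write head. A \emph{program} is a finite partial function that assigns to a state (a natural number) and the tuple of symbols currently scanned by the heads a new state and, for each tape, a symbol to be written on the scanned cell and a move of the head (left, right or stay). The computation of a program starts at time $0$ in state $0$ with all cells containing $0$ and all heads on position $0$. At a successor time $t+1$ the configuration is obtained from the one at time $t$ by carrying out the applicable instruction; a head that moves left from position $0$ or from a limit position goes to position $0$. At a limit time $t$, the state, the position of each head and the content of each cell are the inferior limits of the sequences of their values at the times $s<t$. The computation stops when a configuration is reached to which no instruction applies; if this happens for the first time at time $t$, then the program \emph{halts at time} $t+1$. An ordinal $\alpha$ is \emph{OTM-clockable} if some program halts at time $\alpha+1$. An \emph{OTM-clockable gap} is an interval $[\alpha,\beta)$ of ordinals with $\alpha<\beta$ such that no element of $[\alpha,\beta)$ is OTM-clockable, for every $\xi<\alpha$ there is an OTM-clockable $\delta$ with $\xi\le\delta<\alpha$, and $\beta$ is OTM-clockable. \textbf{Proposition.} There are gaps in the OTM-clockable ordinals. That is, there is an OTM-clockable gap; and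 there are ordinals $\alpha<\beta<\gamma$ such that $\alpha$ and $\gamma$ are OTM-clockable but $\beta$ is not. -/

import Mathlib

/-! # Ordinal Turing Machines with finitely many tapes, and clockability -/

namespace OTM

/-- The possible moves of a read-write head in a single step. -/
inductive Move where
  | left
  | stay
  | right

/-- Moving a head on a tape whose cells are indexed by the ordinals. A head that moves left from
position `0` or from a limit position goes to position `0`. -/
noncomputable def Move.apply : Move → Ordinal.{0} → Ordinal.{0}
  | .left, h => Ordinal.limitRecOn h 0 (fun g _ ↦ g) (fun _ _ _ ↦ 0)
  | .stay, h => h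
  | .right, h => h + 1

/-- What a machine with `k` tapes does in one step: change to the state `state` and, on each tape,
write a symbol on the scanned cell and then move the head of that tape. -/
structure Action (k : ℕ) where
  state : ℕ
  write : Fin k → Bool
  move : Fin k → Move

/-- A program for an Ordinal Turing Machine with finitely many (at least one) tapes: a finite
partial function which assigns an action to a state (a natural number) and the tuple of scanned
symbols (`false` is the symbol `0`, `true` is the symbol `1`). Where it is undefined,
the machine halts. -/
structure Program where
  tapes : ℕ
  tapes_pos : 0 < tapes
  instr : ℕ → (Fin tapes → Bool) → Option (Action tapes)
  finite_instr : {p : ℕ × (Fin tapes → Bool) | instr p.1 p.2 ≠ none}.Finite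

/-- A configuration of a machine with `k` tapes: the inner state, the head position on each tape,
and the contents of each tape. -/
@[ext] structure Config (k : ℕ) where
  state : ℕ
  head : Fin k → Ordinal.{0}
  tape : Fin k → Ordinal.{0} → Bool

/-- The initial configuration: state `0`, all heads on position `0`, all cells contain `0`. -/
def Config.init (k : ℕ) : Config k where
  state := 0
  head _ := 0
  tape _ _ := false

/-- The symbols that the heads are reading. -/
def Config.scanned {k : ℕ} (c : Config k) : Fin k → Bool := fun i ↦ c.tape i (c.head i)

/-- The result of performing the action `a` in the configuration `c`. -/
noncomputable def Config.perform {k : ℕ} (c : Config k) (a : Action k) : Config k where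
  state := a.state
  head i := (a.move i).apply (c.head i)
  tape i := Function.update (c.tape i) (c.head i) (a.write i)

/-- The limit rule at a limit time `t`: the state, every head position and the content of every
cell are the inferior limits of the sequences of their earlier values. -/
noncomputable def Config.limit {k : ℕ} {t : Ordinal.{0}} (c : Set.Iio t → Config k) : Config k where
  state := Filter.liminf (fun s ↦ (c s).state) Filter.atTop
  head i := Filter.liminf (fun s ↦ (c s).head i) Filter.atTop
  tape i x := Filter.liminf (fun s ↦ (c s).tape i x) Filter.atTop

/-- No instruction of `P` applies to the configuration `c`. -/
def Program.IsFinal (P : Program) (c : Config P.tapes) : Prop := P.instr c.state c.scanned = none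

/-- One step of `P`. Final configurations are left unchanged. -/
noncomputable def Program.next (P : Program) (c : Config P.tapes) : Config P.tapes :=
  match P.instr c.state c.scanned with
  | none => c
  | some a => c.perform a

/-- The configuration at time `t` in the computation of `P` on empty tapes. -/
noncomputable def Program.run (P : Program) (t : Ordinal.{0}) : Config P.tapes :=
  Ordinal.limitRecOn t (Config.init P.tapes) (fun _ c ↦ P.next c)
    (fun _ _ c ↦ Config.limit fun s ↦ c s.1 s.2)

theorem Move.apply_left_zero : Move.left.apply 0 = 0 := by
  simp [Move.apply]

theorem Move.apply_left_add_one (h : Ordinal.{0}) : Move.left.apply (h + 1) = h := by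
  simp [Move.apply]

theorem Move.apply_left_limit {h : Ordinal.{0}} (hh : Order.IsSuccLimit h) :
    Move.left.apply h = 0 := by
  simp [Move.apply, Ordinal.limitRecOn_limit (h := hh)]

theorem Program.run_zero (P : Program) : P.run 0 = Config.init P.tapes := by
  simp [Program.run]

theorem Program.run_succ (P : Program) (t : Ordinal.{0}) :
    P.run (t + 1) = P.next (P.run t) := by
  simp [Program.run]

theorem Program.run_limit (P : Program) {t : Ordinal.{0}} (ht : Order.IsSuccLimit t) :
    P.run t = Config.limit fun s : Set.Iio t ↦ P.run s.1 := by
  simp [Program.run, Ordinal.limitRecOn_limit (h := ht)]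

/-- `P` halts at time `τ`, that is, its computation is a sequence of configurations of length `τ`:
there is a first time `t` at which the configuration is final, and `τ = t + 1`. -/
def Program.HaltsAt (P : Program) (τ : Ordinal.{0}) : Prop :=
  ∃ t : Ordinal.{0}, τ = t + 1 ∧ IsLeast {s | P.IsFinal (P.run s)} t

/-- An ordinal `α` is OTM-clockable if some program halts at time `α + 1`. -/
def Clockable (α : Ordinal.{0}) : Prop := ∃ P : Program, P.HaltsAt (α + 1)

/-- The interval `[α, β)` is an OTM-clockable gap. -/
structure IsGap (α β : Ordinal.{0}) : Prop where
  lt : α < β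
  not_clockable : ∀ ξ ∈ Set.Ico α β, ¬ Clockable ξ
  cofinal : ∀ ξ < α, ∃ δ ∈ Set.Ico ξ α, Clockable δ
  clockable : Clockable β

end OTM

/-! Each program clocks at most one ordinal and there are only countably many programs up to
renaming, so unclockable ordinals exist; the point is to find a clockable ordinal above one of them.
A single machine `univ` achieves this by searching for an ordinal that no program clocks: it outruns
the first one it meets and then halts.

The clock tape of `univ` stores an ordinal `α` as an initial segment of `1`s. For `α = 0, 1, …`, and
through all limits, `univ` interprets the programs numbered `0, 1, 2, …` of a small straight-line
language. Each starts on empty data, is executed over and over, and is watched through pass `α` at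
most. If some program signals for the first time at the end of pass `α`, the clock is lengthened by
one cell; if none does, `univ` halts. A straight-line program can simulate an OTM with one pass per
step and signal when the configuration is final (`Program.code`), so every clockable ordinal is
signalled by some number (`exists_succeeds`); the converse plays no role. A number signals at most
one ordinal, so there is a least `β` that is not signalled, and `β` is not clockable. The clock does
reach `β`, which takes at least `β` steps, and `univ` halts later still
(`exists_clockable_of_not_succeeds`). If `σ` is the least unclockable ordinal and `γ` the least
clockable one above it, then `[σ, γ)` is a gap, and `0 < σ < γ` is the required triple.

The work lies in the limit times. A configuration is determined by its atoms `n < state`, `b < head`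
and `cell = 1`, and at a limit an atom holds exactly if it holds eventually
(`Program.run_limit_holds`). Two consequences shape the construction. The simulation stores states
and head positions in unary, so that inferior limits of cells encode inferior limits of
configurations; and since a pass takes many steps, a cell that is `1` before and after a pass must
stay `1` during it (`Program.step_code`). Moreover every loop of `univ` starts in its lowest state,
with its heads at their lowest positions, so that the limit rule leads back to the start of the
loop; `Program.run_chain` turns bounds for the infimum of each round into a description of the
limit. -/

open Filter Order

namespace OTM

/-! ### Inferior limits of configurations as eventual truth of atoms -/

/-- `p` holds at all sufficiently large ordinals below `l`. -/
def Ev (l : Ordinal.{0}) (p : Ordinal.{0} → Prop) : Prop :=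
  ∃ s₀ < l, ∀ s, s₀ ≤ s → s < l → p s

theorem Ev.mono {l : Ordinal.{0}} {p q : Ordinal.{0} → Prop} (h : Ev l p)
    (hpq : ∀ s < l, p s → q s) : Ev l q := by
  obtain ⟨s₀, h₀, h⟩ := h
  exact ⟨s₀, h₀, fun s h1 h2 ↦ hpq s h2 (h s h1 h2)⟩

theorem Ev.and {l : Ordinal.{0}} {p q : Ordinal.{0} → Prop} (hp : Ev l p) (hq : Ev l q) :
    Ev l fun s ↦ p s ∧ q s := by
  obtain ⟨a, ha, hp⟩ := hp
  obtain ⟨b, hb, hq⟩ := hq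
  exact ⟨max a b, max_lt ha hb, fun s h1 h2 ↦
    ⟨hp s (le_trans (le_max_left _ _) h1) h2, hq s (le_trans (le_max_right _ _) h1) h2⟩⟩

theorem Ev.of_forall {l : Ordinal.{0}} (hl : IsSuccLimit l) {p : Ordinal.{0} → Prop}
    (h : ∀ s < l, p s) : Ev l p :=
  ⟨0, hl.bot_lt, fun s _ hs ↦ h s hs⟩

theorem Ev.exists {l : Ordinal.{0}} {p : Ordinal.{0} → Prop} (h : Ev l p) : ∃ s < l, p s := by
  obtain ⟨s₀, h₀, h⟩ := h
  exact ⟨s₀, h₀, h s₀ le_rfl h₀⟩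

theorem Ev.shift {l : Ordinal.{0}} (hl : IsSuccLimit l) {p : Ordinal.{0} → Prop} (h : Ev l p) :
    Ev l fun s ↦ p (s + 1) := by
  obtain ⟨s₀, h₀, h⟩ := h
  exact ⟨s₀, h₀, fun s h1 h2 ↦ h _ (h1.trans (le_self_add)) (hl.add_one_lt h2)⟩

/-- By well-foundedness there is a least element above `b`; if eventually `b < f s`, it is an
eventual lower bound, hence at most the inferior limit. Boundedness is needed because the order is
only conditionally complete. -/
theorem lt_liminf_iff {β : Type*} [ConditionallyCompleteLinearOrder β] [OrderBot β]
    [WellFoundedLT β] {t : Ordinal.{0}} (ht : IsSuccLimit t) (f : Ordinal.{0} → β)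
    (hf : ∃ B, ∀ s < t, f s ≤ B) (b : β) :
    b < liminf (fun s : Set.Iio t ↦ f s.1) atTop ↔ Ev t fun s ↦ b < f s := by
  have h0 : 0 < t := ht.bot_lt
  have : Nonempty (Set.Iio t) := ⟨⟨0, h0⟩⟩
  obtain ⟨B, hB⟩ := hf
  have key : (∀ᶠ s : Set.Iio t in atTop, b < f s.1) ↔ Ev t fun s ↦ b < f s := by
    rw [eventually_atTop]
    constructor
    · rintro ⟨a, ha⟩
      exact ⟨a.1, a.2, fun s h1 h2 ↦ ha ⟨s, h2⟩ h1⟩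
    · rintro ⟨a, ha, h⟩
      exact ⟨⟨a, ha⟩, fun s hs ↦ h s.1 hs s.2⟩
  rw [← key]
  constructor
  · intro h
    refine eventually_lt_of_lt_liminf h ?_
    exact isBoundedUnder_of ⟨⊥, fun _ ↦ bot_le⟩
  · intro h
    have hne : {x : β | b < x}.Nonempty := by
      obtain ⟨s, hs⟩ := h.exists
      exact ⟨_, hs⟩
    have hmin := WellFounded.min_mem (wellFounded_lt : WellFounded ((· < ·) : β → β → Prop)) _ hne
    refine lt_of_lt_of_le hmin ?_
    refine le_liminf_of_le ?_ (h.mono fun s hs ↦ ?_)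
    · refine IsBoundedUnder.isCoboundedUnder_ge ?_
      exact isBoundedUnder_of ⟨B, fun s ↦ hB _ s.2⟩
    · exact WellFounded.min_le _ hs

/-- The elementary facts that describe a configuration. -/
inductive Atom (k : ℕ) where
  | state (n : ℕ)
  | head (i : Fin k) (b : Ordinal.{0})
  | tape (i : Fin k) (y : Ordinal.{0})

/-- All atoms are strict lower bounds, so each of them passes to an inferior limit exactly when it
is eventually true. -/
def Config.Holds {k : ℕ} (c : Config k) : Atom k → Prop
  | .state n => n < c.state
  | .head i b => b < c.head i
  | .tape i y => c.tape i y = true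

theorem Config.ext_holds {k : ℕ} {c d : Config k} (h : ∀ a, c.Holds a ↔ d.Holds a) : c = d := by
  ext
  · exact eq_of_forall_lt_iff fun n ↦ h (.state n)
  · exact eq_of_forall_lt_iff fun b ↦ h (.head _ b)
  · rename_i i y
    exact (Bool.eq_iff_iff.2 (h (.tape i y)))

instance {k : ℕ} : PartialOrder (Config k) where
  le c d := ∀ a, c.Holds a → d.Holds a
  le_refl _ _ h := h
  le_trans _ _ _ h h' a ha := h' a (h a ha)
  le_antisymm _ _ h h' := Config.ext_holds fun a ↦ ⟨h a, h' a⟩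

theorem Config.le_iff {k : ℕ} {c d : Config k} : c ≤ d ↔ c.state ≤ d.state ∧
    (∀ i, c.head i ≤ d.head i) ∧ ∀ i, c.tape i ≤ d.tape i := by
  constructor
  · intro h
    refine ⟨le_of_forall_lt fun n hn ↦ h (.state n) hn,
      fun i ↦ le_of_forall_lt fun n hn ↦ h (.head i n) hn, fun i y ↦ ?_⟩
    exact Bool.le_iff_imp.2 (h (.tape i y))
  · rintro ⟨h1, h2, h3⟩ (n | ⟨i, b⟩ | ⟨i, y⟩) ha
    · exact lt_of_lt_of_le (b := c.state) ha h1
    · exact lt_of_lt_of_le (b := c.head i) ha (h2 i)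
    · exact Bool.le_iff_imp.1 (h3 i y) ha

theorem Program.exists_bound (P : Program) :
    ∃ N, (∀ q s, P.instr q s ≠ none → q ≤ N) ∧ ∀ q s a, P.instr q s = some a → a.state ≤ N := by
  have hf := P.finite_instr
  obtain ⟨N₁, h₁⟩ := (hf.image (fun p ↦ p.1)).bddAbove
  obtain ⟨N₂, h₂⟩ := (hf.image (fun p ↦ ((P.instr p.1 p.2).map Action.state).getD 0)).bddAbove
  refine ⟨max N₁ N₂, fun q s h ↦ le_max_of_le_left (h₁ ⟨(q, s), h, rfl⟩), fun q s a h ↦ ?_⟩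
  refine le_max_of_le_right (h₂ ⟨(q, s), by simp [h], by simp [h]⟩)

theorem Program.next_state_le (P : Program) {N : ℕ}
    (hN : ∀ q s a, P.instr q s = some a → a.state ≤ N) {c : Config P.tapes} (hc : c.state ≤ N) :
    (P.next c).state ≤ N := by
  unfold Program.next
  split
  · exact hc
  · rename_i a h
    exact hN _ _ a h

/-- In `ℕ` the inferior limit is meaningful only for bounded sequences; finiteness of the program
supplies the bound. -/
theorem Program.run_state_le (P : Program) {N : ℕ}
    (hN : ∀ q s a, P.instr q s = some a → a.state ≤ N) (t : Ordinal.{0}) :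
    (P.run t).state ≤ N := by
  induction t using Ordinal.limitRecOn with
  | zero => simp [Program.run_zero, Config.init]
  | add_one t ih => rw [Program.run_succ]; exact P.next_state_le hN ih
  | limit t ht ih =>
    rw [P.run_limit ht]
    refine not_lt.1 fun h ↦ ?_
    obtain ⟨s, hs, h⟩ := ((lt_liminf_iff ht (fun s ↦ (P.run s).state) ⟨N, ih⟩ N).1 h).exists
    exact absurd h (not_lt.2 (ih s hs))

theorem Program.run_limit_holds (P : Program) {t : Ordinal.{0}} (ht : IsSuccLimit t)
    (a : Atom P.tapes) : (P.run t).Holds a ↔ Ev t fun s ↦ (P.run s).Holds a := by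
  obtain ⟨N, -, hN⟩ := P.exists_bound
  rw [P.run_limit ht]
  cases a with
  | state n => exact lt_liminf_iff ht (fun s ↦ (P.run s).state) ⟨N, fun s _ ↦ P.run_state_le hN s⟩ n
  | head i b =>
    refine lt_liminf_iff ht (fun s ↦ (P.run s).head i) ?_ b
    refine ⟨⨆ s : Set.Iio t, (P.run s.1).head i, fun s hs ↦ ?_⟩
    exact Ordinal.le_iSup (fun s : Set.Iio t ↦ (P.run s.1).head i) ⟨s, hs⟩
  | tape i y =>
    have := lt_liminf_iff ht (fun s ↦ (P.run s).tape i y) ⟨⊤, fun s _ ↦ le_top⟩ false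
    simp only [Bool.lt_iff, true_and] at this
    exact this

theorem Program.run_isFinal (P : Program) {s t : Ordinal.{0}} (hs : P.IsFinal (P.run s))
    (hst : s ≤ t) : P.run t = P.run s := by
  induction t using Ordinal.limitRecOn with
  | zero => rw [nonpos_iff_eq_zero.1 hst]
  | add_one t ih =>
    rcases hst.lt_or_eq with h | h
    · rw [P.run_succ, ih (Order.lt_add_one_iff.1 h)]
      unfold Program.next
      unfold Program.IsFinal at hs
      rw [hs]
    · rw [h]
  | limit t ht ih =>
    rcases hst.lt_or_eq with h | h
    · refine Config.ext_holds fun a ↦ ?_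
      rw [P.run_limit_holds ht]
      constructor
      · intro h'
        obtain ⟨r, hr, h''⟩ := (h'.and ⟨s, h, fun r h1 _ ↦ h1⟩).exists
        rw [← ih r hr h''.2]
        exact h''.1
      · intro h'
        exact ⟨s, h, fun r h1 h2 ↦ (by simp only [ih r h2 h1, h'])⟩
    · rw [h]

/-- Final configurations persist, so the first final time cannot be at or before a time at which the
configuration is not final. -/
theorem Program.clockable_of_isFinal (P : Program) {s t : Ordinal.{0}}
    (hs : ¬ P.IsFinal (P.run s)) (ht : P.IsFinal (P.run t)) : ∃ r, s < r ∧ Clockable r := by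
  classical
  have hne : {s | P.IsFinal (P.run s)}.Nonempty := ⟨t, ht⟩
  refine ⟨sInf {s | P.IsFinal (P.run s)}, ?_, P, _, rfl, csInf_mem hne, fun x hx ↦ csInf_le' hx⟩
  refine not_le.1 fun h ↦ hs ?_
  have h1 : P.IsFinal (P.run (sInf {s | P.IsFinal (P.run s)})) := csInf_mem hne
  rwa [P.run_isFinal h1 h]

/-! ### Transfinite loops of an arbitrary machine -/

/-- Provides the times at which the rounds of a loop begin: `g` gives the end of a round, and
suprema are taken at limits. -/
theorem exists_isNormal_iterate (g : Ordinal.{0} → Ordinal.{0} → Ordinal.{0})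
    (hg : ∀ η s, s < g η s) (s₀ : Ordinal.{0}) :
    ∃ τ : Ordinal.{0} → Ordinal.{0}, IsNormal τ ∧ τ 0 = s₀ ∧ ∀ η, τ (η + 1) = g η (τ η) := by
  let τ : Ordinal.{0} → Ordinal.{0} := fun η ↦ Ordinal.limitRecOn η s₀ (fun η s ↦ g η s)
    (fun l _ f ↦ ⨆ x : Set.Iio l, f x.1 x.2)
  have h1 : ∀ η, τ (η + 1) = g η (τ η) := fun η ↦ by simp [τ]
  refine ⟨τ, IsNormal.of_succ_lt (fun η ↦ ?_) (fun {l} hl ↦ ?_), by simp [τ], h1⟩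
  · rw [Order.succ_eq_add_one, h1]
    exact hg _ _
  · have h2 : τ l = ⨆ x : Set.Iio l, τ x.1 := by
      simp [τ, Ordinal.limitRecOn_limit (h := hl)]
    rw [h2]
    have : Nonempty (Set.Iio l) := ⟨⟨0, hl.bot_lt⟩⟩
    have h3 := isLUB_ciSup (f := fun x : Set.Iio l ↦ τ x.1)
      (Ordinal.bddAbove_of_small) 
    rwa [Set.image_eq_range]

/-- Transfinite loops: `I η` describes the configurations at the beginning of round `η`, and
`R η c m u` says that, when round `η` begins with `c`, then the greatest lower bound of its
configurations is between `m` and `u`. -/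
theorem Program.run_chain (P : Program) (I : Ordinal.{0} → Config P.tapes → Prop)
    (R : Ordinal.{0} → Config P.tapes → Config P.tapes → Config P.tapes → Prop)
    (m₀ : Config P.tapes)
    (δ s₀ : Ordinal.{0}) (h₀ : I 0 (P.run s₀))
    (hs : ∀ η < δ, ∀ s, I η (P.run s) → ∃ s' > s, I (η + 1) (P.run s') ∧ ∃ m u,
      R η (P.run s) m u ∧ (∀ r ∈ Set.Ico s s', m ≤ P.run r) ∧
      ∀ a, (∀ r ∈ Set.Ico s s', (P.run r).Holds a) → u.Holds a)
    (hl : ∀ l ≤ δ, IsSuccLimit l → ∀ (cs ms us : Ordinal.{0} → Config P.tapes)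
      (cl : Config P.tapes), (∀ η < l, I η (cs η) ∧ R η (cs η) (ms η) (us η)) →
      (∀ a, (Ev l fun η ↦ (ms η).Holds a) → cl.Holds a) →
      (∀ a, cl.Holds a → Ev l fun η ↦ (us η).Holds a) → I l cl)
    (hm : ∀ η < δ, ∀ c m u, I η c → R η c m u → m₀ ≤ m) :
    ∃ s', s₀ ≤ s' ∧ δ ≤ s' ∧ I δ (P.run s') ∧ ∀ r ∈ Set.Ico s₀ s', m₀ ≤ P.run r := by
  classical
  let Q : Ordinal.{0} → Ordinal.{0} → Ordinal.{0} → Prop := fun η s s' ↦ s < s' ∧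
    (η < δ → I η (P.run s) → I (η + 1) (P.run s') ∧ ∃ m u,
      R η (P.run s) m u ∧ (∀ r ∈ Set.Ico s s', m ≤ P.run r) ∧
      ∀ a, (∀ r ∈ Set.Ico s s', (P.run r).Holds a) → u.Holds a)
  have hQ : ∀ η s, ∃ s', Q η s s' := fun η s ↦ by
    by_cases h : η < δ ∧ I η (P.run s)
    · obtain ⟨s', h1, h2⟩ := hs η h.1 s h.2
      exact ⟨s', h1, fun _ _ ↦ h2⟩
    · exact ⟨s + 1, Order.lt_add_one_iff.2 le_rfl, fun h1 h2 ↦ absurd ⟨h1, h2⟩ h⟩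
  choose g hg using hQ
  obtain ⟨τ, hτ, hτ0, hτs⟩ := exists_isNormal_iterate g (fun η s ↦ (hg η s).1) s₀
  have loc : ∀ l, ∀ r, s₀ ≤ r → r < τ l → ∃ η < l, r ∈ Set.Ico (τ η) (τ (η + 1)) := by
    intro l r h1 h2
    obtain ⟨η, h3, h4⟩ := hτ.exists_map_le_lt_map_succ (x := r) (by simpa [hτ0] using h1)
    exact ⟨η, hτ.strictMono.lt_iff_lt.1 (h3.trans_lt h2), h3, h4⟩
  have hI : ∀ η ≤ δ, I η (P.run (τ η)) := by
    intro η
    induction η using Ordinal.limitRecOn with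
    | zero => intro _; rwa [hτ0]
    | add_one η ih =>
      intro h
      have h' := Order.add_one_le_iff.1 h
      rw [hτs]
      exact ((hg η (τ η)).2 h' (ih h'.le)).1
    | limit l hl' ih =>
      intro h
      have hR : ∀ η < l, ∃ m u, R η (P.run (τ η)) m u ∧
          (∀ r ∈ Set.Ico (τ η) (τ (η + 1)), m ≤ P.run r) ∧
          ∀ a, (∀ r ∈ Set.Ico (τ η) (τ (η + 1)), (P.run r).Holds a) → u.Holds a := fun η hη ↦ by
        rw [hτs]
        exact ((hg η (τ η)).2 (hη.trans_le h) (ih η hη (hη.le.trans h))).2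
      have : Nonempty (Config P.tapes) := ⟨Config.init _⟩
      choose! ms us hms using hR
      refine hl l h hl' (fun η ↦ P.run (τ η)) ms us _
        (fun η hη ↦ ⟨ih η hη (hη.le.trans h), (hms η hη).1⟩) ?_ ?_
      -- An atom that holds in the lower bounds of all late rounds holds at all late times;
      -- conversely, an atom that holds at all late times holds throughout every late round, hence
      -- in its upper bound.
      · rintro a ⟨η₀, h1, h2⟩
        rw [P.run_limit_holds (hτ.map_isSuccLimit hl')]
        refine ⟨τ η₀, hτ.strictMono h1, fun s h3 h4 ↦ ?_⟩
        obtain ⟨η, h5, h6⟩ := loc l s (by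
          rw [← hτ0]; exact (hτ.monotone zero_le).trans h3) h4
        refine (hms η h5).2.1 s h6 a (h2 η ?_ h5)
        exact Order.lt_add_one_iff.1 (hτ.strictMono.lt_iff_lt.1 (h3.trans_lt h6.2))
      · intro a
        rw [P.run_limit_holds (hτ.map_isSuccLimit hl')]
        rintro ⟨r, h1, h2⟩
        obtain ⟨η₀, h3, h4⟩ := (hτ.lt_iff_exists_lt hl').1 h1
        refine ⟨η₀, h3, fun η h5 h6 ↦ (hms η h6).2.2 a fun s hs' ↦ h2 s ?_ ?_⟩
        · exact h4.le.trans ((hτ.monotone h5).trans hs'.1)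
        · exact hs'.2.trans_le (hτ.monotone (Order.add_one_le_iff.2 h6))
  -- `δ` rounds take at least `δ` steps; this is what finally makes `univ` halt after `β`.
  refine ⟨τ δ, ?_, hτ.strictMono.le_apply, hI δ le_rfl, fun r hr ↦ ?_⟩
  · rw [← hτ0]
    exact hτ.monotone zero_le
  · obtain ⟨η, h1, h2⟩ := loc δ r hr.1 hr.2
    rw [hτs] at h2
    obtain ⟨m, u, h3, h4, -⟩ := ((hg η (τ η)).2 h1 (hI η h1.le)).2
    exact (hm η h1 _ m u (hI η h1.le) h3).trans (h4 r h2)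

/-! ### The straight-line language and the universal machine -/

/-- The instructions of the straight-line programs that the universal machine interprets. They act
on an array of bits indexed by the ordinals, a pointer into it, and a flag which, when it is set,
causes instructions to be skipped up to the next `nop`. -/
inductive Op where
  | halt | right | left | clear | set | test | testNot | reset | seek | erase | idle | nop
  deriving DecidableEq

/-- `halt` is coded by blank cells, so every natural number codes a program. The fifth bit belongs
to the stride track and is not part of the instruction. -/
def Op.bits : Op → Fin 5 → Bool
  | .halt => ![false, false, false, false, false]
  | .right => ![true, false, false, false, false]
  | .left => ![false, true, false, false, false]
  | .clear => ![true, true, false, false, false]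
  | .set => ![false, false, true, false, false]
  | .test => ![true, false, true, false, false]
  | .testNot => ![false, true, true, false, false]
  | .reset => ![true, true, true, false, false]
  | .seek => ![false, false, false, true, false]
  | .erase => ![true, false, false, true, false]
  | .idle => ![false, true, false, true, false]
  | .nop => ![true, true, true, true, false]

/-- The instruction encoded by the first four of five bits. -/
def Op.decode (b : Fin 5 → Bool) : Op :=
  match b 0, b 1, b 2, b 3 with
  | false, false, false, false => .halt
  | true, false, false, false => .right
  | false, true, false, false => .left
  | true, true, false, false => .clear
  | false, false, true, false => .set
  | true, false, true, false => .test
  | false, true, true, false => .testNot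
  | true, true, true, false => .reset
  | false, false, false, true => .seek
  | true, false, false, true => .erase
  | false, true, false, true => .idle
  | _, _, _, _ => .nop

theorem Op.decode_eq (o : Op) (b : Fin 5 → Bool) (h : ∀ j < 4, b j = o.bits j) :
    Op.decode b = o := by
  have h0 := h 0 (by decide)
  have h1 := h 1 (by decide)
  have h2 := h 2 (by decide)
  have h3 := h 3 (by decide)
  cases o <;> simp [Op.bits] at h0 h1 h2 h3 <;> simp [Op.decode, h0, h1, h2, h3]

/-- The symbols scanned by the universal machine: five bits `b` of an instruction, markers `mc`,
`mg`, `md`, `mt` for the position `0`, the bits `d` of the data and `v` of the visited region, the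
bit `k` of the clock, and the two registers `f` and `s`. -/
structure Scan where
  b : Fin 5 → Bool
  mc : Bool
  mg : Bool
  md : Bool
  mt : Bool
  d : Bool
  v : Bool
  k : Bool
  f : Bool
  s : Bool

/-- An action of the universal machine. Its heads are coupled so that there are four of them,
for instructions, stride, data and clock; the registers are not moved. -/
structure Act where
  q : ℕ
  mvc : Move
  mvg : Move
  mvd : Move
  mvk : Move
  b : Fin 5 → Bool
  d : Bool
  v : Bool
  k : Bool
  f : Bool
  s : Bool

def Scan.go (r : Scan) (q : ℕ) : Act where
  q := q
  mvc := .stay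
  mvg := .stay
  mvd := .stay
  mvk := .stay
  b := r.b
  d := r.d
  v := r.v
  k := r.k
  f := r.f
  s := r.s

/-- What the universal machine does at the end of a pass. -/
def Scan.endPass (r : Scan) (skip : Bool) : Act :=
  -- The clock head scans `1` exactly in the passes before `α`. A signal there comes too early and
  -- ends the run as a failure; a signal at the first `0` of the clock is a success, and writing `k`
  -- lengthens the clock at once.
  if r.k then if skip then r.go 8 else { r.go 7 with mvk := .right }
  else if skip then { r.go 8 with k := true, s := true }
  else r.go 8

def incBits (b : Fin 5 → Bool) (j : Fin 5) : Bool :=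
  xor (b j) (decide (∀ i < j, b i = true))

/-- The transition table of the universal machine. -/
def table (q : ℕ) (r : Scan) : Option Act :=
  match q with
  -- The search for the current clock value starts here with `f` lowered; limits of clock values
  -- lead to this state as well.
  | 1 => some { r.go 2 with f := true }
  -- `f` is raised before each single program and lowered between them, so a lowered `f` in this
  -- state means that all `ω` programs have been treated; `s` records whether one succeeded. With
  -- both raised, the remaining programs are only counted.
  | 2 =>
    match r.f, r.s with
    | true, false => some (r.go 3)
    | true, true => some { r.go 11 with f := false }
    | false, true => some { r.go 1 with s := false }
    | false, false => none
  | 3 =>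
    match Op.decode r.b with
    | .halt => some (r.endPass false)
    | .right => some { r.go 3 with v := true, mvc := .right, mvd := .right }
    | .left => some { r.go 3 with v := true, mvc := .right, mvd := .left }
    | .clear => some { r.go 3 with v := true, mvc := .right, d := false }
    | .set => some { r.go 3 with v := true, mvc := .right, d := true }
    | .test => some { r.go (if r.d then 3 else 4) with v := true, mvc := .right }
    | .testNot => some { r.go (if r.d then 4 else 3) with v := true, mvc := .right }
    | .reset => some { r.go 13 with v := true, mvc := .right }
    | .seek => some { r.go 14 with v := true, mvc := .right }
    | .erase => some { r.go 15 with v := true, mvc := .right }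
    | .idle => some { r.go 3 with v := true, mvc := .right }
    | .nop => some { r.go 3 with v := true, mvc := .right }
  -- Skipping mode.
  | 4 =>
    match Op.decode r.b with
    | .halt => some (r.endPass true)
    | .nop => some { r.go 3 with mvc := .right }
    | _ => some { r.go 4 with mvc := .right }
  -- The stride is written in unary on the fifth track: the data head advances along it, and then
  -- the stride head returns.
  | 5 =>
    if r.b 4 then some { r.go 5 with v := true, mvd := .right, mvg := .right } else some (r.go 6)
  | 6 => if r.mg then some { r.go 16 with mvc := .left } else some { r.go 6 with mvg := .left }
  | 7 =>
    if r.mc && r.md then some (r.go 3) else some { r.go 7 with mvc := .left, mvd := .left }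
  -- Cleaning up: the heads return, the visited cells are erased, and the heads return again. Only
  -- the bits `v` tell how far the data may extend.
  | 8 =>
    if r.mc && r.md && r.mt then
      if r.v then some (r.go 9) else some { r.go 11 with f := false }
    else some { r.go 8 with mvc := .left, mvd := .left, mvk := .left }
  | 9 =>
    if r.v then some { r.go 9 with d := false, v := false, mvd := .right } else some (r.go 8)
  -- Binary increment of the program number, five digits per cell, with a carry to the next cell if
  -- all five are `1`.
  | 11 =>
    if ∀ i, r.b i = true then some { r.go 11 with b := incBits r.b, mvc := .right, mvg := .right }
    else some { r.go 12 with b := incBits r.b }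
  | 12 =>
    if r.mc && r.mg then some { r.go 2 with f := true }
    else some { r.go 12 with mvc := .left, mvg := .left }
  | 13 => if r.md then some (r.go 3) else some { r.go 13 with mvd := .left }
  -- `seek` and `erase` look ahead over the following instructions `right` to find the row to be
  -- tested. Both heads walk back over them afterwards, so that at a limit of strides the machine is
  -- again in state `3` on the same instruction, with the data pointer at the supremum.
  | 14 =>
    if Op.decode r.b = .right then some { r.go 14 with v := true, mvc := .right, mvd := .right }
    else if r.d then some { r.go 5 with v := true, mvd := .right }
    else some { r.go 17 with mvc := .left }
  | 15 =>
    if Op.decode r.b = .right then some { r.go 15 with v := true, mvc := .right, mvd := .right }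
    else if r.d then some { r.go 5 with v := true, d := false, mvd := .right }
    else some { r.go 17 with mvc := .left }
  | 16 =>
    if Op.decode r.b = .right then some { r.go 16 with mvc := .left, mvd := .left }
    else some (r.go 3)
  | 17 =>
    if Op.decode r.b = .right then some { r.go 17 with mvc := .left, mvd := .left }
    else some { r.go 3 with mvc := .right }
  | _ => none

theorem table_le {q : ℕ} {r : Scan} (h : table q r ≠ none) : q ≤ 17 := by
  by_contra! hq
  obtain ⟨n, rfl⟩ := Nat.exists_eq_add_of_lt hq
  refine h ?_
  rw [show 17 + n + 1 = n + 18 by omega]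
  rfl

def Scan.ofSymbols (s : Fin 14 → Bool) : Scan where
  b := ![s 0, s 1, s 2, s 3, s 4]
  mc := s 5
  mg := s 6
  d := s 7
  v := s 8
  md := s 9
  k := s 10
  mt := s 11
  f := s 12
  s := s 13

def Act.toAction (r : Scan) (a : Act) : Action 14 where
  state := a.q
  write := ![a.b 0, a.b 1, a.b 2, a.b 3, a.b 4, r.mc, r.mg, a.d, a.v, r.md, a.k, r.mt, a.f, a.s]
  move := ![a.mvc, a.mvc, a.mvc, a.mvc, a.mvg, a.mvc, a.mvg, a.mvd, a.mvd, a.mvd, a.mvk, a.mvk,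
    .stay, .stay]

/-- The first action writes the markers. -/
def initAction : Action 14 where
  state := 1
  write := ![false, false, false, false, false, true, true, false, false, true, false, true,
    false, false]
  move _ := .stay

/-- A universal machine. For `α = 0, 1, …` it runs all straight-line programs, one after the other,
for `α` passes until one of them is found which signals to have ended in pass `α`; it halts when
there is none. -/
def univ : Program where
  tapes := 14
  tapes_pos := by decide
  instr q s := if q = 0 then some initAction else
    (table q (Scan.ofSymbols s)).map (Act.toAction (Scan.ofSymbols s))
  finite_instr := by
    refine ((Set.finite_Iic 17).prod (Set.finite_univ (α := Fin 14 → Bool))).subset ?_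
    rintro ⟨q, s⟩ h
    refine ⟨?_, trivial⟩
    by_cases hq : q = 0
    · simp [hq]
    · refine table_le (r := Scan.ofSymbols s) fun h' ↦ h ?_
      simp [hq, h']

/-! ### Readable configurations of the universal machine -/

/-- The configurations of the universal machine, in readable form. -/
structure X where
  q : ℕ
  hc : Ordinal.{0}
  hg : Ordinal.{0}
  hd : Ordinal.{0}
  hk : Ordinal.{0}
  B : Fin 5 → Ordinal.{0} → Bool
  D : Ordinal.{0} → Bool
  V : Ordinal.{0} → Bool
  K : Ordinal.{0} → Bool
  f : Bool
  s : Bool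

/-- Serves both for the tapes that mark position `0` and for the one-cell registers `f` and `s`. -/
noncomputable def mark (b : Bool) (y : Ordinal.{0}) : Bool := decide (y = 0) && b

noncomputable def X.cfg (x : X) : Config 14 where
  state := x.q
  head := ![x.hc, x.hc, x.hc, x.hc, x.hg, x.hc, x.hg, x.hd, x.hd, x.hd, x.hk, x.hk, 0, 0]
  tape := ![x.B 0, x.B 1, x.B 2, x.B 3, x.B 4, mark true, mark true, x.D, x.V, mark true, x.K,
    mark true, mark x.f, mark x.s]

def X.hb (x : X) (j : Fin 5) : Ordinal.{0} := if j = 4 then x.hg else x.hc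

noncomputable def X.scan (x : X) : Scan where
  b j := x.B j (x.hb j)
  mc := decide (x.hc = 0)
  mg := decide (x.hg = 0)
  md := decide (x.hd = 0)
  mt := decide (x.hk = 0)
  d := x.D x.hd
  v := x.V x.hd
  k := x.K x.hk
  f := x.f
  s := x.s

noncomputable def X.app (x : X) (a : Act) : X where
  q := a.q
  hc := a.mvc.apply x.hc
  hg := a.mvg.apply x.hg
  hd := a.mvd.apply x.hd
  hk := a.mvk.apply x.hk
  B j := Function.update (x.B j) (x.hb j) (a.b j)
  D := Function.update x.D x.hd a.d
  V := Function.update x.V x.hd a.v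
  K := Function.update x.K x.hk a.k
  f := a.f
  s := a.s

theorem mark_update (b b' : Bool) : Function.update (mark b) 0 b' = mark b' := by
  funext y
  by_cases h : y = 0
  · subst h; simp [mark]
  · simp [mark, h]

theorem mark_update_self (h : Ordinal.{0}) :
    Function.update (mark true) h (decide (h = 0)) = mark true := by
  funext y
  by_cases h : y = h
  · subst h; simp [mark]
  · simp [h]

theorem X.scan_cfg (x : X) : Scan.ofSymbols x.cfg.scanned = x.scan := by
  have hb : ![x.cfg.scanned 0, x.cfg.scanned 1, x.cfg.scanned 2, x.cfg.scanned 3,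
      x.cfg.scanned 4] = x.scan.b := by
    funext j
    fin_cases j <;> rfl
  unfold Scan.ofSymbols
  rw [show (![(x.cfg.scanned : Fin 14 → Bool) 0, x.cfg.scanned 1, x.cfg.scanned 2,
    x.cfg.scanned 3, x.cfg.scanned 4] : Fin 5 → Bool) = x.scan.b from hb]
  simp [Config.scanned, X.cfg, X.scan, mark]

theorem X.perform_cfg (x : X) (a : Act) :
    x.cfg.perform (a.toAction x.scan) = (x.app a).cfg := by
  unfold Config.perform
  ext1
  · rfl
  · funext i
    fin_cases i <;> rfl
  · funext i
    fin_cases i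
    all_goals first | rfl | exact mark_update_self _ | exact mark_update _ _

theorem Program.next_of_instr {P : Program} {c : Config P.tapes} {a : Action P.tapes}
    (h : P.instr c.state c.scanned = some a) : P.next c = c.perform a := by
  unfold Program.next
  rw [h]

theorem X.next_cfg (x : X) (hq : x.q ≠ 0) {a : Act} (ha : table x.q x.scan = some a) :
    univ.next x.cfg = (x.app a).cfg := by
  have h : univ.instr x.cfg.state x.cfg.scanned = some (a.toAction x.scan) := by
    simp only [univ]
    rw [if_neg (by exact hq)]
    erw [X.scan_cfg, show x.cfg.state = x.q from rfl, ha]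
    rfl
  exact (Program.next_of_instr h).trans (X.perform_cfg x a)

theorem X.isFinal_cfg (x : X) (hq : x.q ≠ 0) :
    univ.IsFinal x.cfg ↔ table x.q x.scan = none := by
  unfold Program.IsFinal
  simp only [univ]
  rw [if_neg (by exact hq)]
  erw [X.scan_cfg, show x.cfg.state = x.q from rfl]
  simp

instance : LE X where
  le x y := x.q ≤ y.q ∧ x.hc ≤ y.hc ∧ x.hg ≤ y.hg ∧ x.hd ≤ y.hd ∧ x.hk ≤ y.hk ∧ x.B ≤ y.B ∧
    x.D ≤ y.D ∧ x.V ≤ y.V ∧ x.K ≤ y.K ∧ x.f ≤ y.f ∧ x.s ≤ y.s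

theorem mark_mono {a b : Bool} (h : a ≤ b) : mark a ≤ mark b := fun y ↦ by
  refine Bool.le_iff_imp.2 fun h' ↦ ?_
  simp only [mark, Bool.and_eq_true] at h' ⊢
  exact ⟨h'.1, Bool.le_iff_imp.1 h h'.2⟩

theorem X.cfg_le_cfg {x y : X} (h : x ≤ y) : x.cfg ≤ y.cfg := by
  obtain ⟨h1, h2, h3, h4, h5, h6, h7, h8, h9, h10, h11⟩ := h
  refine Config.le_iff.2 ⟨h1, fun i ↦ ?_, fun i ↦ ?_⟩
  · exact match i with
      | 0 => h2 | 1 => h2 | 2 => h2 | 3 => h2 | 4 => h3 | 5 => h2 | 6 => h3 | 7 => h4 | 8 => h4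
      | 9 => h4 | 10 => h5 | 11 => h5 | 12 => le_refl (0 : Ordinal) | 13 => le_refl (0 : Ordinal)
  · exact match i with
      | 0 => h6 0 | 1 => h6 1 | 2 => h6 2 | 3 => h6 3 | 4 => h6 4 | 5 => le_refl (mark true)
      | 6 => le_refl (mark true) | 7 => h7 | 8 => h8 | 9 => le_refl (mark true) | 10 => h9
      | 11 => le_refl (mark true) | 12 => mark_mono h10 | 13 => mark_mono h11

theorem X.le_trans {x y z : X} (h : x ≤ y) (h' : y ≤ z) : x ≤ z :=
  ⟨h.1.trans h'.1, h.2.1.trans h'.2.1, h.2.2.1.trans h'.2.2.1, h.2.2.2.1.trans h'.2.2.2.1,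
    h.2.2.2.2.1.trans h'.2.2.2.2.1, h.2.2.2.2.2.1.trans h'.2.2.2.2.2.1,
    h.2.2.2.2.2.2.1.trans h'.2.2.2.2.2.2.1, h.2.2.2.2.2.2.2.1.trans h'.2.2.2.2.2.2.2.1,
    h.2.2.2.2.2.2.2.2.1.trans h'.2.2.2.2.2.2.2.2.1,
    h.2.2.2.2.2.2.2.2.2.1.trans h'.2.2.2.2.2.2.2.2.2.1,
    h.2.2.2.2.2.2.2.2.2.2.trans h'.2.2.2.2.2.2.2.2.2.2⟩

/-! ### Reachability with lower bounds, and loops of the universal machine -/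

/-- From `x` the universal machine gets to a configuration in `p`, and it stays above `m` before. -/
def Reach (m x : X) (p : X → Prop) : Prop :=
  ∀ s, univ.run s = x.cfg → ∃ s' ≥ s, ∃ y : X, p y ∧ univ.run s' = y.cfg ∧
    ∀ r ∈ Set.Ico s s', (m.cfg : Config univ.tapes) ≤ univ.run r

/-- As `Reach`, with at least one step. -/
def SReach (m x : X) (p : X → Prop) : Prop :=
  ∀ s, univ.run s = x.cfg → ∃ s' > s, ∃ y : X, p y ∧ univ.run s' = y.cfg ∧
    ∀ r ∈ Set.Ico s s', (m.cfg : Config univ.tapes) ≤ univ.run r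

/-- As `SReach`, where the greatest lower bound of the configurations before is at most `u`. -/
def SReachU (m u x : X) (p : X → Prop) : Prop :=
  ∀ s, univ.run s = x.cfg → ∃ s' > s, ∃ y : X, p y ∧ univ.run s' = y.cfg ∧
    (∀ r ∈ Set.Ico s s', (m.cfg : Config univ.tapes) ≤ univ.run r) ∧
    ∀ a, (∀ r ∈ Set.Ico s s', (univ.run r).Holds a) → u.cfg.Holds a

/-- The initial configuration is one of those over which the infimum is taken. -/
theorem SReach.toU {m x : X} {p : X → Prop} (h : SReach m x p) : SReachU m x x p := fun s hs ↦ by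
  obtain ⟨s', h1, y, h2, h3, h4⟩ := h s hs
  refine ⟨s', h1, y, h2, h3, h4, fun a ha ↦ ?_⟩
  have := ha s ⟨le_rfl, h1⟩
  rwa [hs] at this

theorem SReach.reach {m x : X} {p : X → Prop} (h : SReach m x p) : Reach m x p := fun s hs ↦ by
  obtain ⟨s', h1, h2⟩ := h s hs
  exact ⟨s', h1.le, h2⟩

theorem Reach.refl {m x : X} {p : X → Prop} (h : p x) : Reach m x p := fun s hs ↦
  ⟨s, le_rfl, x, h, hs, fun _ hr ↦ absurd hr.2 (not_lt.2 hr.1)⟩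

theorem SReach.trans {m x : X} {p p' : X → Prop} (h : SReach m x p)
    (h' : ∀ y, p y → Reach m y p') : SReach m x p' := fun s hs ↦ by
  obtain ⟨s', h1, y, h2, h3, h4⟩ := h s hs
  obtain ⟨s'', h5, z, h6, h7, h8⟩ := h' y h2 s' h3
  refine ⟨s'', lt_of_lt_of_le h1 h5, z, h6, h7, fun r hr ↦ ?_⟩
  rcases lt_or_ge r s' with h9 | h9
  · exact h4 r ⟨hr.1, h9⟩
  · exact h8 r ⟨h9, hr.2⟩

theorem Reach.trans {m x : X} {p p' : X → Prop} (h : Reach m x p)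
    (h' : ∀ y, p y → Reach m y p') : Reach m x p' := fun s hs ↦ by
  obtain ⟨s', h1, y, h2, h3, h4⟩ := h s hs
  obtain ⟨s'', h5, z, h6, h7, h8⟩ := h' y h2 s' h3
  refine ⟨s'', ge_trans h5 h1, z, h6, h7, fun r hr ↦ ?_⟩
  rcases lt_or_ge r s' with h9 | h9
  · exact h4 r ⟨hr.1, h9⟩
  · exact h8 r ⟨h9, hr.2⟩

/-- The configuration after the next step. -/
noncomputable def X.next (x : X) : Option X := (table x.q x.scan).map x.app

theorem SReach.step {m x : X} {p : X → Prop} (y : X) (hy : x.next = some y) (hm : m ≤ x)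
    (h : Reach m y p) : SReach m x p := by
  obtain ⟨a, ha, rfl⟩ := Option.map_eq_some_iff.1 hy
  refine SReach.trans (p := (· = x.app a)) (fun s hs ↦ ⟨s + 1, Order.lt_add_one_iff.2 le_rfl, _,
    rfl, ?_, fun r hr ↦ ?_⟩) (by rintro _ rfl; exact h)
  · rw [Program.run_succ, hs]
    refine X.next_cfg x ?_ ha
    intro hq
    rw [hq] at ha
    cases ha
  · rw [le_antisymm (Order.lt_add_one_iff.1 hr.2) hr.1, hs]
    exact X.cfg_le_cfg hm

theorem Reach.step {m x : X} {p : X → Prop} (y : X) (hy : x.next = some y) (hm : m ≤ x)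
    (h : Reach m y p) : Reach m x p :=
  (SReach.step y hy hm h).reach

/-- `b` is the limit along `l` of anything between `f` and `g`. -/
structure IsLim {β : Type*} [LT β] (l : Ordinal.{0}) (f g : Ordinal.{0} → β) (b : β) : Prop where
  lower : ∀ n, n < b → Ev l fun η ↦ n < f η
  upper : ∀ n, (Ev l fun η ↦ n < g η) → n < b

theorem IsLim.const {β : Type*} [LT β] {l : Ordinal.{0}} (hl : IsSuccLimit l) (b : β) :
    IsLim l (fun _ ↦ b) (fun _ ↦ b) b :=
  ⟨fun _ h ↦ Ev.of_forall hl fun _ _ ↦ h, fun _ h ↦ h.exists.choose_spec.2⟩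

theorem IsLim.eq {β : Type*} [LinearOrder β] {l : Ordinal.{0}} {f g : Ordinal.{0} → β} {b c : β}
    (h : IsLim l f g b) (h1 : ∀ n, (Ev l fun η ↦ n < f η) → n < c)
    (h2 : ∀ n, n < c → Ev l fun η ↦ n < g η) : c = b :=
  eq_of_forall_lt_iff fun n ↦ ⟨fun hn ↦ h.upper n (h2 n hn), fun hn ↦ h1 n (h.lower n hn)⟩

theorem isLim_bool {l : Ordinal.{0}} {f g : Ordinal.{0} → Bool} {b : Bool}
    (h1 : b = true → Ev l fun η ↦ f η = true) (h2 : (Ev l fun η ↦ g η = true) → b = true) :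
    IsLim l f g b := by
  constructor
  · rintro (_ | _) hn
    · exact (h1 (by simpa [Bool.lt_iff] using hn)).mono fun η _ h ↦ by simp [h]
    · simp [Bool.lt_iff] at hn
  · rintro (_ | _) hn
    · rw [h2 (hn.mono fun η _ h ↦ by simpa [Bool.lt_iff] using h)]
      decide
    · obtain ⟨η, -, h⟩ := hn.exists
      simp [Bool.lt_iff] at h

/-- A normal function is increasing and continuous, so its inferior limit at `l` is its value there.
-/
theorem isLim_of_isNormal {l : Ordinal.{0}} (hl : IsSuccLimit l)
    {f : Ordinal.{0} → Ordinal.{0}} (hf : IsNormal f) : IsLim l f f (f l) := by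
  constructor
  · intro n hn
    obtain ⟨η, h1, h2⟩ := (hf.lt_iff_exists_lt hl).1 hn
    exact ⟨η, h1, fun s h3 _ ↦ h2.trans_le (hf.monotone h3)⟩
  · intro n hn
    obtain ⟨η, h1, h2⟩ := hn.exists
    exact h2.trans (hf.strictMono h1)

theorem isLim_id {l : Ordinal.{0}} (hl : IsSuccLimit l) : IsLim l (fun η ↦ η) (fun η ↦ η) l :=
  isLim_of_isNormal hl IsNormal.id

/-- `z` is, apart from the data, the limit along `l` of anything between `u` and `w`. -/
structure XLim (l : Ordinal.{0}) (u w : Ordinal.{0} → X) (z : X) : Prop where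
  q : IsLim l (fun η ↦ (u η).q) (fun η ↦ (w η).q) z.q
  hc : IsLim l (fun η ↦ (u η).hc) (fun η ↦ (w η).hc) z.hc
  hg : IsLim l (fun η ↦ (u η).hg) (fun η ↦ (w η).hg) z.hg
  hd : IsLim l (fun η ↦ (u η).hd) (fun η ↦ (w η).hd) z.hd
  hk : IsLim l (fun η ↦ (u η).hk) (fun η ↦ (w η).hk) z.hk
  B : ∀ j y, IsLim l (fun η ↦ (u η).B j y) (fun η ↦ (w η).B j y) (z.B j y)
  V : ∀ y, IsLim l (fun η ↦ (u η).V y) (fun η ↦ (w η).V y) (z.V y)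
  K : ∀ y, IsLim l (fun η ↦ (u η).K y) (fun η ↦ (w η).K y) (z.K y)
  f : IsLim l (fun η ↦ (u η).f) (fun η ↦ (w η).f) z.f
  s : IsLim l (fun η ↦ (u η).s) (fun η ↦ (w η).s) z.s

theorem IsLim.mark {l : Ordinal.{0}} (hl : IsSuccLimit l) {f g : Ordinal.{0} → Bool} {b : Bool}
    (h : IsLim l f g b) (y : Ordinal.{0}) :
    IsLim l (fun η ↦ mark (f η) y) (fun η ↦ mark (g η) y) (mark b y) := by
  by_cases hy : y = 0
  · simpa [OTM.mark, hy] using h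
  · simpa [OTM.mark, hy] using IsLim.const hl _

/-- Where lower and upper bounds have the same limit, the configuration is determined by squeezing.
Tape `7` holds the data; its contents are kept as they are and identified separately in each
application. -/
theorem XLim.cfg_eq {l : Ordinal.{0}} (hl : IsSuccLimit l) {f g : Ordinal.{0} → X} {z : X}
    (h : XLim l f g z) {c : Config 14} (h1 : ∀ a, (Ev l fun η ↦ (f η).cfg.Holds a) → c.Holds a)
    (h2 : ∀ a, c.Holds a → Ev l fun η ↦ (g η).cfg.Holds a) :
    c = { z with D := c.tape 7 }.cfg := by
  have key : ∀ i y (b : Bool),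
      IsLim l (fun η ↦ (f η).cfg.tape i y) (fun η ↦ (g η).cfg.tape i y) b → c.tape i y = b := by
    intro i y b hb
    refine Bool.eq_iff_iff.2 ⟨fun h ↦ ?_, fun h ↦ ?_⟩
    · have := hb.upper false ((h2 (.tape i y) h).mono fun η _ h ↦ ?_)
      · simpa [Bool.lt_iff] using this
      · rw [show (g η).cfg.tape i y = true from h]; decide
    · refine h1 (.tape i y) ((hb.lower false (by simp [h, Bool.lt_iff])).mono fun η _ h ↦ ?_)
      simpa [Bool.lt_iff, Config.Holds] using h
  ext1
  · exact h.q.eq (fun n ↦ h1 (.state n)) (fun n ↦ h2 (.state n))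
  · have hd : ∀ i (b : Ordinal.{0}),
        IsLim l (fun η ↦ (f η).cfg.head i) (fun η ↦ (g η).cfg.head i) b → c.head i = b :=
      fun i b hb ↦ hb.eq (fun n ↦ h1 (.head i n)) (fun n ↦ h2 (.head i n))
    have h0 := IsLim.const hl (0 : Ordinal.{0})
    funext i
    exact match i with
      | 0 => hd 0 _ h.hc | 1 => hd 1 _ h.hc | 2 => hd 2 _ h.hc | 3 => hd 3 _ h.hc
      | 4 => hd 4 _ h.hg | 5 => hd 5 _ h.hc | 6 => hd 6 _ h.hg | 7 => hd 7 _ h.hd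
      | 8 => hd 8 _ h.hd | 9 => hd 9 _ h.hd | 10 => hd 10 _ h.hk | 11 => hd 11 _ h.hk
      | 12 => hd 12 _ h0 | 13 => hd 13 _ h0
  · funext i y
    have hm := IsLim.const hl (mark true y)
    exact match i with
      | 0 => key 0 y _ (h.B 0 y) | 1 => key 1 y _ (h.B 1 y) | 2 => key 2 y _ (h.B 2 y)
      | 3 => key 3 y _ (h.B 3 y) | 4 => key 4 y _ (h.B 4 y) | 5 => key 5 y _ hm
      | 6 => key 6 y _ hm | 7 => rfl | 8 => key 8 y _ (h.V y) | 9 => key 9 y _ hm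
      | 10 => key 10 y _ (h.K y) | 11 => key 11 y _ hm | 12 => key 12 y _ (h.f.mark hl y)
      | 13 => key 13 y _ (h.s.mark hl y)

/-- Transfinite loops of the universal machine. -/
theorem exists_run_of_loop (I : Ordinal.{0} → X → Prop) (R : Ordinal.{0} → X → X → X → Prop)
    (m₀ x : X) (δ : Ordinal.{0}) (h₀ : I 0 x)
    (hs : ∀ η < δ, ∀ x, I η x → ∃ m u, R η x m u ∧ SReachU m u x (I (η + 1)))
    (hl : ∀ l ≤ δ, IsSuccLimit l → ∀ xs ms us : Ordinal.{0} → X,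
      (∀ η < l, I η (xs η) ∧ R η (xs η) (ms η) (us η)) → ∃ z, XLim l ms us z ∧ ∀ D,
        (∀ y, (Ev l fun η ↦ (ms η).D y = true) → D y = true) →
        (∀ y, D y = true → Ev l fun η ↦ (us η).D y = true) → I l { z with D := D })
    (hm : ∀ η < δ, ∀ x m u, I η x → R η x m u → m₀ ≤ m) (s : Ordinal.{0}) (hx : univ.run s = x.cfg) :
    ∃ s' ≥ s, δ ≤ s' ∧ ∃ y : X, I δ y ∧ univ.run s' = y.cfg ∧
      ∀ r ∈ Set.Ico s s', (m₀.cfg : Config univ.tapes) ≤ univ.run r := by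
  obtain ⟨s', h1, h2, ⟨y, h3, h4⟩, h5⟩ := univ.run_chain (fun η c ↦ ∃ x : X, I η x ∧ c = x.cfg)
    (fun η c m u ↦ ∃ x y z : X, I η x ∧ R η x y z ∧ c = x.cfg ∧ m = y.cfg ∧ u = z.cfg)
    m₀.cfg δ s ⟨x, h₀, hx⟩
    (by
      rintro η hη s ⟨x, hx, hc⟩
      obtain ⟨m, u, h1, h2⟩ := hs η hη x hx
      obtain ⟨s', h3, y, h4, h5, h6, h7⟩ := h2 s hc
      exact ⟨s', h3, ⟨y, h4, h5⟩, m.cfg, u.cfg, ⟨x, m, u, hx, h1, hc, rfl, rfl⟩, h6, h7⟩)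
    (by
      intro l hlδ hl' cs ms us cl h1 h2 h3
      have : Nonempty X := ⟨x⟩
      choose! xs ms' us' h4 h5 h5' h6 h7 using fun η hη ↦ (h1 η hη).2
      obtain ⟨z, hz, hz'⟩ := hl l hlδ hl' xs ms' us' (fun η hη ↦ ⟨h4 η hη, h5 η hη⟩)
      have h8 : ∀ a, (Ev l fun η ↦ (ms' η).cfg.Holds a) → cl.Holds a := fun a ha ↦
        h2 a (ha.mono fun η hη h ↦ by rw [h6 η hη]; exact h)
      have h9 : ∀ a, cl.Holds a → Ev l fun η ↦ (us' η).cfg.Holds a := fun a ha ↦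
        (h3 a ha).mono fun η hη h ↦ by rw [h7 η hη] at h; exact h
      exact ⟨_, hz' _ (fun y ↦ h8 (.tape (7 : Fin 14) y))
        (fun y ↦ h9 (.tape (7 : Fin 14) y)), hz.cfg_eq hl' h8 h9⟩)
    (by
      rintro η hη c m _ - ⟨x, y, z, h1, h2, -, rfl, -⟩
      exact X.cfg_le_cfg (hm η hη x y z h1 h2))
  exact ⟨s', h1, h2, y, h3, h4, h5⟩

theorem Reach.loop (I : Ordinal.{0} → X → Prop) (R : Ordinal.{0} → X → X → X → Prop)
    (m₀ x : X) (δ : Ordinal.{0}) (h₀ : I 0 x)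
    (hs : ∀ η < δ, ∀ x, I η x → ∃ m u, R η x m u ∧ SReachU m u x (I (η + 1)))
    (hl : ∀ l ≤ δ, IsSuccLimit l → ∀ xs ms us : Ordinal.{0} → X,
      (∀ η < l, I η (xs η) ∧ R η (xs η) (ms η) (us η)) → ∃ z, XLim l ms us z ∧ ∀ D,
        (∀ y, (Ev l fun η ↦ (ms η).D y = true) → D y = true) →
        (∀ y, D y = true → Ev l fun η ↦ (us η).D y = true) → I l { z with D := D })
    (hm : ∀ η < δ, ∀ x m u, I η x → R η x m u → m₀ ≤ m) : Reach m₀ x (I δ) := fun s hx ↦ by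
  obtain ⟨s', h1, -, h2⟩ := exists_run_of_loop I R m₀ x δ h₀ hs hl hm s hx
  exact ⟨s', h1, h2⟩

theorem XLim.congr {l : Ordinal.{0}} {f g f' g' : Ordinal.{0} → X} {z : X} (h : XLim l f g z)
    (hf : ∀ η < l, f' η = f η) (hg : ∀ η < l, g' η = g η) : XLim l f' g' z := by
  have key : ∀ {β : Type} [LT β] (π : X → β) {b : β},
      IsLim l (fun η ↦ π (f η)) (fun η ↦ π (g η)) b →
      IsLim l (fun η ↦ π (f' η)) (fun η ↦ π (g' η)) b := fun π b hb ↦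
    ⟨fun n hn ↦ (hb.lower n hn).mono fun η hη h ↦ by rwa [hf η hη],
      fun n hn ↦ hb.upper n (hn.mono fun η hη h ↦ by rwa [hg η hη] at h)⟩
  have key' : ∀ (π : X → Ordinal.{0}) {b : Ordinal.{0}},
      IsLim l (fun η ↦ π (f η)) (fun η ↦ π (g η)) b →
      IsLim l (fun η ↦ π (f' η)) (fun η ↦ π (g' η)) b := fun π b hb ↦
    ⟨fun n hn ↦ (hb.lower n hn).mono fun η hη h ↦ by rwa [hf η hη],
      fun n hn ↦ hb.upper n (hn.mono fun η hη h ↦ by rwa [hg η hη] at h)⟩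
  exact ⟨key X.q h.q, key' X.hc h.hc, key' X.hg h.hg, key' X.hd h.hd, key' X.hk h.hk,
    fun j y ↦ key (fun x ↦ x.B j y) (h.B j y), fun y ↦ key (fun x ↦ x.V y) (h.V y),
    fun y ↦ key (fun x ↦ x.K y) (h.K y), key X.f h.f, key X.s h.s⟩

/-- Loops whose configurations are known explicitly. -/
theorem Reach.loop_exact (c m : Ordinal.{0} → X) (m₀ : X) (δ : Ordinal.{0})
    (hs : ∀ η < δ, SReach (m η) (c η) (· = c (η + 1)))
    (hl : ∀ l ≤ δ, IsSuccLimit l → XLim l m c (c l) ∧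
      ∀ y, IsLim l (fun η ↦ (m η).D y) (fun η ↦ (c η).D y) ((c l).D y))
    (hm : ∀ η < δ, m₀ ≤ m η) : Reach m₀ (c 0) (· = c δ) := by
  refine Reach.loop (fun η x ↦ x = c η) (fun η _ y z ↦ y = m η ∧ z = c η) m₀ _ δ rfl ?_ ?_ ?_
  · rintro η hη _ rfl
    exact ⟨_, _, ⟨rfl, rfl⟩, (hs η hη).toU⟩
  · intro l hlδ hl' xs ms us h
    obtain ⟨h1, h2⟩ := hl l hlδ hl'
    refine ⟨c l, h1.congr (fun η hη ↦ (h η hη).2.1) (fun η hη ↦ (h η hη).2.2), fun D h3 h4 ↦ ?_⟩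
    have : D = (c l).D := by
      funext y
      refine Bool.eq_iff_iff.2 ⟨fun h5 ↦ ?_, fun h5 ↦ ?_⟩
      · have := (h2 y).upper false ((h4 y h5).mono fun η hη h' ↦ ?_)
        · simpa [Bool.lt_iff] using this
        · rw [(h η hη).2.2] at h'
          simp [h', Bool.lt_iff]
      · refine h3 y (((h2 y).lower false (by simp [h5, Bool.lt_iff])).mono fun η hη h' ↦ ?_)
        rw [(h η hη).2.1]
        simpa [Bool.lt_iff] using h'
    rw [this]
  · rintro η hη x m _ rfl ⟨rfl, -⟩
    exact hm η hη

/-! ### Head movements and the visited region -/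

@[simp] theorem Move.apply_stay (h : Ordinal.{0}) : Move.stay.apply h = h := rfl

@[simp] theorem Move.apply_right (h : Ordinal.{0}) : Move.right.apply h = h + 1 := rfl

theorem Move.apply_left_lt {h : Ordinal.{0}} (h0 : h ≠ 0) : Move.left.apply h < h := by
  induction h using Ordinal.limitRecOn with
  | zero => exact absurd rfl h0
  | add_one h _ => rw [Move.apply_left_add_one]; exact Order.lt_add_one_iff.2 le_rfl
  | limit h hl _ => rw [Move.apply_left_limit hl]; exact hl.bot_lt

theorem Move.apply_left_le (h : Ordinal.{0}) : Move.left.apply h ≤ h := by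
  rcases eq_or_ne h 0 with rfl | h0
  · rw [Move.apply_left_zero]
  · exact (Move.apply_left_lt h0).le

/-- The indicator function of the ordinals below `v`. -/
noncomputable def below (v y : Ordinal.{0}) : Bool := decide (y < v)

theorem below_mono {v w : Ordinal.{0}} (h : v ≤ w) : below v ≤ below w := fun y ↦ by
  refine Bool.le_iff_imp.2 fun h' ↦ ?_
  simp only [below, decide_eq_true_eq] at h' ⊢
  exact h'.trans_le h

theorem IsLim.below {l : Ordinal.{0}} {f g : Ordinal.{0} → Ordinal.{0}} {b : Ordinal.{0}}
    (h : IsLim l f g b) (y : Ordinal.{0}) :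
    IsLim l (fun η ↦ below (f η) y) (fun η ↦ below (g η) y) (below b y) := by
  refine isLim_bool (fun hb ↦ ?_) (fun hb ↦ ?_)
  · simp only [OTM.below, decide_eq_true_eq] at hb ⊢
    exact h.lower y hb
  · simp only [OTM.below, decide_eq_true_eq] at hb ⊢
    exact h.upper y hb

/-- Visiting a cell inside or just beyond the visited region keeps that region an initial segment.
-/
theorem update_below {v x : Ordinal.{0}} (h : x ≤ v) :
    Function.update (below v) x true = below (max v (x + 1)) := by
  funext y
  rcases eq_or_ne y x with rfl | hy
  · simp [below]
  · rw [Function.update_of_ne hy]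
    simp only [below, lt_max_iff, decide_eq_decide, Order.lt_add_one_iff]
    exact ⟨Or.inl, fun h' ↦ h'.elim id fun h' ↦ (lt_of_le_of_ne h' hy).trans_le h⟩

/-- Moving heads back to their starting positions. -/
theorem Reach.descend {σ : Type*} [PartialOrder σ] [WellFoundedLT σ] {m : X} {p : X → Prop}
    (c : σ → X) (nx : σ → σ) (z : σ) (h1 : ∀ a, a ≠ z → nx a < a)
    (h2 : ∀ a, a ≠ z → (c a).next = some (c (nx a)))
    (hm : ∀ a, m ≤ c a) (hz : Reach m (c z) p) (a : σ) : Reach m (c a) p := by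
  -- Each step strictly decreases the positions, so the return takes finitely many steps, however
  -- far away the heads are, and meets no limit time.
  induction a using WellFoundedLT.induction with
  | ind a ih =>
    rcases eq_or_ne a z with rfl | ha
    · exact hz
    · exact Reach.step _ (h2 a ha) (hm a) (ih _ (h1 a ha))

/-- The configurations of the universal machine while it interprets `B` with the clock `α`. -/
noncomputable def interp (B : Fin 5 → Ordinal.{0} → Bool) (α : Ordinal.{0}) (q : ℕ)
    (hc hg hd hk : Ordinal.{0}) (D : Ordinal.{0} → Bool) (v : Ordinal.{0}) : X where
  q := q
  hc := hc
  hg := hg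
  hd := hd
  hk := hk
  B := B
  D := D
  V := below v
  K := below α
  f := true
  s := false

theorem interp_mono {B : Fin 5 → Ordinal.{0} → Bool} {α : Ordinal.{0}} {q q' : ℕ}
    {hc hg hd hk v hc' hg' hd' hk' v' : Ordinal.{0}} {D D' : Ordinal.{0} → Bool} (h1 : q ≤ q')
    (h2 : hc ≤ hc') (h3 : hg ≤ hg') (h4 : hd ≤ hd') (h5 : hk ≤ hk') (h6 : D ≤ D') (h7 : v ≤ v') :
    interp B α q hc hg hd hk D v ≤ interp B α q' hc' hg' hd' hk' D' v' :=
  ⟨h1, h2, h3, h4, h5, le_rfl, h6, below_mono h7, le_rfl, le_rfl, le_rfl⟩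

/-! ### Semantics and interpretation of single instructions -/

/-- The state of a straight-line program. -/
structure Mem where
  D : Ordinal.{0} → Bool
  x : Ordinal.{0}
  skip : Bool

/-- The number of strides of length `k` from `x` to the next `0` at offset `i`. -/
noncomputable def gapIndex (k : Ordinal.{0}) (i : ℕ) (D : Ordinal.{0} → Bool) (x : Ordinal.{0}) :
    Ordinal.{0} :=
  sInf {η | D (x + k * η + i) = false}

open Classical in
/-- `D`, with the cells at offset `i` after less than `n` strides from `x` erased. -/
noncomputable def eraseRun (k : Ordinal.{0}) (i : ℕ) (D : Ordinal.{0} → Bool)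
    (x n : Ordinal.{0}) : Ordinal.{0} → Bool :=
  fun y ↦ if ∃ η < n, y = x + k * η + i then false else D y

/-- The execution of an instruction, where `k` is the length of a stride and `i` is the number
of instructions `right` that follow it. -/
noncomputable def Op.exec (k : Ordinal.{0}) (i : ℕ) (o : Op) (a : Mem) : Mem :=
  if a.skip then { a with skip := decide (o ≠ .nop) } else
  match o with
  | .halt => a
  | .right => { a with x := a.x + 1 }
  | .left => { a with x := Move.left.apply a.x }
  | .clear => { a with D := Function.update a.D a.x false }
  | .set => { a with D := Function.update a.D a.x true }
  | .test => { a with skip := !a.D a.x }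
  | .testNot => { a with skip := a.D a.x }
  | .reset => { a with x := 0 }
  | .seek => { a with x := a.x + k * gapIndex k i a.D a.x }
  | .erase => { a with
      D := eraseRun k i a.D a.x (gapIndex k i a.D a.x), x := a.x + k * gapIndex k i a.D a.x }
  | .idle => a
  | .nop => a

/-- All data and the pointer lie in the visited region. -/
def Mem.Within (a : Mem) (v : Ordinal.{0}) : Prop :=
  a.x ≤ v ∧ ∀ y, a.D y = true → y < v

/-- The data lie below `v`, so `v` strides lead out of them and the search for a `0` succeeds. -/
theorem gapIndex_spec {k : Ordinal.{0}} (hk : 0 < k) (i : ℕ) {D : Ordinal.{0} → Bool}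
    {v : Ordinal.{0}} (hD : ∀ y, D y = true → y < v) (x : Ordinal.{0}) :
    D (x + k * gapIndex k i D x + i) = false := by
  have hne : {η | D (x + k * η + i) = false}.Nonempty := by
    refine ⟨v, ?_⟩
    by_contra h
    have h1 := hD _ (by simpa using h)
    have h2 : v ≤ k * v := by simpa using mul_le_mul_left (Order.one_le_iff_pos.2 hk) v
    exact absurd h1 (not_lt.2 (h2.trans (le_add_self.trans le_self_add)))
  exact csInf_mem hne

theorem lt_gapIndex {k : Ordinal.{0}} {i : ℕ} {D : Ordinal.{0} → Bool} {x η : Ordinal.{0}}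
    (h : η < gapIndex k i D x) : D (x + k * η + i) = true := by
  have := notMem_of_lt_csInf' h
  simpa using this

theorem decode_interp (B : Fin 5 → Ordinal.{0} → Bool) (α : Ordinal.{0}) (q : ℕ)
    (hc hg hd hk : Ordinal.{0}) (D : Ordinal.{0} → Bool) (v : Ordinal.{0}) :
    Op.decode (interp B α q hc hg hd hk D v).scan.b = Op.decode fun j ↦ B j hc := rfl

section
variable {B : Fin 5 → Ordinal.{0} → Bool} {α : Ordinal.{0}} {m : X} {p : X → Prop} {g : ℕ}

theorem Reach.resetPointer {hc hd hk v : Ordinal.{0}} {D : Ordinal.{0} → Bool}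
    (hm : m ≤ interp B α 3 hc 0 0 hk D v) (h : Reach m (interp B α 3 hc 0 0 hk D v) p) :
    Reach m (interp B α 13 hc 0 hd hk D v) p := by
  refine Reach.descend (fun hd ↦ interp B α 13 hc 0 hd hk D v) Move.left.apply 0
    (fun a ha ↦ Move.apply_left_lt ha) (fun a ha ↦ ?_) (fun a ↦ ?_) ?_ hd
  · simp [X.next, table, X.app, Scan.go, interp, X.scan, X.hb, ha]
  · exact X.le_trans hm (interp_mono (by decide) le_rfl le_rfl zero_le le_rfl le_rfl le_rfl)
  · refine Reach.step (interp B α 3 hc 0 0 hk D v) ?_ ?_ h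
    · simp [X.next, table, X.app, Scan.go, interp, X.scan, X.hb]
    · exact X.le_trans hm (interp_mono (by decide) le_rfl le_rfl le_rfl le_rfl le_rfl le_rfl)

/-- Outside the skipping mode the universal machine reads `o`, followed by `i` times `right`. -/
structure Follows (B : Fin 5 → Ordinal.{0} → Bool) (hc : Ordinal.{0}) (o : Op) (i : ℕ) : Prop where
  decode : Op.decode (fun j ↦ B j hc) = o
  right : ∀ n < i, Op.decode (fun j ↦ B j (hc + 1 + n)) = .right
  ne_right : Op.decode (fun j ↦ B j (hc + 1 + i)) ≠ .right

variable {hc hk y : Ordinal.{0}} {D D' : Ordinal.{0} → Bool} {o : Op} {i : ℕ}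

theorem le_interp_of_le {q : ℕ} {hc' hg' hd' v v' : Ordinal.{0}}
    (hm : m ≤ interp B α 3 hc 0 y hk D' v) (hq : 3 ≤ q) (hcc : hc ≤ hc') (hy : y ≤ hd')
    (hD : D' ≤ D) (hv : v ≤ v') : m ≤ interp B α q hc' hg' hd' hk D v' :=
  X.le_trans hm (interp_mono hq hcc zero_le hy le_rfl hD hv)

/-- The look-ahead of `seek` and `erase`: the `i` instructions `right` move both heads to the cell
to be tested. -/
theorem Reach.walk {v w : Ordinal.{0}} (hB : Follows B hc o i) (q : ℕ) (hq : q = 14 ∨ q = 15)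
    (hm : m ≤ interp B α 3 hc 0 y hk D' v) (hD : D' ≤ D) (hvw : v ≤ w)
    (n : ℕ) (hn : n ≤ i) (hw : y + n ≤ w)
    (h : ∀ w', v ≤ w' → y + i ≤ w' → Reach m (interp B α q (hc + 1 + i) 0 (y + i) hk D w') p) :
    Reach m (interp B α q (hc + 1 + n) 0 (y + n) hk D w) p := by
  obtain ⟨e, rfl⟩ := Nat.exists_eq_add_of_le hn
  induction e generalizing n w with
  | zero => exact h w hvw hw
  | succ e ih =>
    have hup := update_below hw
    have hr := hB.right n (by omega)
    have h1 : y + n + 1 = y + (n + 1 : ℕ) := by push_cast; rw [add_assoc]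
    have h2 : hc + 1 + n + 1 = hc + 1 + (n + 1 : ℕ) := by push_cast; rw [add_assoc]
    have h3 : n + 1 + e = n + (e + 1) := by ring
    rw [h1] at hup
    have h4 : 3 ≤ q := by omega
    have h5 : hc ≤ hc + 1 + n := by rw [add_assoc]; exact le_self_add
    refine Reach.step (interp B α q (hc + 1 + (n + 1 : ℕ)) 0 (y + (n + 1 : ℕ)) hk D
      (max w (y + (n + 1 : ℕ)))) ?_ (le_interp_of_le hm h4 h5 le_self_add hD hvw)
      (ih (hvw.trans (le_max_left _ _)) (n + 1) (le_max_right _ _)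
        (by rw [h3]; exact hB) (by omega) (by rw [h3]; exact h))
    unfold X.next
    rw [show (interp B α q (hc + 1 + n) 0 (y + n) hk D w).q = q from rfl]
    rcases hq with rfl | rfl
    all_goals
      simp only [table, decode_interp, hr, if_true, Option.map_some]
      simp only [X.app, Scan.go, interp, X.scan,
        X.hb, Move.apply_stay, Move.apply_right, Function.update_eq_self, hup, h1, h2]

/-- Undoes the look-ahead. In state `16` the instruction is about to be repeated; in state `17` it
is left, and the instructions `right` are then executed in the ordinary way. -/
theorem Reach.walkBack {v w z : Ordinal.{0}} (hB : Follows B hc o i) (ho : o ≠ .right) (q : ℕ)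
    (hq : q = 16 ∨ q = 17) (hm : m ≤ interp B α 3 hc 0 y hk D v) (hz : y ≤ z) (hvw : v ≤ w)
    (h : Reach m (interp B α 3 (if q = 16 then hc else hc + 1) 0 z hk D w) p) (n : ℕ) (hn : n ≤ i) :
    Reach m (interp B α q (hc + n) 0 (z + n) hk D w) p := by
  have hq3 : 3 ≤ q := by omega
  induction n with
  | zero =>
    simp only [Nat.cast_zero, add_zero]
    refine Reach.step _ ?_ (le_interp_of_le hm hq3 le_rfl hz le_rfl hvw) h
    unfold X.next
    rw [show (interp B α q hc 0 z hk D w).q = q from rfl]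
    rcases hq with rfl | rfl
    all_goals
      simp only [table, decode_interp, hB.decode, ho]
      simp [X.app, Scan.go, interp, X.scan, X.hb]
  | succ n ih =>
    have hr := hB.right n (by omega)
    have h1 : z + (n + 1 : ℕ) = z + n + 1 := by push_cast; rw [add_assoc]
    have h2 : hc + (n + 1 : ℕ) = hc + n + 1 := by push_cast; rw [add_assoc]
    have h3 : hc + n + 1 = hc + 1 + n := by
      rw [add_assoc, add_assoc]
      congr 1
      exact_mod_cast Nat.add_comm n 1
    rw [← h3] at hr
    rw [h1, h2]
    have h4 : hc ≤ hc + n + 1 := by rw [add_assoc]; exact le_self_add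
    have h5 : z ≤ z + n + 1 := by rw [add_assoc]; exact le_self_add
    refine Reach.step _ ?_ (le_interp_of_le hm hq3 h4 (hz.trans h5) le_rfl hvw) (ih (by omega))
    unfold X.next
    rw [show (interp B α q (hc + n + 1) 0 (z + n + 1) hk D w).q = q from rfl]
    rcases hq with rfl | rfl
    all_goals
      simp only [table, decode_interp, hr, if_true, Option.map_some]
      simp only [X.app, Scan.go, interp, X.scan,
        X.hb, Move.apply_stay, Move.apply_left_add_one, Function.update_eq_self]

theorem Move.apply_left_add_natCast (x : Ordinal.{0}) (n : ℕ) :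
    Move.left.apply (x + 1 + n) = x + n := by
  have : x + 1 + n = x + n + 1 := by
    rw [add_assoc, add_assoc]
    congr 1
    exact_mod_cast Nat.add_comm 1 n
  rw [this, Move.apply_left_add_one]

theorem Reach.returnStride {hd v : Ordinal.{0}} (n : Ordinal.{0}) (hc' : Ordinal.{0})
    (hm : ∀ q ≥ 6, ∀ n, m ≤ interp B α q hc' n hd hk D v)
    (h : Reach m (interp B α 16 (Move.left.apply hc') 0 hd hk D v) p) :
    Reach m (interp B α 6 hc' n hd hk D v) p := by
  refine Reach.descend (fun n ↦ interp B α 6 hc' n hd hk D v) Move.left.apply 0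
    (fun a ha ↦ Move.apply_left_lt ha) (fun a ha ↦ ?_) (fun a ↦ hm 6 le_rfl a) ?_ n
  · simp [X.next, table, X.app, Scan.go, interp, X.scan, X.hb, ha]
  · refine Reach.step _ ?_ (hm 6 le_rfl 0) h
    simp [X.next, table, X.app, Scan.go, interp, X.scan, X.hb]

/-- These `g` moves follow the one made on entering state `5`, hence strides of length `g + 1`. -/
theorem Reach.advance {z v w : Ordinal.{0}} (hg1 : ∀ i < g, B 4 i = true) (hg2 : B 4 g = false)
    (hc' : Ordinal.{0}) (hm : m ≤ interp B α 3 hc 0 y hk D v) (hc'' : hc ≤ hc') (hz : y ≤ z)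
    (hvw : v ≤ w) (n : ℕ) (hn : n ≤ g) (hw : z + n ≤ w)
    (h : ∀ w', v ≤ w' → z + g ≤ w' →
      Reach m (interp B α 16 (Move.left.apply hc') 0 (z + g) hk D w') p) :
    Reach m (interp B α 5 hc' n (z + n) hk D w) p := by
  obtain ⟨e, he⟩ := Nat.exists_eq_add_of_le hn
  induction e generalizing n w with
  | zero =>
    obtain rfl : n = g := he.symm
    have hle : ∀ q ≥ 5, ∀ n', m ≤ interp B α q hc' n' (z + n) hk D w := fun q hq n' ↦
      le_interp_of_le hm (by omega) hc'' (hz.trans le_self_add) le_rfl hvw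
    refine Reach.step (interp B α 6 hc' n (z + n) hk D w) ?_ (hle 5 le_rfl _) ?_
    · have : B 4 n = false := hg2
      simp [X.next, table, X.app, Scan.go, interp, X.scan, X.hb, this]
    · exact Reach.returnStride _ _ (fun q hq n' ↦ hle q (by omega) n') (h w hvw hw)
  | succ e ih =>
    have hup := update_below hw
    have h1 : z + n + 1 = z + (n + 1 : ℕ) := by push_cast; rw [add_assoc]
    have h2 : (n : Ordinal.{0}) + 1 = (n + 1 : ℕ) := by push_cast; rfl
    rw [h1] at hup
    refine Reach.step (interp B α 5 hc' (n + 1 : ℕ) (z + (n + 1 : ℕ)) hk D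
      (max w (z + (n + 1 : ℕ)))) ?_
      (le_interp_of_le hm (by decide) hc'' (hz.trans le_self_add) le_rfl hvw)
      (ih (hvw.trans (le_max_left _ _)) (n + 1) (by omega) (le_max_right _ _) (by omega))
    have hb := hg1 n (by rw [he]; simp)
    simp only [interp, X.next, table, X.scan, X.hb, hb, Scan.go, X.app, h1, h2, hup,
      if_true, Option.map_some, Move.apply_stay, Move.apply_right, Function.update_eq_self]

theorem update_false_le (D : Ordinal.{0} → Bool) (y : Ordinal.{0}) :
    Function.update D y false ≤ D := fun z ↦ by
  rcases eq_or_ne z y with rfl | hz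
  · rw [Function.update_self]
    exact Bool.false_le _
  · rw [Function.update_of_ne hz]

/-- One round of the loop that is executed by `seek` and `erase`. -/
theorem SReach.stride {v : Ordinal.{0}} (hg1 : ∀ i < g, B 4 i = true) (hg2 : B 4 g = false)
    (hB : Follows B hc o i) (ho : o = .seek ∧ D' = D ∨
      o = .erase ∧ D' = Function.update D (y + i) false) (hy : y ≤ v) (hyi : D (y + i) = true)
    (hm : m ≤ interp B α 3 hc 0 y hk D' v)
    (h : ∀ v', v ≤ v' → y + (g + 1 : ℕ) ≤ v' →
      Reach m (interp B α 3 hc 0 (y + (g + 1 : ℕ)) hk D' v') p) :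
    SReach m (interp B α 3 hc 0 y hk D v) p := by
  have hD : D' ≤ D := by
    rcases ho with ⟨-, rfl⟩ | ⟨-, rfl⟩
    · exact le_rfl
    · exact update_false_le _ _
  have hor : o ≠ .right := by rcases ho with ⟨rfl, -⟩ | ⟨rfl, -⟩ <;> decide
  obtain ⟨q, hq', h1⟩ : ∃ q, (q = 14 ∧ D' = D ∨ q = 15 ∧ D' = Function.update D (y + i) false) ∧
      ∀ w, y ≤ w →
      (interp B α 3 hc 0 y hk D w).next = some (interp B α q (hc + 1) 0 y hk D (max w (y + 1))) := by
    rcases ho with ⟨rfl, h0⟩ | ⟨rfl, h0⟩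
    · refine ⟨14, Or.inl ⟨rfl, h0⟩, fun w hw ↦ ?_⟩
      have hup := update_below hw
      unfold X.next
      rw [show (interp B α 3 hc 0 y hk D w).q = 3 from rfl]
      simp only [table, decode_interp, hB.decode]
      simp [X.app, Scan.go, interp, X.scan, X.hb, hup]
    · refine ⟨15, Or.inr ⟨rfl, h0⟩, fun w hw ↦ ?_⟩
      have hup := update_below hw
      unfold X.next
      rw [show (interp B α 3 hc 0 y hk D w).q = 3 from rfl]
      simp only [table, decode_interp, hB.decode]
      simp [X.app, Scan.go, interp, X.scan, X.hb, hup]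
  have hq : q = 14 ∨ q = 15 := hq'.imp And.left And.left
  have h3 : y + (g + 1 : ℕ) = y + 1 + g := by
    rw [add_assoc]
    congr 1
    exact_mod_cast Nat.add_comm g 1
  refine SReach.step _ (h1 v hy) (X.le_trans hm (interp_mono le_rfl le_rfl le_rfl le_rfl le_rfl hD
    le_rfl)) ?_
  have key := Reach.walk (p := p) (D := D) (w := max v (y + 1)) hB q hq hm hD (le_max_left _ _) 0
    (Nat.zero_le _) (by simp) fun w hw hw' ↦ ?_
  · simpa using key
  have h2 : (interp B α q (hc + 1 + i) 0 (y + i) hk D w).next =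
      some (interp B α 5 (hc + 1 + i) 0 (y + i + 1) hk D' (max w (y + i + 1))) := by
    have hup := update_below hw'
    unfold X.next
    rw [show (interp B α q (hc + 1 + i) 0 (y + i) hk D w).q = q from rfl]
    rcases hq' with ⟨rfl, h0⟩ | ⟨rfl, h0⟩
    · simp only [table, decode_interp, hB.ne_right, if_false]
      simp [X.app, Scan.go, interp, X.scan, X.hb, hup, hyi, h0]
    · simp only [table, decode_interp, hB.ne_right, if_false]
      simp [X.app, Scan.go, interp, X.scan, X.hb, hup, hyi, h0]
  have h4 : hc ≤ hc + 1 + i := by rw [add_assoc]; exact le_self_add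
  have h5 : y + i + 1 = y + 1 + i := by
    rw [add_assoc, add_assoc]
    congr 1
    exact_mod_cast Nat.add_comm i 1
  refine Reach.step _ h2 (le_interp_of_le hm (by omega) h4 le_self_add hD hw) ?_
  have key := Reach.advance (p := p) (z := y + i + 1) (w := max w (y + i + 1)) hg1 hg2
    (hc + 1 + i) hm h4 (by rw [add_assoc]; exact le_self_add) (hw.trans (le_max_left _ _)) 0
    (Nat.zero_le _) (by simp) fun w' hw hw' ↦ ?_
  · simpa using key
  have h6 : y + i + 1 + g = y + (g + 1 : ℕ) + i := by
    rw [h3, h5, add_assoc, add_assoc (y + 1)]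
    congr 1
    exact_mod_cast Nat.add_comm i g
  rw [Move.apply_left_add_natCast, h6]
  rw [h6] at hw'
  exact Reach.walkBack hB hor 16 (Or.inl rfl) hm le_self_add hw
    (by simpa using h w' hw (le_self_add.trans hw')) i le_rfl

theorem Reach.exitStride {v : Ordinal.{0}}
    (hB : Follows B hc o i) (ho : o = .seek ∨ o = .erase) (hy : y ≤ v) (hyi : D (y + i) = false)
    (hm : m ≤ interp B α 3 hc 0 y hk D v)
    (h : ∀ v', v ≤ v' → y ≤ v' → Reach m (interp B α 3 (hc + 1) 0 y hk D v') p) :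
    Reach m (interp B α 3 hc 0 y hk D v) p := by
  have h1 : (interp B α 3 hc 0 y hk D v).next = some
      (interp B α (if o = .seek then 14 else 15) (hc + 1) 0 y hk D (max v (y + 1))) := by
    have hup := update_below hy
    unfold X.next
    rw [show (interp B α 3 hc 0 y hk D v).q = 3 from rfl]
    rcases ho with rfl | rfl
    all_goals
      simp only [table, decode_interp, hB.decode]
      simp [X.app, Scan.go, interp, X.scan, X.hb, hup]
  refine Reach.step _ h1 hm ?_
  have key := Reach.walk (p := p) (D := D) (w := max v (y + 1)) hB (if o = .seek then 14 else 15)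
    (by split_ifs <;> simp) hm le_rfl (le_max_left _ _) 0
    (Nat.zero_le _) (by simp) fun w hw hw' ↦ ?_
  · simpa using key
  have h2 : (interp B α (if o = .seek then 14 else 15) (hc + 1 + i) 0 (y + i) hk D w).next =
      some (interp B α 17 (hc + i) 0 (y + i) hk D w) := by
    unfold X.next
    rw [show (interp B α (if o = .seek then 14 else 15) (hc + 1 + i) 0 (y + i) hk D w).q =
      (if o = .seek then 14 else 15) from rfl]
    rcases ho with rfl | rfl
    · simp only [if_true, table, decode_interp, hB.ne_right, if_false]
      simp [X.app, Scan.go, interp, X.scan, X.hb, hyi, Move.apply_left_add_natCast]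
    · simp only [reduceCtorEq, table, decode_interp, hB.ne_right, if_false]
      simp [X.app, Scan.go, interp, X.scan, X.hb, hyi, Move.apply_left_add_natCast]
  have h4 : hc ≤ hc + 1 + i := by rw [add_assoc]; exact le_self_add
  refine Reach.step _ h2 (le_interp_of_le hm (by split_ifs <;> decide) h4 le_self_add le_rfl hw)
    (Reach.walkBack hB (by rcases ho with rfl | rfl <;> decide) 17 (Or.inr rfl) hm le_rfl hw
    (by simpa using h w hw (hy.trans hw)) i le_rfl)

/-- Used for the bounds of the visited region, whose precise limit is irrelevant: the inferior limit
always exists. -/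
theorem exists_isLim {t : Ordinal.{0}} (vs : Ordinal.{0} → Ordinal.{0}) :
    ∃ v, IsLim t vs vs v := by
  refine ⟨sInf {v | ∀ n, (Ev t fun s ↦ n < vs s) → n < v}, fun n hn ↦ ?_, ?_⟩
  · by_contra hev
    refine absurd hn (not_lt.2 (csInf_le' fun n' hn' ↦ ?_))
    by_contra! hle
    exact hev (hn'.mono fun s _ h ↦ lt_of_le_of_lt hle h)
  · refine csInf_mem (s := {v | ∀ n, (Ev t fun s ↦ n < vs s) → n < v})
      ⟨⨆ s : Set.Iio t, vs s.1, fun n hn ↦ ?_⟩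
    obtain ⟨s, hst, h5⟩ := hn.exists
    exact h5.trans_le (Ordinal.le_iSup (fun s : Set.Iio t ↦ vs s.1) ⟨s, hst⟩)

/-- The loop that is executed by `seek` and `erase`. -/
theorem Reach.strideLoop {x v : Ordinal.{0}} (hg1 : ∀ i < g, B 4 i = true) (hg2 : B 4 g = false)
    (hB : Follows B hc o i) (ho : o = .seek ∨ o = .erase)
    (D : Ordinal.{0} → Ordinal.{0} → Bool) (N : Ordinal.{0}) (hx : x ≤ v)
    (hD : Antitone D) (hDl : ∀ l, IsSuccLimit l → ∀ y, (∀ η < l, D η y = true) → D l y = true)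
    (hs : ∀ η < N, D η (x + (g + 1 : ℕ) * η + i) = true ∧ (o = .seek ∧ D (η + 1) = D η ∨
      o = .erase ∧ D (η + 1) = Function.update (D η) (x + (g + 1 : ℕ) * η + i) false))
    (hN : D N (x + (g + 1 : ℕ) * N + i) = false)
    (hm : m ≤ interp B α 3 hc 0 x hk (D N) v)
    (h : ∀ v', v ≤ v' → x + (g + 1 : ℕ) * N ≤ v' →
      Reach m (interp B α 3 (hc + 1) 0 (x + (g + 1 : ℕ) * N) hk (D N) v') p) :
    Reach m (interp B α 3 hc 0 x hk (D 0) v) p := by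
  have hn : IsNormal fun η : Ordinal.{0} ↦ x + (g + 1 : ℕ) * η :=
    (Ordinal.isNormal_add_right x).comp (Ordinal.isNormal_mul_right (by simp))
  have key := Reach.loop (m₀ := m)
    (fun η z ↦ ∃ w, v ≤ w ∧ x + (g + 1 : ℕ) * η ≤ w ∧
      z = interp B α 3 hc 0 (x + (g + 1 : ℕ) * η) hk (D η) w)
    -- The lower bound uses `D (η + 1)` because the tested cell may be erased in the middle of round
    -- `η`; antitonicity gives both bounds the same limit.
    (fun η z m u ↦ ∃ w, v ≤ w ∧ x + (g + 1 : ℕ) * η ≤ w ∧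
      z = interp B α 3 hc 0 (x + (g + 1 : ℕ) * η) hk (D η) w ∧
      m = interp B α 3 hc 0 (x + (g + 1 : ℕ) * η) hk (D (η + 1)) w ∧
      u = interp B α 3 hc 0 (x + (g + 1 : ℕ) * η) hk (D η) w)
    (interp B α 3 hc 0 x hk (D 0) v) N ⟨v, le_rfl, by simpa using hx, by simp⟩ ?_ ?_ ?_
  · refine key.trans ?_
    rintro _ ⟨w, hw, hw', rfl⟩
    exact Reach.exitStride hB ho hw' hN (X.le_trans hm (interp_mono le_rfl le_rfl le_rfl
      le_self_add le_rfl le_rfl hw)) fun v' hv' hv'' ↦ h v' (hw.trans hv') hv''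
  · rintro η hη _ ⟨w, hw, hw', rfl⟩
    refine ⟨_, _, ⟨w, hw, hw', rfl, rfl, rfl⟩, SReach.toU (SReach.stride hg1 hg2 hB (hs η hη).2 hw'
      (hs η hη).1 (interp_mono le_rfl le_rfl le_rfl le_rfl le_rfl le_rfl le_rfl) fun v' hv' hv'' ↦ Reach.refl ⟨v', hw.trans hv', ?_, ?_⟩)⟩
    · rwa [mul_add_one, ← add_assoc]
    · rw [mul_add_one, ← add_assoc]
  · intro l hl hl' xs ms us h1
    choose! vs h2 h3 h3' h4 h5 using fun η hη ↦ (h1 η hη).2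
    obtain ⟨w, hw⟩ := exists_isLim (t := l) vs
    refine ⟨interp B α 3 hc 0 (x + (g + 1 : ℕ) * l) hk (D l) w,
      XLim.congr (f := fun η ↦ interp B α 3 hc 0 (x + (g + 1 : ℕ) * η) hk (D (η + 1)) (vs η))
      (g := fun η ↦ interp B α 3 hc 0 (x + (g + 1 : ℕ) * η) hk (D η) (vs η))
      ⟨.const hl' _, .const hl' _, .const hl' _, isLim_of_isNormal hl' hn, .const hl' _,
      fun _ _ ↦ .const hl' _, hw.below, fun _ ↦ .const hl' _, .const hl' _, .const hl' _⟩ h4 h5,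
      fun D' h6 h7 ↦ ⟨w, ?_, ?_, ?_⟩⟩
    · exact le_of_forall_lt fun n hn' ↦ hw.upper n (Ev.of_forall hl' fun η hη ↦
        hn'.trans_le (h2 η hη))
    · exact le_of_forall_lt fun n hn' ↦ hw.upper n (((isLim_of_isNormal hl' hn).lower n hn').mono
        fun η hη h ↦ h.trans_le (h3 η hη))
    · have : D' = D l := by
        funext y
        refine Bool.eq_iff_iff.2 ⟨fun h8 ↦ hDl l hl' y fun η hη ↦ ?_, fun h8 ↦ h6 y ?_⟩
        · obtain ⟨s, h9, h10⟩ := h7 y h8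
          have h11 : (us (max s η)).D y = true := h10 _ (le_max_left _ _) (max_lt h9 hη)
          rw [h5 _ (max_lt h9 hη)] at h11
          exact Bool.le_iff_imp.1 (hD (le_max_right s η) y) h11
        · refine Ev.of_forall hl' fun η hη ↦ ?_
          rw [h4 η hη]
          exact Bool.le_iff_imp.1 (hD (hl'.add_one_lt hη).le y) h8
      rw [this]
      rfl
  · rintro η hη _ _ _ - ⟨w, hw, -, -, rfl, -⟩
    exact X.le_trans hm (interp_mono le_rfl le_rfl le_rfl le_self_add le_rfl
      (hD (Order.add_one_le_iff.2 hη)) hw)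

end

theorem eraseRun_zero (k : Ordinal.{0}) (i : ℕ) (D : Ordinal.{0} → Bool) (x : Ordinal.{0}) :
    eraseRun k i D x 0 = D := by
  funext y
  simp [eraseRun]

theorem eraseRun_le (k : Ordinal.{0}) (i : ℕ) (D : Ordinal.{0} → Bool) (x n : Ordinal.{0}) :
    eraseRun k i D x n ≤ D := fun y ↦ by
  unfold eraseRun
  split_ifs
  · exact Bool.false_le _
  · exact le_rfl

theorem eraseRun_antitone (k : Ordinal.{0}) (i : ℕ) (D : Ordinal.{0} → Bool) (x : Ordinal.{0}) :
    Antitone (eraseRun k i D x) := fun a b hab y ↦ by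
  unfold eraseRun
  split_ifs with h1 h2
  · exact le_rfl
  · exact Bool.false_le _
  · rename_i h2
    obtain ⟨η, h3, h4⟩ := h2
    exact absurd ⟨η, h3.trans_le hab, h4⟩ h1
  · exact le_rfl

theorem eraseRun_limit {k : Ordinal.{0}} {i : ℕ} {D : Ordinal.{0} → Bool} {x l : Ordinal.{0}}
    (hl : IsSuccLimit l) {y : Ordinal.{0}} (h : ∀ η < l, eraseRun k i D x η y = true) :
    eraseRun k i D x l y = true := by
  unfold eraseRun at h ⊢
  split_ifs with h1
  · obtain ⟨η, h2, h3⟩ := h1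
    have := h (η + 1) (hl.add_one_lt h2)
    rw [if_pos ⟨η, Order.lt_add_one_iff.2 le_rfl, h3⟩] at this
    exact absurd this Bool.false_ne_true
  · have := h 0 hl.bot_lt
    simpa using this

theorem eraseRun_add_one (k : Ordinal.{0}) (i : ℕ) (D : Ordinal.{0} → Bool) (x n : Ordinal.{0}) :
    eraseRun k i D x (n + 1) = Function.update (eraseRun k i D x n) (x + k * n + i) false := by
  funext y
  by_cases hy : y = x + k * n + i
  · rw [hy, Function.update_self]
    exact if_pos ⟨n, Order.lt_add_one_iff.2 le_rfl, rfl⟩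
  · rw [Function.update_of_ne hy]
    unfold eraseRun
    congr 1
    refine propext ⟨?_, ?_⟩
    · rintro ⟨η, h1, h2⟩
      refine ⟨η, lt_of_le_of_ne (Order.lt_add_one_iff.1 h1) ?_, h2⟩
      rintro rfl
      exact hy h2
    · rintro ⟨η, h1, h2⟩
      exact ⟨η, h1.trans (Order.lt_add_one_iff.2 le_rfl), h2⟩

theorem strictMono_stride (x : Ordinal.{0}) (g i : ℕ) :
    StrictMono fun η : Ordinal.{0} ↦ x + (g + 1 : ℕ) * η + i := fun a b hab ↦ by
  have h1 : x + (g + 1 : ℕ) * (a + 1) ≤ x + (g + 1 : ℕ) * b := by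
    gcongr
    exact Order.add_one_le_iff.2 hab
  refine lt_of_lt_of_le ?_ (add_le_add_left h1 (i : Ordinal.{0}))
  rw [mul_add_one, ← add_assoc, add_assoc _ _ (i : Ordinal.{0})]
  refine add_lt_add_right ?_ _
  exact_mod_cast (by omega : i < g + 1 + i)

/-- Different strides test different cells, so the cell tested after `n` strides still has its
original value. -/
theorem eraseRun_of_lt (g i : ℕ) (D : Ordinal.{0} → Bool) (x n : Ordinal.{0}) :
    eraseRun (g + 1 : ℕ) i D x n (x + (g + 1 : ℕ) * n + i) = D (x + (g + 1 : ℕ) * n + i) := by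
  refine if_neg ?_
  rintro ⟨η, h1, h2⟩
  exact (strictMono_stride x g i h1).ne h2.symm

section
variable {B : Fin 5 → Ordinal.{0} → Bool} {α : Ordinal.{0}} {m : X} {p : X → Prop} {g : ℕ}

/-- Where the interpreter fetches an instruction. -/
noncomputable def fetch (B : Fin 5 → Ordinal.{0} → Bool) (α hc t : Ordinal.{0}) (a : Mem)
    (v : Ordinal.{0}) : X :=
  interp B α (if a.skip then 4 else 3) hc 0 a.x t a.D v

theorem le_interp_of_le_fetch {hc t v v' hc' hd' : Ordinal.{0}} {q : ℕ} {mD D : Ordinal.{0} → Bool}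
    (hm : m ≤ interp B α 3 0 0 0 t mD v) (hD : mD ≤ D) (hq : 3 ≤ q) (hv : v ≤ v') :
    m ≤ interp B α q hc' hc hd' t D v' :=
  X.le_trans hm (interp_mono hq zero_le zero_le zero_le le_rfl hD hv)

/-- The universal machine executes an instruction. -/
theorem Reach.exec {hc t v : Ordinal.{0}} {i : ℕ} {mD : Ordinal.{0} → Bool} (o : Op) (ho : o ≠ .halt)
    (hF : Follows B hc o i) (hg1 : ∀ i < g, B 4 i = true) (hg2 : B 4 g = false)
    (a : Mem) (ha : a.Within v) (hm : m ≤ interp B α 3 0 0 0 t mD v) (h1 : mD ≤ a.D)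
    (h2 : mD ≤ (o.exec (g + 1 : ℕ) i a).D)
    (h : ∀ v', v ≤ v' → (o.exec (g + 1 : ℕ) i a).Within v' →
      Reach m (fetch B α (hc + 1) t (o.exec (g + 1 : ℕ) i a) v') p) :
    Reach m (fetch B α hc t a v) p := by
  have hB := hF.decode
  obtain ⟨D, x, skip⟩ := a
  obtain ⟨hx, hD⟩ := ha
  change x ≤ v at hx
  change ∀ y, D y = true → y < v at hD
  have hk : (0 : Ordinal.{0}) < (g + 1 : ℕ) := by simp
  have hv : v ≤ max v (x + 1) := le_max_left _ _
  have hvx : x + 1 ≤ max v (x + 1) := le_max_right _ _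
  have hxx : x ≤ x + 1 := le_self_add
  have hup := update_below hx
  have hD' : ∀ y, D y = true → y < max v (x + 1) := fun y hy ↦ (hD y hy).trans_le hv
  cases skip with
  | true =>
    refine Reach.step (fetch B α (hc + 1) t (o.exec (g + 1 : ℕ) i ⟨D, x, true⟩) v) ?_
      (le_interp_of_le_fetch hm h1 (Nat.le_succ 3) le_rfl) (h v le_rfl ⟨hx, hD⟩)
    unfold fetch X.next
    rw [show (interp B α (if (Mem.mk D x true).skip = true then 4 else 3) hc 0
      (Mem.mk D x true).x t (Mem.mk D x true).D v).q = 4 from rfl]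
    cases o <;> first
      | exact absurd rfl ho
      | (simp only [table, decode_interp, hB]
         simp [X.app, Scan.go, interp, X.scan, X.hb, Op.exec])
  | false =>
    have base : ∀ b : Mem, (h2 : mD ≤ b.D) → o.exec (g + 1 : ℕ) i ⟨D, x, false⟩ = b →
        b.Within (max v (x + 1)) →
        (interp B α 3 hc 0 x t D v).next = some (fetch B α (hc + 1) t b (max v (x + 1))) →
        Reach m (fetch B α hc t ⟨D, x, false⟩ v) p := by
      rintro b h2 rfl h3 h4
      exact Reach.step _ h4 (le_interp_of_le_fetch hm h1 le_rfl le_rfl) (h _ hv h3)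
    cases o with
    | halt => exact absurd rfl ho
    | right =>
      refine base ⟨D, x + 1, false⟩ h1 rfl ⟨hvx, hD'⟩ ?_
      unfold X.next
      rw [show (interp B α 3 hc 0 x t D v).q = 3 from rfl]
      simp only [table, decode_interp, hB]
      simp [X.app, Scan.go, interp, X.scan, X.hb, fetch, hup]
    | left =>
      refine base ⟨D, Move.left.apply x, false⟩ h1 rfl
        ⟨(Move.apply_left_le x).trans (hxx.trans hvx), hD'⟩ ?_
      unfold X.next
      rw [show (interp B α 3 hc 0 x t D v).q = 3 from rfl]
      simp only [table, decode_interp, hB]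
      simp [X.app, Scan.go, interp, X.scan, X.hb, fetch, hup]
    | clear =>
      refine base ⟨Function.update D x false, x, false⟩ h2 rfl ⟨hxx.trans hvx, fun y hy ↦ ?_⟩ ?_
      · refine hD' y ?_
        rcases eq_or_ne y x with rfl | hyx
        · simp at hy
        · change Function.update D x false y = true at hy
          rwa [Function.update_of_ne hyx] at hy
      unfold X.next
      rw [show (interp B α 3 hc 0 x t D v).q = 3 from rfl]
      simp only [table, decode_interp, hB]
      simp [X.app, Scan.go, interp, X.scan, X.hb, fetch, hup]
    | set =>
      refine base ⟨Function.update D x true, x, false⟩ h2 rfl ⟨hxx.trans hvx, fun y hy ↦ ?_⟩ ?_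
      · rcases eq_or_ne y x with rfl | hyx
        · exact lt_max_of_lt_right (Order.lt_add_one_iff.2 le_rfl)
        · change Function.update D x true y = true at hy
          rw [Function.update_of_ne hyx] at hy
          exact hD' y hy
      unfold X.next
      rw [show (interp B α 3 hc 0 x t D v).q = 3 from rfl]
      simp only [table, decode_interp, hB]
      simp [X.app, Scan.go, interp, X.scan, X.hb, fetch, hup]
    | test =>
      refine base ⟨D, x, !D x⟩ h1 rfl ⟨hxx.trans hvx, hD'⟩ ?_
      unfold X.next
      rw [show (interp B α 3 hc 0 x t D v).q = 3 from rfl]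
      simp only [table, decode_interp, hB]
      cases hdx : D x <;> simp [X.app, Scan.go, interp, X.scan, X.hb, fetch, hup, hdx]
    | testNot =>
      refine base ⟨D, x, D x⟩ h1 rfl ⟨hxx.trans hvx, hD'⟩ ?_
      unfold X.next
      rw [show (interp B α 3 hc 0 x t D v).q = 3 from rfl]
      simp only [table, decode_interp, hB]
      cases hdx : D x <;> simp [X.app, Scan.go, interp, X.scan, X.hb, fetch, hup, hdx]
    | reset =>
      refine Reach.step (interp B α 13 (hc + 1) 0 x t D (max v (x + 1))) ?_
        (le_interp_of_le_fetch hm h1 le_rfl le_rfl) ?_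
      · unfold X.next
        rw [show (fetch B α hc t ⟨D, x, false⟩ v).q = 3 from rfl]
        simp only [table, fetch, decode_interp, hB]
        simp [X.app, Scan.go, interp, X.scan, X.hb, hup]
      · exact Reach.resetPointer (le_interp_of_le_fetch hm h1 le_rfl hv) (h _ hv ⟨zero_le, hD'⟩)
    | nop =>
      refine base ⟨D, x, false⟩ h1 rfl ⟨hxx.trans hvx, hD'⟩ ?_
      unfold X.next
      rw [show (interp B α 3 hc 0 x t D v).q = 3 from rfl]
      simp only [table, decode_interp, hB]
      simp [X.app, Scan.go, interp, X.scan, X.hb, fetch, hup]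
    | idle =>
      refine base ⟨D, x, false⟩ h1 rfl ⟨hxx.trans hvx, hD'⟩ ?_
      unfold X.next
      rw [show (interp B α 3 hc 0 x t D v).q = 3 from rfl]
      simp only [table, decode_interp, hB]
      simp [X.app, Scan.go, interp, X.scan, X.hb, fetch, hup]
    | seek =>
      refine Reach.strideLoop hg1 hg2 hF (Or.inl rfl) (fun _ ↦ D) (gapIndex (g + 1 : ℕ) i D x) hx
        (fun _ _ _ ↦ le_rfl) (fun l hl y hy ↦ hy 0 hl.bot_lt)
        (fun η hη ↦ ⟨lt_gapIndex hη, Or.inl ⟨rfl, rfl⟩⟩) (gapIndex_spec hk i hD x)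
        (le_interp_of_le_fetch hm h1 le_rfl le_rfl) fun v' hv' hv'' ↦ ?_
      exact h v' hv' ⟨hv'', fun y hy ↦ (hD y hy).trans_le hv'⟩
    | erase =>
      have hN := (eraseRun_of_lt g i D x _).trans (gapIndex_spec hk i hD x)
      have key := Reach.strideLoop (m := m) (p := p) (α := α) (hk := t) hg1 hg2 hF (Or.inr rfl)
        (eraseRun (g + 1 : ℕ) i D x) (gapIndex (g + 1 : ℕ) i D x) hx (eraseRun_antitone _ _ _ _)
        (fun l hl y hy ↦ eraseRun_limit hl hy)
        (fun η hη ↦ ⟨by rw [eraseRun_of_lt]; exact lt_gapIndex hη,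
          Or.inr ⟨rfl, eraseRun_add_one _ _ _ _ _⟩⟩) hN
        (le_interp_of_le_fetch hm h2 le_rfl le_rfl) fun v' hv' hv'' ↦ ?_
      · rwa [eraseRun_zero] at key
      · exact h v' hv' ⟨hv'', fun y hy ↦
          (hD y (Bool.le_iff_imp.1 (eraseRun_le _ _ _ _ _ y) hy)).trans_le hv'⟩

end

/-! ### Passes of a straight-line program -/

/-- The number of instructions `right` at the beginning of a program. -/
def lead : List Op → ℕ
  | .right :: l => lead l + 1
  | _ => 0

/-- The execution of a program, where `k` is the length of a stride. -/
noncomputable def runOps (k : Ordinal.{0}) : List Op → Mem → Mem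
  | [], a => a
  | o :: l, a => runOps k l (o.exec k (lead l) a)

/-- The cells that contain `1` all the time while `l` is executed from `a`. -/
noncomputable def common (k : Ordinal.{0}) : List Op → Mem → Ordinal.{0} → Bool
  | [], a, y => a.D y
  | o :: l, a, y => a.D y && common k l (o.exec k (lead l) a) y

theorem common_le (k : Ordinal.{0}) (l : List Op) (a : Mem) : common k l a ≤ a.D := fun y ↦ by
  cases l with
  | nil => exact le_rfl
  | cons o l => exact Bool.and_le_left _ _

theorem common_cons_le (k : Ordinal.{0}) (o : Op) (l : List Op) (a : Mem) :
    common k (o :: l) a ≤ common k l (o.exec k (lead l) a) := fun _ ↦ Bool.and_le_right _ _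

theorem common_le_runOps (k : Ordinal.{0}) (l : List Op) (a : Mem) :
    common k l a ≤ (runOps k l a).D := by
  induction l generalizing a with
  | nil => exact le_rfl
  | cons o l ih => exact (common_cons_le k o l a).trans (ih _)

/-- The program `l` is written on the tapes. -/
structure Loaded (B : Fin 5 → Ordinal.{0} → Bool) (l : List Op) : Prop where
  decode : ∀ (i : ℕ) (h : i < l.length), Op.decode (fun j ↦ B j i) = l[i]
  halt : Op.decode (fun j ↦ B j l.length) = .halt
  ne_halt : ∀ o ∈ l, o ≠ .halt

/-- A configuration that differs from the first one cannot be reached without a step. -/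
theorem Reach.strict {m x : X} {p : X → Prop} (h : Reach m x p) (hp : ∀ y, p y → y.cfg ≠ x.cfg) :
    SReach m x p := fun s hs ↦ by
  obtain ⟨s', h1, y, h2, h3, h4⟩ := h s hs
  refine ⟨s', lt_of_le_of_ne h1 ?_, y, h2, h3, h4⟩
  rintro rfl
  exact hp y h2 (h3.symm.trans hs)

theorem lead_cons_of_ne {o : Op} (h : o ≠ .right) (l : List Op) : lead (o :: l) = 0 := by
  cases o <;> first | rfl | exact absurd rfl h

theorem Loaded.follows {B : Fin 5 → Ordinal.{0} → Bool} {l : List Op} (hl : Loaded B l)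
    (l₁ : List Op) (o : Op) (l₂ : List Op) (h : l = l₁ ++ o :: l₂) :
    Follows B l₁.length o (lead l₂) := by
  have key : ∀ (l₂ l₁ : List Op), l = l₁ ++ l₂ →
      (∀ n < lead l₂, Op.decode (fun j ↦ B j ((l₁.length : Ordinal.{0}) + n)) = .right) ∧
      Op.decode (fun j ↦ B j ((l₁.length : Ordinal.{0}) + lead l₂)) ≠ .right := by
    intro l₂
    induction l₂ with
    | nil =>
      intro l₁ h
      refine ⟨fun n hn ↦ absurd hn (Nat.not_lt_zero n), ?_⟩
      have := hl.halt
      rw [h, List.append_nil] at this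
      simp [lead, this]
    | cons o l₂ ih =>
      intro l₁ h
      have h1 := hl.decode l₁.length (by simp [h])
      by_cases ho : o = .right
      · subst ho
        obtain ⟨h2, h3⟩ := ih (l₁ ++ [.right]) (by simp [h])
        have h4 : ∀ n : ℕ, (l₁.length : Ordinal.{0}) + (n + 1 : ℕ) =
            ((l₁ ++ [Op.right]).length : Ordinal.{0}) + n := fun n ↦ by
          rw [List.length_append]
          exact_mod_cast (by simp; omega)
        refine ⟨fun n hn ↦ ?_, ?_⟩
        · cases n with
          | zero =>
            rw [Nat.cast_zero, add_zero, h1]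
            simp [h]
          | succ n =>
            rw [h4]
            exact h2 n (Nat.lt_of_succ_lt_succ hn)
        · rw [show lead (.right :: l₂) = lead l₂ + 1 from rfl, h4]
          exact h3
      · rw [lead_cons_of_ne ho]
        refine ⟨fun n hn ↦ absurd hn (Nat.not_lt_zero n), ?_⟩
        rw [Nat.cast_zero, add_zero, h1]
        simpa [h] using ho
  have h1 := hl.decode l₁.length (by simp [h])
  obtain ⟨h2, h3⟩ := key l₂ (l₁ ++ [o]) (by simp [h])
  refine ⟨?_, ?_, ?_⟩
  · rw [h1]
    simp [h]
  · simpa using h2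
  · simpa using h3

/-- As `SReach`, where the cells that contain `1` all the time before are in `E`. -/
def DReach (m : X) (E : Ordinal.{0} → Bool) (x : X) (p : X → Prop) : Prop :=
  ∀ s, univ.run s = x.cfg → ∃ s' > s, ∃ y : X, p y ∧ univ.run s' = y.cfg ∧
    (∀ r ∈ Set.Ico s s', (m.cfg : Config univ.tapes) ≤ univ.run r) ∧
    ∀ z, (∀ r ∈ Set.Ico s s', (univ.run r).Holds (.tape (7 : Fin 14) z)) → E z = true

theorem SReach.toD {m x : X} {p : X → Prop} (h : SReach m x p) : DReach m x.D x p := fun s hs ↦ by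
  obtain ⟨s', h1, y, h2, h3, h4⟩ := h s hs
  refine ⟨s', h1, y, h2, h3, h4, fun a ha ↦ ?_⟩
  have := ha s ⟨le_rfl, h1⟩
  rwa [hs] at this

theorem SReach.transD {m x : X} {p p' : X → Prop} {E : Ordinal.{0} → Bool} (h : SReach m x p)
    (h' : ∀ y, p y → DReach m E y p') : DReach m (fun z ↦ x.D z && E z) x p' := fun s hs ↦ by
  obtain ⟨s', h1, y, h2, h3, h4⟩ := h s hs
  obtain ⟨s'', h5, z, h6, h7, h8, h9⟩ := h' y h2 s' h3
  refine ⟨s'', h1.trans h5, z, h6, h7, fun r hr ↦ ?_, fun a ha ↦ ?_⟩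
  · rcases lt_or_ge r s' with h9 | h9
    · exact h4 r ⟨hr.1, h9⟩
    · exact h8 r ⟨h9, hr.2⟩
  · rw [Bool.and_eq_true]
    refine ⟨?_, h9 a fun r hr ↦ ha r ⟨h1.le.trans hr.1, hr.2⟩⟩
    have := ha s ⟨le_rfl, h1.trans h5⟩
    rwa [hs] at this

theorem DReach.reach {m x : X} {p : X → Prop} {E : Ordinal.{0} → Bool} (h : DReach m E x p) :
    Reach m x p := fun s hs ↦ by
  obtain ⟨s', h1, y, h2, h3, h4, -⟩ := h s hs
  exact ⟨s', h1.le, y, h2, h3, h4⟩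

theorem X.tape_cfg_update (x : X) (E : Ordinal.{0} → Bool) (i : Fin 14) :
    i = 7 ∨ x.cfg.tape i = { x with D := E }.cfg.tape i := by
  unfold X.cfg
  exact match i with
  | 0 => Or.inr (Eq.refl (x.B 0)) | 1 => Or.inr (Eq.refl (x.B 1)) | 2 => Or.inr (Eq.refl (x.B 2))
  | 3 => Or.inr (Eq.refl (x.B 3)) | 4 => Or.inr (Eq.refl (x.B 4))
  | 5 => Or.inr (Eq.refl (mark true)) | 6 => Or.inr (Eq.refl (mark true)) | 7 => Or.inl (Eq.refl 7)
  | 8 => Or.inr (Eq.refl x.V) | 9 => Or.inr (Eq.refl (mark true)) | 10 => Or.inr (Eq.refl x.K)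
  | 11 => Or.inr (Eq.refl (mark true)) | 12 => Or.inr (Eq.refl (mark x.f))
  | 13 => Or.inr (Eq.refl (mark x.s))

theorem Config.Holds.of_eq {k : ℕ} {c d : Config k} {j : Fin k} (h1 : c.state = d.state)
    (h2 : c.head = d.head) (h3 : ∀ i, i = j ∨ c.tape i = d.tape i) {a : Atom k} (h : c.Holds a)
    (h4 : ∀ y, a = .tape j y → d.Holds a) : d.Holds a := by
  cases a with
  | state n => exact lt_of_lt_of_eq (a := n) h h1
  | head i b => exact lt_of_lt_of_eq (a := b) h (congrFun h2 i)
  | tape i y =>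
    rcases h3 i with rfl | hi
    · exact h4 y rfl
    · exact (congrFun hi y).symm.trans h

/-- Apart from the data, the infimum is bounded by the first configuration; for the data the sharper
bound `E` is available. -/
theorem DReach.toU {m x : X} {p : X → Prop} {E : Ordinal.{0} → Bool} (h : DReach m E x p) :
    SReachU m { x with D := E } x p := fun s hs ↦ by
  obtain ⟨s', h1, y, h2, h3, h4, h5⟩ := h s hs
  refine ⟨s', h1, y, h2, h3, h4, fun a ha ↦ ?_⟩
  have h6 := ha s ⟨le_rfl, h1⟩
  rw [hs] at h6
  refine Config.Holds.of_eq (k := 14) (c := x.cfg) (d := { x with D := E }.cfg) (j := 7)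
    rfl rfl (X.tape_cfg_update x E) h6 fun z hz ↦ ?_
  subst hz
  exact h5 z ha

/-- The configurations of the universal machine between the runs of the straight-line programs. -/
noncomputable def rest (q : ℕ) (B : Fin 5 → Ordinal.{0} → Bool) (α : Ordinal.{0}) (f s : Bool) :
    X where
  q := q
  hc := 0
  hg := 0
  hd := 0
  hk := 0
  B := B
  D _ := false
  V _ := false
  K := below α
  f := f
  s := s

section
variable {B : Fin 5 → Ordinal.{0} → Bool} {α : Ordinal.{0}} {m : X} {p : X → Prop} {g : ℕ}
  {l : List Op}

/-- Within one instruction the data stay above its initial or its final data, so the cells that are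
`1` throughout are found by looking only between instructions. Hence `common` occurs both in the
lower bound and as the upper bound. -/
theorem DReach.execList (hl : Loaded B l) (hg1 : ∀ i < g, B 4 i = true) (hg2 : B 4 g = false)
    {t : Ordinal.{0}} (l₁ l₂ : List Op) (hl₁ : l = l₁ ++ l₂)
    (v : Ordinal.{0}) (a : Mem) (ha : a.Within v)
    (hm : m ≤ interp B α 3 0 0 0 t (common (g + 1 : ℕ) l₂ a) v)
    (h : ∀ v', v ≤ v' → (runOps (g + 1 : ℕ) l₂ a).Within v' →
      SReach m (fetch B α l.length t (runOps (g + 1 : ℕ) l₂ a) v') p) :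
    DReach m (common (g + 1 : ℕ) l₂ a) (fetch B α l₁.length t a v) p := by
  induction l₂ generalizing l₁ v a with
  | nil =>
    have := h v le_rfl ha
    rw [hl₁, List.append_nil] at this
    exact this.toD
  | cons o l₂ ih =>
    have hle := common_cons_le (g + 1 : ℕ) o l₂ a
    refine SReach.transD (p := fun z ↦ ∃ v', v ≤ v' ∧ (o.exec (g + 1 : ℕ) (lead l₂) a).Within v' ∧
      z = fetch B α (l₁.length + 1) t (o.exec (g + 1 : ℕ) (lead l₂) a) v') (Reach.strict (Reach.exec o
        (hl.ne_halt o (by simp [hl₁])) (hl.follows l₁ o l₂ hl₁) hg1 hg2 a ha hm (common_le _ _ _)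
        (hle.trans (common_le _ _ _)) fun v' hv' ha' ↦ Reach.refl ⟨v', hv', ha', rfl⟩) ?_) ?_
    · rintro _ ⟨v', -, -, rfl⟩ he
      have : (l₁.length : Ordinal.{0}) + 1 = l₁.length :=
        congrArg (fun c : Config 14 ↦ c.head 0) he
      exact absurd this (Order.lt_add_one_iff.2 le_rfl).ne'
    · rintro _ ⟨v', hv', ha', rfl⟩
      have := ih (l₁ ++ [o]) (by simp [hl₁]) v' _ ha'
        (X.le_trans hm (interp_mono le_rfl le_rfl le_rfl le_rfl le_rfl hle hv'))
        fun v'' hv'' ↦ h v'' (hv'.trans hv'')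
      simpa using this

theorem Move.apply_left_prod_lt {σ τ : Type*} [PartialOrder σ] [PartialOrder τ]
    {f : σ → σ} {g : τ → τ} {a z : σ} {b w : τ} (hf : ∀ a, f a ≤ a) (hg : ∀ b, g b ≤ b)
    (hf' : ∀ a, a ≠ z → f a < a) (hg' : ∀ b, b ≠ w → g b < b) (h : (a, b) ≠ (z, w)) :
    (f a, g b) < (a, b) := by
  rw [Prod.mk_lt_mk]
  by_cases ha : a = z
  · exact Or.inr ⟨hf a, hg' b fun hb ↦ h (by rw [ha, hb])⟩
  · exact Or.inl ⟨hf' a ha, hg b⟩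

/-- At the end of a pass before the last one, the clock advances. -/
theorem SReach.tick (hl : Loaded B l) {t v : Ordinal.{0}} (ht : t < α) (a : Mem)
    (hs : a.skip = false)
    (hm : m ≤ interp B α 3 0 0 0 t a.D v)
    (h : Reach m (fetch B α 0 (t + 1) ⟨a.D, 0, false⟩ v) p) :
    SReach m (fetch B α l.length t a v) p := by
  have ht' : below α t = true := by simpa [below] using ht
  have hm' : ∀ q, 3 ≤ q → ∀ b c d, m ≤ interp B α q b c d (t + 1) a.D v := fun q hq b c d ↦
    X.le_trans hm (interp_mono hq zero_le zero_le zero_le le_self_add le_rfl le_rfl)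
  refine SReach.step (interp B α 7 l.length 0 a.x (t + 1) a.D v) ?_
    (le_interp_of_le_fetch hm le_rfl (by split_ifs <;> decide) le_rfl) ?_
  · unfold X.next fetch
    rw [hs, show (interp B α (if false = true then 4 else 3) l.length 0 a.x t a.D v).q = 3 from rfl]
    simp only [table, decode_interp, hl.halt, Scan.endPass]
    simp [X.app, Scan.go, interp, X.scan, X.hb, ht']
  · refine Reach.descend (fun c : Ordinal.{0} × Ordinal.{0} ↦
      interp B α 7 c.1 0 c.2 (t + 1) a.D v) (fun c ↦ (Move.left.apply c.1, Move.left.apply c.2))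
      (0, 0) (fun c hc ↦ Move.apply_left_prod_lt Move.apply_left_le Move.apply_left_le
        (fun _ ↦ Move.apply_left_lt) (fun _ ↦ Move.apply_left_lt) hc) (fun c hc ↦ ?_)
      (fun c ↦ hm' 7 (by decide) _ _ _) ?_ (l.length, a.x)
    · by_cases h1 : c.1 = 0
      · have h2 : c.2 ≠ 0 := fun h2 ↦ hc (Prod.ext h1 h2)
        simp [X.next, table, X.app, Scan.go, interp, X.scan, X.hb, h1, h2]
      · simp [X.next, table, X.app, Scan.go, interp, X.scan, X.hb, h1]
    · refine Reach.step _ ?_ (hm' 7 (by decide) _ _ _) h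
      simp [X.next, table, X.app, Scan.go, interp, X.scan, X.hb, fetch]

open Classical in
/-- The data at the beginning of pass `t` of the program `l`. -/
noncomputable def dataAt (k : Ordinal.{0}) (l : List Op) (t : Ordinal.{0}) : Ordinal.{0} → Bool :=
  Ordinal.limitRecOn t (fun _ ↦ false) (fun _ D ↦ (runOps k l ⟨D, 0, false⟩).D) fun t _ F y ↦
    decide (∃ s₀ < t, ∀ s (h : s < t), s₀ ≤ s → common k l ⟨F s h, 0, false⟩ y = true)

/-- The state of the program `l` at the beginning of pass `t`. -/
noncomputable def startAt (k : Ordinal.{0}) (l : List Op) (t : Ordinal.{0}) : Mem :=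
  ⟨dataAt k l t, 0, false⟩

theorem dataAt_zero (k : Ordinal.{0}) (l : List Op) : dataAt k l 0 = fun _ ↦ false := by
  simp [dataAt]

theorem dataAt_add_one (k : Ordinal.{0}) (l : List Op) (t : Ordinal.{0}) :
    dataAt k l (t + 1) = (runOps k l (startAt k l t)).D := by
  simp [dataAt, startAt]

open Classical in
theorem dataAt_limit (k : Ordinal.{0}) (l : List Op) {t : Ordinal.{0}} (ht : IsSuccLimit t)
    (y : Ordinal.{0}) :
    dataAt k l t y = true ↔ Ev t fun s ↦ common k l (startAt k l s) y = true := by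
  rw [dataAt, Ordinal.limitRecOn_limit (h := ht), decide_eq_true_eq]
  exact exists_congr fun s₀ ↦ and_congr_right fun _ ↦
    ⟨fun h s h1 h2 ↦ h s h2 h1, fun h s h2 h1 ↦ h s h1 h2⟩

theorem DReach.pass (hl : Loaded B l) (hg1 : ∀ i < g, B 4 i = true) (hg2 : B 4 g = false)
    {t v : Ordinal.{0}} (ht : t < α) (hD : ∀ y, dataAt (g + 1 : ℕ) l t y = true → y < v)
    (hskip : (runOps (g + 1 : ℕ) l (startAt (g + 1 : ℕ) l t)).skip = false)
    (hm : m ≤ interp B α 3 0 0 0 t (common (g + 1 : ℕ) l (startAt (g + 1 : ℕ) l t)) v)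
    (h : ∀ v', v ≤ v' → (∀ y, dataAt (g + 1 : ℕ) l (t + 1) y = true → y < v') →
      Reach m (fetch B α 0 (t + 1) (startAt (g + 1 : ℕ) l (t + 1)) v') p) :
    DReach m (common (g + 1 : ℕ) l (startAt (g + 1 : ℕ) l t))
      (fetch B α 0 t (startAt (g + 1 : ℕ) l t) v) p := by
  have := DReach.execList (p := p) hl hg1 hg2 [] l rfl v (startAt (g + 1 : ℕ) l t) ⟨zero_le, hD⟩ hm
    fun v' hv' hw ↦ SReach.tick hl ht _ hskip (X.le_trans hm
      (interp_mono le_rfl le_rfl le_rfl le_rfl le_rfl (common_le_runOps _ _ _) hv')) ?_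
  · simpa using this
  · rw [← dataAt_add_one]
    refine h v' hv' ?_
    rw [dataAt_add_one]
    exact hw.2

/-- The passes that do not end with the skip flag set. -/
theorem Reach.passes (hl : Loaded B l) (hg1 : ∀ i < g, B 4 i = true) (hg2 : B 4 g = false)
    (δ : Ordinal.{0}) (hδ : δ ≤ α)
    (hskip : ∀ t < δ, (runOps (g + 1 : ℕ) l (startAt (g + 1 : ℕ) l t)).skip = false)
    (hm : m ≤ interp B α 3 0 0 0 0 (fun _ ↦ false) 0)
    (h : ∀ v, (∀ y, dataAt (g + 1 : ℕ) l δ y = true → y < v) →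
      Reach m (fetch B α 0 δ (startAt (g + 1 : ℕ) l δ) v) p) :
    Reach m (fetch B α 0 0 ⟨fun _ ↦ false, 0, false⟩ 0) p := by
  let k : Ordinal.{0} := (g + 1 : ℕ)
  let E : Ordinal.{0} → Ordinal.{0} → Bool := fun t ↦ common k l (startAt k l t)
  refine Reach.trans (p := fun x ↦ ∃ v, (∀ y, dataAt k l δ y = true → y < v) ∧
    x = fetch B α 0 δ (startAt k l δ) v) ?_ (by rintro _ ⟨v, h1, rfl⟩; exact h v h1)
  refine Reach.loop (fun t x ↦ ∃ v, (∀ y, dataAt k l t y = true → y < v) ∧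
    x = fetch B α 0 t (startAt k l t) v) (fun t x y z ↦ ∃ v, x = fetch B α 0 t (startAt k l t) v ∧
      y = interp B α 3 0 0 0 t (E t) v ∧ z = interp B α 3 0 0 0 t (E t) v) m _ δ
      ⟨0, ?_, ?_⟩ ?_ ?_ ?_
  · simp [dataAt_zero]
  · simp [startAt, dataAt_zero]
  · rintro t ht _ ⟨v, h1, rfl⟩
    refine ⟨_, _, ⟨v, rfl, rfl, rfl⟩, (DReach.pass hl hg1 hg2 (ht.trans_le hδ) h1 (hskip t ht)
      (interp_mono le_rfl le_rfl le_rfl le_rfl le_rfl le_rfl le_rfl) fun v' _ h6 ↦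
      Reach.refl ⟨v', h6, rfl⟩).toU⟩
  · intro t ht hlt xs ms us hI
    have : ∀ s < t, ∃ v, (∀ y, dataAt k l s y = true → y < v) ∧
        ms s = interp B α 3 0 0 0 s (E s) v ∧ us s = interp B α 3 0 0 0 s (E s) v := by
      intro s hs'
      obtain ⟨⟨v, h1, h2⟩, v', h3, h4, h5⟩ := hI s hs'
      refine ⟨v, h1, ?_⟩
      have h6 : below v = below v' := congrArg X.V (h2.symm.trans h3)
      rw [h4, h5]
      simp only [interp, h6, and_self]
    choose! vs h1 h2 h3 using this
    obtain ⟨v, hv⟩ := exists_isLim (t := t) vs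
    refine ⟨fetch B α 0 t ⟨fun _ ↦ false, 0, false⟩ v, XLim.congr (f := fun s ↦
      interp B α 3 0 0 0 s (E s) (vs s)) (g := fun s ↦ interp B α 3 0 0 0 s (E s) (vs s))
      ⟨.const hlt _, .const hlt _, .const hlt _, .const hlt _, isLim_id hlt,
        fun _ _ ↦ .const hlt _, hv.below, fun _ ↦ .const hlt _, .const hlt _, .const hlt _⟩ h2 h3,
      fun D h5 h6 ↦ ?_⟩
    -- Both bounds have the data `common`, so the limit is exactly that of `dataAt_limit`.
    have hD : D = dataAt k l t := by
      funext y
      rw [Bool.eq_iff_iff, dataAt_limit _ _ hlt]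
      refine ⟨fun hy ↦ (h6 y hy).mono fun s hs' h ↦ ?_, fun hy ↦ h5 y (hy.mono fun s hs' h ↦ ?_)⟩
      · rw [h3 s hs'] at h; exact h
      · rw [h2 s hs']; exact h
    subst hD
    refine ⟨v, fun y hy ↦ hv.upper y (((dataAt_limit _ _ hlt y).1 hy).mono fun s hs' h ↦
      h1 s hs' y ?_), rfl⟩
    exact Bool.le_iff_imp.1 (common_le _ _ _ y) h
  · rintro t ht _ _ _ - ⟨v, -, rfl, -⟩
    exact X.le_trans hm (interp_mono le_rfl le_rfl le_rfl le_rfl zero_le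
      (fun _ ↦ Bool.false_le _) zero_le)

end

/-! ### Removing the traces of a run -/

/-- The configurations of the universal machine while it removes the traces of a run. -/
noncomputable def cleanup (B : Fin 5 → Ordinal.{0} → Bool) (α : Ordinal.{0}) (s : Bool) (q : ℕ)
    (hc hd hk : Ordinal.{0}) (D V : Ordinal.{0} → Bool) : X where
  q := q
  hc := hc
  hg := 0
  hd := hd
  hk := hk
  B := B
  D := D
  V := V
  K := below α
  f := true
  s := s

/-- `D` with the cells below `ξ` erased. -/
noncomputable def above (ξ : Ordinal.{0}) (D : Ordinal.{0} → Bool) (y : Ordinal.{0}) : Bool :=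
  decide (ξ ≤ y) && D y

theorem above_zero (D : Ordinal.{0} → Bool) : above 0 D = D := by
  funext y
  simp [above]

theorem above_eq_false {v : Ordinal.{0}} {D : Ordinal.{0} → Bool}
    (hD : ∀ y, D y = true → y < v) : above v D = fun _ ↦ false := by
  funext y
  by_contra h
  simp only [above, Bool.not_eq_false, Bool.and_eq_true, decide_eq_true_eq] at h
  exact absurd (hD y h.2) (not_lt.2 h.1)

theorem update_above (ξ : Ordinal.{0}) (D : Ordinal.{0} → Bool) :
    Function.update (above ξ D) ξ false = above (ξ + 1) D := by
  funext y
  rcases eq_or_ne y ξ with rfl | hy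
  · simp [above]
  · rw [Function.update_of_ne hy]
    simp [above, Order.add_one_le_iff, lt_iff_le_and_ne, hy.symm]

theorem above_antitone {ξ ξ' : Ordinal.{0}} (h : ξ ≤ ξ') (D : Ordinal.{0} → Bool) :
    above ξ' D ≤ above ξ D := fun y ↦ by
  refine Bool.le_iff_imp.2 fun h' ↦ ?_
  simp only [above, Bool.and_eq_true, decide_eq_true_eq] at h' ⊢
  exact ⟨h.trans h'.1, h'.2⟩

/-- The shift by one in the lower bound allows for the erasure within the round and is invisible at
a limit. -/
theorem isLim_above {l : Ordinal.{0}} (hl : IsSuccLimit l) (D : Ordinal.{0} → Bool)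
    (y : Ordinal.{0}) :
    IsLim l (fun η ↦ above (η + 1) D y) (fun η ↦ above η D y) (above l D y) := by
  simp only [above]
  refine isLim_bool (fun h ↦ ?_) (fun h ↦ ?_) <;>
    simp only [Bool.and_eq_true, decide_eq_true_eq] at h ⊢
  · exact Ev.of_forall hl fun η hη ↦ ⟨(hl.add_one_lt hη).le.trans h.1, h.2⟩
  · refine ⟨le_of_forall_lt fun η hη ↦ ?_, h.exists.choose_spec.2.2⟩
    obtain ⟨s, h1, h2⟩ := h
    exact ((le_max_right s η).trans_lt (lt_add_one_iff.2 le_rfl)).trans_le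
      (h2 _ ((le_max_left s η).trans le_self_add) (hl.add_one_lt (max_lt h1 hη))).1

section
variable {B : Fin 5 → Ordinal.{0} → Bool} {α : Ordinal.{0}} {m : X} {p : X → Prop} {s : Bool}

theorem rest_le_cleanup {q : ℕ} {hc hd hk : Ordinal.{0}} {D V : Ordinal.{0} → Bool} (hq : 8 ≤ q)
    (hm : m ≤ rest 8 B α false s) : m ≤ cleanup B α s q hc hd hk D V :=
  X.le_trans hm ⟨hq, zero_le, zero_le, zero_le, zero_le, le_rfl, fun _ ↦ Bool.false_le _,
    fun _ ↦ Bool.false_le _, le_rfl, Bool.false_le _, le_rfl⟩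

theorem Reach.returnHeads {D V : Ordinal.{0} → Bool} (hm : m ≤ rest 8 B α false s)
    (h : Reach m (cleanup B α s 8 0 0 0 D V) p) (hc hd hk : Ordinal.{0}) :
    Reach m (cleanup B α s 8 hc hd hk D V) p := by
  refine Reach.descend (fun c : Ordinal.{0} × Ordinal.{0} × Ordinal.{0} ↦
    cleanup B α s 8 c.1 c.2.1 c.2.2 D V)
    (fun c ↦ (Move.left.apply c.1, Move.left.apply c.2.1, Move.left.apply c.2.2)) (0, 0, 0)
    (fun c hc ↦ ?_) (fun c hc ↦ ?_) (fun c ↦ rest_le_cleanup le_rfl hm) h (hc, hd, hk)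
  · refine Move.apply_left_prod_lt Move.apply_left_le (g := fun d : Ordinal.{0} × Ordinal.{0} ↦
      (Move.left.apply d.1, Move.left.apply d.2)) (fun d ↦ ?_) (fun _ ↦ Move.apply_left_lt)
      (w := (0, 0)) (fun d hd ↦ ?_) hc
    · exact ⟨Move.apply_left_le _, Move.apply_left_le _⟩
    · exact Move.apply_left_prod_lt Move.apply_left_le Move.apply_left_le
        (fun _ ↦ Move.apply_left_lt) (fun _ ↦ Move.apply_left_lt) hd
  · by_cases h1 : c.1 = 0
    · by_cases h2 : c.2.1 = 0
      · have h3 : c.2.2 ≠ 0 := fun h3 ↦ hc (Prod.ext h1 (Prod.ext h2 h3))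
        simp [X.next, table, X.app, Scan.go, cleanup, X.scan, X.hb, h1, h2, h3]
      · simp [X.next, table, X.app, Scan.go, cleanup, X.scan, X.hb, h1, h2]
    · simp [X.next, table, X.app, Scan.go, cleanup, X.scan, X.hb, h1]

theorem Reach.cleanup (hc hd hk : Ordinal.{0}) {D : Ordinal.{0} → Bool} {v : Ordinal.{0}}
    (hD : ∀ y, D y = true → y < v) (hm : m ≤ rest 8 B α false s)
    (h : Reach m (rest 11 B α false s) p) :
    Reach m (OTM.cleanup B α s 8 hc hd hk D (below v)) p := by
  have fin : Reach m (OTM.cleanup B α s 8 0 0 0 (fun _ ↦ false) fun _ ↦ false) p := by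
    refine Reach.step _ ?_ (rest_le_cleanup le_rfl hm) h
    simp [X.next, table, X.app, Scan.go, OTM.cleanup, X.scan, X.hb, rest]
  refine Reach.returnHeads hm ?_ hc hd hk
  -- With nothing visited the machine moves on at once; otherwise the visited region is erased in
  -- `v` steps first.
  rcases eq_or_ne v 0 with rfl | hv
  · have h1 : D = fun _ ↦ false := funext fun y ↦ by
      by_contra h'
      exact absurd (hD y (by simpa using h')) not_lt_zero
    have h2 : below 0 = fun _ ↦ false := funext fun y ↦ by simp [below]
    rw [h1, h2]
    exact fin
  · have hV : ∀ y, below v y = true → y < v := fun y h ↦ by simpa [below] using h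
    have h0 : below v 0 = true := by simpa [below] using hv.pos
    refine Reach.step (OTM.cleanup B α s 9 0 0 0 D (below v)) ?_ (rest_le_cleanup le_rfl hm) ?_
    · simp [X.next, table, X.app, Scan.go, OTM.cleanup, X.scan, X.hb, h0]
    have key := Reach.loop_exact
      (fun ξ ↦ OTM.cleanup B α s 9 0 ξ 0 (above ξ D) (above ξ (below v)))
      (fun ξ ↦ OTM.cleanup B α s 9 0 ξ 0 (above (ξ + 1) D) (above (ξ + 1) (below v))) m v ?_ ?_
      fun ξ _ ↦ rest_le_cleanup (by decide) hm
    · rw [above_zero, above_zero] at key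
      refine key.trans ?_
      rintro _ rfl
      rw [above_eq_false hD, above_eq_false hV]
      refine Reach.step (OTM.cleanup B α s 8 0 v 0 (fun _ ↦ false) fun _ ↦ false) ?_
        (rest_le_cleanup (by decide) hm) (Reach.returnHeads hm fin _ _ _)
      simp [X.next, table, X.app, Scan.go, OTM.cleanup, X.scan, X.hb]
    · intro ξ hξ
      refine SReach.step _ ?_ ⟨le_rfl, le_rfl, le_rfl, le_rfl, le_rfl, le_rfl,
        above_antitone le_self_add D, above_antitone le_self_add _, le_rfl, le_rfl, le_rfl⟩
        (Reach.refl rfl)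
      have h1 : above ξ (below v) ξ = true := by simpa [above, below] using hξ
      simp [X.next, table, X.app, Scan.go, OTM.cleanup, X.scan, X.hb, h1, update_above]
    · intro l _ hl
      exact ⟨⟨.const hl _, .const hl _, .const hl _, isLim_id hl, .const hl _,
        fun _ _ ↦ .const hl _, isLim_above hl _, fun _ ↦ .const hl _, .const hl _, .const hl _⟩,
        isLim_above hl _⟩

/-- At the end of the last pass, success is recorded if the skip flag is set at time `α`. -/
theorem SReach.endRun {l : List Op} (hl : Loaded B l) (a : Mem) {t v : Ordinal.{0}} (ht : t ≤ α)
    (ht' : t < α → a.skip = true) (hD : ∀ y, a.D y = true → y < v) (hm : m ≤ rest 3 B α false false)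
    (b : Bool) (hb : b = true ↔ t = α ∧ a.skip = true)
    (h : Reach m (rest 11 B (if b then α + 1 else α) false b) p) :
    SReach m (fetch B α l.length t a v) p := by
  have hle : α ≤ if b then α + 1 else α := by split_ifs; exacts [le_self_add, le_rfl]
  refine SReach.step (OTM.cleanup B (if b then α + 1 else α) b 8 l.length a.x t a.D (below v)) ?_
    (X.le_trans hm ⟨show 3 ≤ if a.skip then 4 else 3 by split_ifs <;> decide,
      zero_le, zero_le, zero_le, zero_le, le_rfl, fun _ ↦ Bool.false_le _, fun _ ↦ Bool.false_le _,
      le_rfl, Bool.false_le _, le_rfl⟩)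
    (Reach.cleanup _ _ _ hD (X.le_trans hm ⟨show 3 ≤ 8 by decide, le_rfl, le_rfl, le_rfl, le_rfl,
      le_rfl, le_rfl, le_rfl, below_mono hle, le_rfl, Bool.false_le _⟩) h)
  unfold X.next fetch
  rcases ht.lt_or_eq with ht | rfl
  · have h1 : b = false := by
      rw [← Bool.not_eq_true, hb]
      exact fun h ↦ ht.ne h.1
    have ha : below α t = true := by simpa [below] using ht
    subst h1
    rw [ht' ht, show (interp B α (if true = true then 4 else 3) l.length 0 a.x t a.D v).q = 4
      from rfl]
    simp only [table, decode_interp, hl.halt, Scan.endPass]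
    simp [X.app, Scan.go, interp, X.scan, X.hb, ha, OTM.cleanup]
  · have ha : below t t = false := by simp [below]
    have h1 : b = a.skip := by rw [Bool.eq_iff_iff, hb]; simp
    subst h1
    cases a.skip
    · rw [show (interp B t (if false = true then 4 else 3) l.length 0 a.x t a.D v).q = 3 from rfl]
      simp only [table, decode_interp, hl.halt, Scan.endPass]
      simp [X.app, Scan.go, interp, X.scan, X.hb, ha, OTM.cleanup]
    · rw [show (interp B t (if true = true then 4 else 3) l.length 0 a.x t a.D v).q = 4 from rfl]
      have hup := update_below (le_refl t)
      rw [max_eq_right le_self_add] at hup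
      simp only [table, decode_interp, hl.halt, Scan.endPass]
      simp [X.app, Scan.go, interp, X.scan, X.hb, ha, OTM.cleanup, hup]

end

/-! ### The binary counter of programs -/

theorem testBit_add_one (n b : ℕ) :
    (n + 1).testBit b = xor (n.testBit b) (decide (∀ c < b, n.testBit c = true)) := by
  induction b generalizing n with
  | zero =>
    simp only [Nat.testBit_zero, not_lt_zero, false_imp_iff, implies_true, decide_true,
      Bool.xor_true]
    rcases Nat.mod_two_eq_zero_or_one n with h | h <;> simp [Nat.add_mod, h]
  | succ b ih =>
    rw [Nat.testBit_succ, Nat.testBit_succ]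
    have key : (∀ c < b + 1, n.testBit c = true) ↔
        n % 2 = 1 ∧ ∀ c < b, (n / 2).testBit c = true := by
      constructor
      · intro h
        refine ⟨by simpa using h 0 (Nat.succ_pos b), fun c hc ↦ ?_⟩
        rw [← Nat.testBit_succ]
        exact h _ (Nat.succ_lt_succ hc)
      · rintro ⟨h1, h2⟩ (_ | c) hc
        · simpa using h1
        · rw [Nat.testBit_succ]
          exact h2 c (Nat.lt_of_succ_lt_succ hc)
    rcases Nat.mod_two_eq_zero_or_one n with h | h
    · rw [show (n + 1) / 2 = n / 2 by omega]
      rw [decide_eq_false fun h' ↦ by have := (key.1 h').1; omega, Bool.xor_false]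
    · rw [show (n + 1) / 2 = n / 2 + 1 by omega, ih]
      simp only [key, h, true_and]

open Classical in
/-- The tapes that contain the binary digits of `n`. -/
noncomputable def digits (n : ℕ) (j : Fin 5) (y : Ordinal.{0}) : Bool :=
  decide (∃ i : ℕ, y = i ∧ n.testBit (5 * i + j) = true)

theorem digits_natCast (n : ℕ) (j : Fin 5) (i : ℕ) : digits n j i = n.testBit (5 * i + j) := by
  rw [Bool.eq_iff_iff]
  simp [digits]

theorem digits_zero : digits 0 = fun _ _ ↦ false := by
  funext j y
  simp [digits]

open Classical in
/-- The digits of `n + 1` below the position `i`, and those of `n` above. -/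
noncomputable def partialInc (n : ℕ) (i : ℕ) (j : Fin 5) (y : Ordinal.{0}) : Bool :=
  if y < i then digits (n + 1) j y else digits n j y

/-- All digits below cell `i` are `1`, so a carry arrives there and adding one locally yields the
digits of `n + 1`. -/
theorem partialInc_add_one {n i : ℕ} (h : ∀ b < 5 * i, n.testBit b = true) :
    (fun j ↦ Function.update (partialInc n i j) i
      (incBits (fun j ↦ n.testBit (5 * i + j)) j)) = partialInc n (i + 1) := by
  funext j y
  rcases eq_or_ne y i with rfl | hy
  · rw [Function.update_self]
    unfold partialInc incBits
    rw [if_pos (by simp), digits_natCast, testBit_add_one]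
    congr 2
    refine propext ⟨fun h' c hc ↦ ?_, fun h' c hc ↦ h' _ (by simpa using hc)⟩
    rcases lt_or_ge c (5 * i) with h1 | h1
    · exact h c h1
    · have := h' ⟨c - 5 * i, by omega⟩ (by rw [Fin.lt_def]; simp only; omega)
      simpa [h1] using this
  · rw [Function.update_of_ne hy]
    unfold partialInc
    have : y < (i + 1 : ℕ) ↔ y < i := by
      push_cast
      rw [lt_add_one_iff, le_iff_lt_or_eq, or_iff_left hy]
    simp only [this]

/-- A digit `0` in cell `i` absorbs the carry, so `n` and `n + 1` agree in all later cells. -/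
theorem partialInc_eq {n i : ℕ} (h : ∃ j : Fin 5, n.testBit (5 * i + j) = false) :
    partialInc n (i + 1) = digits (n + 1) := by
  funext j y
  unfold partialInc
  split_ifs with hy
  · rfl
  · obtain ⟨j₀, h⟩ := h
    unfold digits
    rw [decide_eq_decide]
    refine exists_congr fun i' ↦ and_congr_right ?_
    rintro rfl
    have hi : i + 1 ≤ i' := by exact_mod_cast not_lt.1 hy
    have h1 : ¬ ∀ c < 5 * i' + j, n.testBit c = true := fun h' ↦ by
      have := h' (5 * i + j₀) (by omega)
      rw [h] at this
      exact Bool.false_ne_true this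
    rw [testBit_add_one, decide_eq_false h1, Bool.xor_false]

/-- The configurations of the universal machine while it increases the counter. -/
noncomputable def counting (α : Ordinal.{0}) (s : Bool) (q : ℕ) (i : Ordinal.{0})
    (B : Fin 5 → Ordinal.{0} → Bool) : X where
  q := q
  hc := i
  hg := i
  hd := 0
  hk := 0
  B := B
  D _ := false
  V _ := false
  K := below α
  f := false
  s := s

section
variable {α : Ordinal.{0}} {m : X} {p : X → Prop} {s : Bool}

theorem le_counting {q : ℕ} {i : Ordinal.{0}} {B : Fin 5 → Ordinal.{0} → Bool} (hq : 2 ≤ q)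
    (hm : m ≤ rest 2 (fun _ _ ↦ false) α false s) : m ≤ counting α s q i B :=
  X.le_trans hm ⟨hq, zero_le, zero_le, le_rfl, le_rfl, fun _ _ ↦ Bool.false_le _, le_rfl, le_rfl,
    le_rfl, le_rfl, le_rfl⟩

theorem exists_testBit_eq_false (n : ℕ) : ∃ i, ∃ j : Fin 5, n.testBit (5 * i + j) = false :=
  ⟨n, 0, Nat.testBit_lt_two_pow
    (Nat.lt_two_pow_self.trans_le (Nat.pow_le_pow_right (by decide) (by omega)))⟩

/-- The universal machine increases the counter. -/
theorem Reach.increment (n : ℕ) (hm : m ≤ rest 2 (fun _ _ ↦ false) α false s)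
    (h : Reach m (rest 2 (digits (n + 1)) α true s) p) :
    Reach m (rest 11 (digits n) α false s) p := by
  classical
  have hex := exists_testBit_eq_false n
  set N := Nat.find hex
  have hN : ∃ j : Fin 5, n.testBit (5 * N + j) = false := Nat.find_spec hex
  have hlt : ∀ i < N, ∀ j : Fin 5, n.testBit (5 * i + j) = true := fun i hi j ↦ by
    simpa using not_exists.1 (Nat.find_min hex hi) j
  have hcarry : ∀ i ≤ N, ∀ b < 5 * i, n.testBit b = true := fun i hi b hb ↦ by
    have := hlt (b / 5) (by omega) ⟨b % 5, Nat.mod_lt _ (by decide)⟩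
    rwa [show 5 * (b / 5) + b % 5 = b from Nat.div_add_mod b 5] at this
  have hread : ∀ i : ℕ, ∀ j, partialInc n i j i = n.testBit (5 * i + j) := fun i j ↦ by
    rw [partialInc, if_neg (lt_irrefl _), digits_natCast]
  have key : ∀ i ≤ N, Reach m (counting α s 11 i (partialInc n i)) p := by
    intro i hi
    induction hi using Nat.decreasingInduction with
    | self =>
      refine Reach.step (counting α s 12 N (digits (n + 1))) ?_ (le_counting (by decide) hm) ?_
      · have h1 : ¬ ∀ j : Fin 5, n.testBit (5 * N + j) = true := by simpa using hN
        simp only [X.next, table, X.scan, counting, X.hb, ite_self, hread, if_neg h1]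
        simp only [Option.map_some, X.app, Scan.go, X.hb, ite_self, Move.apply_stay,
          Function.update_eq_self, partialInc_add_one (hcarry N le_rfl), partialInc_eq hN]
      · refine Reach.descend (fun i ↦ counting α s 12 i (digits (n + 1))) Move.left.apply 0
          (fun a ha ↦ Move.apply_left_lt ha) (fun a ha ↦ ?_)
          (fun a ↦ le_counting (by decide) hm) ?_ _
        · simp [X.next, table, X.app, Scan.go, counting, X.scan, X.hb, ha]
        · refine Reach.step _ ?_ (le_counting (by decide) hm) h
          simp [X.next, table, X.app, Scan.go, counting, X.scan, X.hb, rest]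
    | of_succ i hi' ih =>
      refine Reach.step _ ?_ (le_counting (by decide) hm) ih
      simp only [X.next, table, X.scan, counting, X.hb, ite_self, hread, if_pos (hlt i hi')]
      simp only [Option.map_some, X.app, Scan.go, X.hb, ite_self, Move.apply_stay,
        Move.apply_right, Function.update_eq_self, partialInc_add_one (hcarry i hi'.le),
        Nat.cast_add, Nat.cast_one]
  have := key 0 (Nat.zero_le _)
  rwa [show counting α s 11 (0 : ℕ) (partialInc n 0) = rest 11 (digits n) α false s by
    simp [counting, rest, partialInc, funext_iff]] at this

end

/-! ### Running all programs for all clock values -/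

/-- The program `l` sets the skip flag at the end of pass `α` for the first time. -/
def SignalsAt (k : Ordinal.{0}) (l : List Op) (α : Ordinal.{0}) : Prop :=
  (runOps k l (startAt k l α)).skip = true ∧
    ∀ t < α, (runOps k l (startAt k l t)).skip = false

theorem SignalsAt.unique {k : Ordinal.{0}} {l : List Op} {α β : Ordinal.{0}}
    (hα : SignalsAt k l α) (hβ : SignalsAt k l β) : α = β := by
  rcases lt_trichotomy α β with h | h | h
  · exact absurd ((hβ.2 α h).symm.trans hα.1) Bool.false_ne_true
  · exact h
  · exact absurd ((hα.2 β h).symm.trans hβ.1) Bool.false_ne_true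

theorem digits_eq_false {n i : ℕ} (h : n ≤ i) (j : Fin 5) : digits n j i = false := by
  rw [digits_natCast]
  exact Nat.testBit_lt_two_pow
    (Nat.lt_two_pow_self.trans_le (Nat.pow_le_pow_right (by decide) (by omega)))

/-- From cell `n` on all digits vanish and read as `halt`; the program is what precedes the first
`halt`. -/
theorem exists_loaded (n : ℕ) : ∃ l, Loaded (digits n) l := by
  classical
  have h : ∃ i : ℕ, Op.decode (fun j ↦ digits n j i) = .halt :=
    ⟨n, by simp only [digits_eq_false le_rfl]; rfl⟩
  refine ⟨(List.range (Nat.find h)).map fun i : ℕ ↦ Op.decode fun j ↦ digits n j i, ?_, ?_, ?_⟩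
  · intro i hi
    simp
  · simpa using Nat.find_spec h
  · intro o ho
    simp only [List.mem_map, List.mem_range] at ho
    obtain ⟨i, hi, rfl⟩ := ho
    exact Nat.find_min h hi

theorem exists_stride (n : ℕ) :
    ∃ g : ℕ, (∀ i : ℕ, i < g → digits n 4 i = true) ∧ digits n 4 g = false := by
  classical
  have h : ∃ i : ℕ, digits n 4 i = false := ⟨n, digits_eq_false le_rfl 4⟩
  exact ⟨Nat.find h, fun i hi ↦ by simpa using Nat.find_min h hi, Nat.find_spec h⟩

/-- The program with the number `n` signals in pass `α`. -/
def Succeeds (n : ℕ) (α : Ordinal.{0}) : Prop :=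
  SignalsAt ((exists_stride n).choose + 1 : ℕ) (exists_loaded n).choose α

section
variable {α : Ordinal.{0}} {m : X} {p : X → Prop}

/-- The universal machine runs the program with the number `n`. -/
theorem Reach.runCode (n : ℕ) (hm : m ≤ rest 2 (fun _ _ ↦ false) α false false) (b : Bool)
    (hb : b = true ↔ Succeeds n α)
    (h : Reach m (rest 11 (digits n) (if b then α + 1 else α) false b) p) :
    Reach m (rest 3 (digits n) α true false) p := by
  classical
  obtain ⟨hg1, hg2⟩ := (exists_stride n).choose_spec
  have hl := (exists_loaded n).choose_spec
  unfold Succeeds SignalsAt at hb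
  set g := (exists_stride n).choose
  set l := (exists_loaded n).choose
  set k : Ordinal.{0} := ((g + 1 : ℕ) : Ordinal.{0}) with hk
  have hm3 : m ≤ rest 3 (digits n) α false false := X.le_trans hm ⟨show 2 ≤ 3 by decide, le_rfl,
    le_rfl, le_rfl, le_rfl, fun _ _ ↦ Bool.false_le _, le_rfl, le_rfl, le_rfl, le_rfl, le_rfl⟩
  -- `δ` is the pass in which the run ends: the first pass with a signal, if it comes before `α`,
  -- and `α` otherwise.
  obtain ⟨δ, hδ, h1, h2⟩ : ∃ δ ≤ α, (∀ t < δ, (runOps k l (startAt k l t)).skip = false) ∧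
      (δ < α → (runOps k l (startAt k l δ)).skip = true) := by
    by_cases hex : ∃ t < α, (runOps k l (startAt k l t)).skip = true
    · refine ⟨sInf {t | (runOps k l (startAt k l t)).skip = true}, ?_, fun t ht ↦ ?_, fun _ ↦ ?_⟩
      · obtain ⟨t, h1, h2⟩ := hex
        exact le_trans (csInf_le' (s := {t | (runOps k l (startAt k l t)).skip = true}) h2) h1.le
      · simpa using notMem_of_lt_csInf' ht
      · obtain ⟨t, h1, h2⟩ := hex
        exact csInf_mem (s := {t | (runOps k l (startAt k l t)).skip = true}) ⟨t, h2⟩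
    · push Not at hex
      exact ⟨α, le_rfl, fun t ht ↦ by simpa using hex t ht, fun h ↦ absurd h (lt_irrefl _)⟩
  have hmi : ∀ (t v : Ordinal.{0}) (D : Ordinal.{0} → Bool), m ≤ interp (digits n) α 3 0 0 0 t D v :=
    fun t v D ↦ X.le_trans hm3 ⟨le_rfl, le_rfl, le_rfl, le_rfl, zero_le, le_rfl,
      fun _ ↦ Bool.false_le _, fun _ ↦ Bool.false_le _, le_rfl, Bool.false_le _, le_rfl⟩
  have hrest : rest 3 (digits n) α true false =
      fetch (digits n) α 0 0 ⟨fun _ ↦ false, 0, false⟩ 0 := by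
    simp [rest, fetch, interp, below, funext_iff]
  rw [hrest]
  refine Reach.passes hl hg1 hg2 δ hδ h1 (hmi _ _ _) fun v hv ↦ ?_
  have := DReach.execList (m := m) (α := α) (t := δ) (p := p) hl hg1 hg2 [] l rfl v
    (startAt k l δ) ⟨zero_le, hv⟩ (hmi _ _ _) fun v' _ hw ↦
      SReach.endRun hl _ hδ h2 hw.2 hm3 b (hb.trans ⟨fun h3 ↦ ?_, fun h3 ↦ ?_⟩) h
  · simpa only [List.length_nil, Nat.cast_zero] using this.reach
  · rcases hδ.lt_or_eq with h4 | rfl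
    · exact absurd ((h3.2 δ h4).symm.trans (h2 h4)) Bool.false_ne_true
    · exact ⟨rfl, h3.1⟩
  · obtain ⟨rfl, h4⟩ := h3
    exact ⟨h4, h1⟩

end

open Ordinal in
/-- The natural number that is equal to a finite ordinal. -/
noncomputable def index (η : Ordinal.{0}) : ℕ := Cardinal.toNat η.card

theorem index_natCast (n : ℕ) : index n = n := by
  simp [index]

-- At `ω` the inferior limit is `b` as soon as the lower bounds are eventually at least `b` and the
-- upper bounds are at most `b` infinitely often.
open Ordinal in
theorem isLim_index {β : Type*} [LinearOrder β] {f g : ℕ → β} {b : β}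
    (h1 : ∃ N, ∀ n ≥ N, b ≤ f n) (h2 : ∀ N, ∃ n ≥ N, g n ≤ b) :
    IsLim ω (fun η ↦ f (index η)) (fun η ↦ g (index η)) b := by
  constructor
  · intro c hc
    obtain ⟨N, hN⟩ := h1
    refine ⟨N, natCast_lt_omega0 N, fun s hs hs' ↦ ?_⟩
    obtain ⟨n, rfl⟩ := lt_omega0.1 hs'
    rw [index_natCast]
    exact hc.trans_le (hN n (by exact_mod_cast hs))
  · rintro c ⟨s, hs, h⟩
    obtain ⟨N, rfl⟩ := lt_omega0.1 hs
    obtain ⟨n, hn, h3⟩ := h2 N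
    have := h n (by exact_mod_cast hn) (natCast_lt_omega0 n)
    simp only [index_natCast] at this
    exact this.trans_le h3

open Ordinal in
/-- Loops with `ω` rounds. -/
theorem Reach.loop_omega {m₀ z : X} {p : X → Prop} (c m : ℕ → X)
    (hs : ∀ n, SReach (m n) (c n) (· = c (n + 1)))
    (hl : XLim ω (fun η ↦ m (index η)) (fun η ↦ c (index η)) z)
    (hD : ∀ y, IsLim ω (fun η ↦ (m (index η)).D y) (fun η ↦ (c (index η)).D y) (z.D y))
    (hm : ∀ n, m₀ ≤ m n) (h : Reach m₀ z p) : Reach m₀ (c 0) p := by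
  classical
  let c' : Ordinal.{0} → X := fun η ↦ if η < ω then c (index η) else z
  have h1 : ∀ η < ω, c' η = c (index η) := fun η hη ↦ if_pos hη
  have h2 : c' ω = z := if_neg (lt_irrefl _)
  have h3 : c' 0 = c 0 := by
    rw [h1 0 omega0_pos, ← Nat.cast_zero, index_natCast]
  have key := Reach.loop_exact c' (fun η ↦ m (index η)) m₀ ω ?_ ?_ fun η _ ↦ hm _
  · rw [h3, h2] at key
    exact key.trans (by rintro _ rfl; exact h)
  · intro η hη
    obtain ⟨n, rfl⟩ := lt_omega0.1 hη
    have h4 : c' (n + 1 : ℕ) = c (n + 1) := by rw [h1 _ (natCast_lt_omega0 _), index_natCast]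
    rw [h1 n hη, index_natCast]
    rw [Nat.cast_add, Nat.cast_one] at h4
    rw [h4]
    exact hs n
  · intro l hl' hl''
    obtain rfl : l = ω := le_antisymm hl' (omega0_le_of_isSuccLimit hl'')
    rw [h2]
    refine ⟨hl.congr (fun _ _ ↦ rfl) h1, fun y ↦ ⟨(hD y).lower, fun b hb ↦ (hD y).upper b
      (hb.mono fun η hη h ↦ ?_)⟩⟩
    rwa [h1 η hη] at h

section
variable {α : Ordinal.{0}} {m : X} {p : X → Prop}

-- Every digit is `0` in arbitrarily large numbers, so at the limit of all programs the counter is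
-- blank again without any action of the machine.
open Classical in
theorem frequently_digits (j : Fin 5) (y : Ordinal.{0}) (N : ℕ) :
    ∃ n ≥ N, digits n j y = false := by
  by_cases hy : ∃ i : ℕ, y = i
  · obtain ⟨i, rfl⟩ := hy
    refine ⟨2 ^ (5 * i + j + 1 + N), ?_, ?_⟩
    · have h1 : N < 2 ^ N := Nat.lt_two_pow_self
      have h2 : 2 ^ N ≤ 2 ^ (5 * i + j + 1 + N) := Nat.pow_le_pow_right (by decide) (by omega)
      omega
    · rw [digits_natCast, Nat.testBit_two_pow]
      simp
      omega
  · refine ⟨N, le_rfl, ?_⟩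
    exact decide_eq_false fun ⟨i, h, _⟩ ↦ hy ⟨i, h⟩

theorem rest_le_rest {q q' : ℕ} {B : Fin 5 → Ordinal.{0} → Bool} {α' : Ordinal.{0}} {f s s' : Bool}
    (hq : q ≤ q') (hα : α ≤ α') (hs : s ≤ s') :
    rest q (fun _ _ ↦ false) α false s ≤ rest q' B α' f s' :=
  ⟨hq, le_rfl, le_rfl, le_rfl, le_rfl, fun _ _ ↦ Bool.false_le _, le_rfl, le_rfl, below_mono hα,
    Bool.false_le _, hs⟩

open Classical in
/-- The universal machine runs all programs. -/
theorem Reach.round (hm : m ≤ rest 1 (fun _ _ ↦ false) α false false) (b : Bool)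
    (hb : b = true ↔ ∃ n, Succeeds n α)
    (h : Reach m (rest 2 (fun _ _ ↦ false) (if b then α + 1 else α) false b) p) :
    Reach m (rest 1 (fun _ _ ↦ false) α false false) p := by
  -- `S n` is the register `s` before program `n`, and `A` the corresponding length of the clock. In
  -- `c`, even indices stand before a program and odd ones before the counter is increased; `d`
  -- bounds these rounds from below.
  let S : ℕ → Bool := fun n ↦ decide (∃ i < n, Succeeds i α)
  let A : Bool → Ordinal.{0} := fun s ↦ if s then α + 1 else α
  have hA : ∀ s, α ≤ A s := fun s ↦ by
    cases s
    · exact le_rfl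
    · exact le_self_add
  let c : ℕ → X := fun n ↦ if n % 2 = 0 then rest 2 (digits (n / 2)) (A (S (n / 2))) true (S (n / 2))
    else rest 11 (digits (n / 2)) (A (S (n / 2 + 1))) false (S (n / 2 + 1))
  let d : ℕ → X := fun n ↦ rest 2 (fun _ _ ↦ false) (A (S ((n + 1) / 2))) false (S ((n + 1) / 2))
  have hc0 : ∀ n, c (2 * n) = rest 2 (digits n) (A (S n)) true (S n) := fun n ↦ by
    simp [c]
  have hc1 : ∀ n, c (2 * n + 1) = rest 11 (digits n) (A (S (n + 1))) false (S (n + 1)) :=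
    fun n ↦ by
      have : (2 * n + 1) / 2 = n := by omega
      simp [c, this]
  have hd0 : ∀ n, d (2 * n) = rest 2 (fun _ _ ↦ false) (A (S n)) false (S n) := fun n ↦ by
    simp only [d, show (2 * n + 1) / 2 = n by omega]
  have hd1 : ∀ n, d (2 * n + 1) = rest 2 (fun _ _ ↦ false) (A (S (n + 1))) false (S (n + 1)) :=
    fun n ↦ by simp only [d, show (2 * n + 1 + 1) / 2 = n + 1 by omega]
  have hS : ∃ N, ∀ n ≥ N, S n = b := by
    by_cases hex : ∃ n, Succeeds n α
    · obtain ⟨N, hN⟩ := hex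
      refine ⟨N + 1, fun n hn ↦ ?_⟩
      rw [hb.2 ⟨N, hN⟩]
      exact decide_eq_true ⟨N, hn, hN⟩
    · refine ⟨0, fun n _ ↦ ?_⟩
      have : b = false := by rwa [← Bool.not_eq_true, hb]
      rw [this]
      exact decide_eq_false fun ⟨i, _, hi⟩ ↦ hex ⟨i, hi⟩
  have hcd : ∀ n, ∃ q B f, 2 ≤ q ∧ c n = rest q B (A (S ((n + 1) / 2))) f (S ((n + 1) / 2)) := by
    intro n
    obtain ⟨k, rfl | rfl⟩ : ∃ k, n = 2 * k ∨ n = 2 * k + 1 := ⟨n / 2, by omega⟩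
    · exact ⟨_, _, _, le_rfl, by rw [hc0, show (2 * k + 1) / 2 = k by omega]⟩
    · exact ⟨11, _, _, by decide, by rw [hc1, show (2 * k + 1 + 1) / 2 = k + 1 by omega]⟩
  have hstep : ∀ n, SReach (d n) (c n) (· = c (n + 1)) := by
    intro n
    obtain ⟨k, rfl | rfl⟩ : ∃ k, n = 2 * k ∨ n = 2 * k + 1 := ⟨n / 2, by omega⟩
    · rw [hc0, hc1, hd0]
      by_cases hk : ∃ i < k, Succeeds i α
      · have h1 : S k = true := decide_eq_true hk
        have h2 : S (k + 1) = true := decide_eq_true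
          (hk.imp fun i hi ↦ ⟨hi.1.trans (Nat.lt_succ_self k), hi.2⟩)
        rw [h1, h2]
        refine SReach.step _ ?_ (rest_le_rest le_rfl le_rfl le_rfl) (Reach.refl rfl)
        simp [X.next, table, X.app, Scan.go, X.scan, X.hb, rest]
      · have h1 : S k = false := decide_eq_false hk
        have h2 : S (k + 1) = true ↔ Succeeds k α := by
          simp only [S, decide_eq_true_eq]
          refine ⟨fun ⟨i, h3, h4⟩ ↦ ?_, fun h3 ↦ ⟨k, Nat.lt_succ_self k, h3⟩⟩
          rcases (Nat.lt_succ_iff_lt_or_eq.1 h3) with h5 | rfl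
          · exact absurd ⟨i, h5, h4⟩ hk
          · exact h4
        rw [h1]
        refine SReach.step (rest 3 (digits k) α true false) ?_
          (rest_le_rest le_rfl (hA _) le_rfl) (Reach.runCode k
          (rest_le_rest le_rfl le_rfl le_rfl) (S (k + 1)) h2 (Reach.refl rfl))
        simp [X.next, table, X.app, Scan.go, X.scan, X.hb, rest, A]
    · rw [hc1, hd1, show 2 * k + 1 + 1 = 2 * (k + 1) by ring, hc0]
      refine Reach.strict (Reach.increment k (rest_le_rest le_rfl le_rfl le_rfl) (Reach.refl rfl)) ?_
      rintro _ rfl he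
      have : 2 = 11 := congrArg (fun c : Config 14 ↦ c.state) he
      exact absurd this (by decide)
  refine Reach.step (c 0) ?_ hm ?_
  · rw [show c 0 = rest 2 (digits 0) (A (S 0)) true (S 0) from hc0 0]
    simp [X.next, table, X.app, Scan.go, X.scan, X.hb, rest, A, S, digits_zero]
  obtain ⟨N, hN⟩ := hS
  have hS' : ∀ n ≥ 2 * N, S ((n + 1) / 2) = b := fun n hn ↦ hN _ (by omega)
  have hdc : ∀ n, d n = rest 2 (fun _ _ ↦ false) (A (S ((n + 1) / 2))) false (S ((n + 1) / 2)) :=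
    fun _ ↦ rfl
  have freq : ∀ n, c (2 * n) = rest 2 (digits n) (A (S n)) true (S n) := hc0
  refine Reach.loop_omega (z := rest 2 (fun _ _ ↦ false) (A b) false b) c d hstep
    ⟨isLim_index (f := fun n ↦ (d n).q) (g := fun n ↦ (c n).q)
        ⟨0, fun n _ ↦ le_rfl⟩ fun n ↦ ⟨2 * n, by omega, ?_⟩,
      isLim_index (f := fun n ↦ (d n).hc) (g := fun n ↦ (c n).hc)
        ⟨0, fun n _ ↦ le_rfl⟩ fun n ↦ ⟨2 * n, by omega, ?_⟩,
      isLim_index (f := fun n ↦ (d n).hg) (g := fun n ↦ (c n).hg)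
        ⟨0, fun n _ ↦ le_rfl⟩ fun n ↦ ⟨2 * n, by omega, ?_⟩,
      isLim_index (f := fun n ↦ (d n).hd) (g := fun n ↦ (c n).hd)
        ⟨0, fun n _ ↦ le_rfl⟩ fun n ↦ ⟨2 * n, by omega, ?_⟩,
      isLim_index (f := fun n ↦ (d n).hk) (g := fun n ↦ (c n).hk)
        ⟨0, fun n _ ↦ le_rfl⟩ fun n ↦ ⟨2 * n, by omega, ?_⟩,
      fun j y ↦ isLim_index (f := fun n ↦ (d n).B j y) (g := fun n ↦ (c n).B j y)
        ⟨0, fun n _ ↦ le_rfl⟩ fun n ↦ ?_,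
      fun y ↦ isLim_index (f := fun n ↦ (d n).V y) (g := fun n ↦ (c n).V y)
        ⟨0, fun n _ ↦ le_rfl⟩ fun n ↦ ⟨2 * n, by omega, ?_⟩,
      fun y ↦ isLim_index (f := fun n ↦ (d n).K y) (g := fun n ↦ (c n).K y)
        ⟨2 * N, fun n hn ↦ ?_⟩ fun n ↦ ⟨2 * (n + N), by omega, ?_⟩,
      isLim_index (f := fun n ↦ (d n).f) (g := fun n ↦ (c n).f) ⟨0, fun n _ ↦ le_rfl⟩ fun n ↦
        ⟨2 * n + 1, by omega, ?_⟩,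
      isLim_index (f := fun n ↦ (d n).s) (g := fun n ↦ (c n).s) ⟨2 * N, fun n hn ↦ ?_⟩ fun n ↦
        ⟨2 * (n + N), by omega, ?_⟩⟩
    (fun y ↦ isLim_index (f := fun n ↦ (d n).D y) (g := fun n ↦ (c n).D y)
      ⟨0, fun n _ ↦ le_rfl⟩ fun n ↦ ⟨2 * n, by omega, ?_⟩)
    (fun n ↦ X.le_trans hm (rest_le_rest (by decide) (hA _) (Bool.false_le _))) h
  · rw [hc0]; exact le_rfl
  · rw [hc0]; exact le_rfl
  · rw [hc0]; exact le_rfl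
  · rw [hc0]; exact le_rfl
  · rw [hc0]; exact le_rfl
  · obtain ⟨k, h1, h2⟩ := frequently_digits j y n
    refine ⟨2 * k, by omega, ?_⟩
    rw [hc0]
    exact h2.le
  · rw [hc0]; exact le_rfl
  · rw [hdc, hS' n hn]
  · rw [hc0, hN _ (by omega)]; exact le_rfl
  · rw [hc1]; exact le_rfl
  · rw [hdc, hS' n hn]
  · rw [hc0, hN _ (by omega)]; exact le_rfl
  · rw [hc0]; exact le_rfl

end

/-- If there is an ordinal that no program signals, then there is a larger clockable ordinal. -/
theorem exists_clockable_of_not_succeeds {β : Ordinal.{0}} (h : ∀ n, ¬ Succeeds n β)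
    (hβ : ∀ α < β, ∃ n, Succeeds n α) : ∃ r, β < r ∧ Clockable r := by
  have h0 : univ.run (0 + 1) = (rest 1 (fun _ _ ↦ false) 0 false false).cfg := by
    rw [univ.run_succ, univ.run_zero]
    refine (Program.next_of_instr (P := univ) (a := initAction) rfl).trans ?_
    have h1 : Function.update (fun _ : Ordinal.{0} ↦ false) 0 true = mark true := by
      rw [← mark_update false true]
      congr 1
      funext y
      simp [mark]
    have h2 : Function.update (fun _ : Ordinal.{0} ↦ false) 0 false = fun _ ↦ false :=
      Function.update_eq_self 0 _
    have h3 : (fun _ : Ordinal.{0} ↦ false) = below 0 := by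
      funext y
      simp [below]
    have h4 : (fun _ : Ordinal.{0} ↦ false) = mark false := by
      funext y
      simp [mark]
    refine @Config.ext 14 _ _ rfl (funext fun i ↦ ?_) (funext fun i ↦ ?_)
    · exact match i with
        | 0 => rfl | 1 => rfl | 2 => rfl | 3 => rfl | 4 => rfl | 5 => rfl | 6 => rfl | 7 => rfl
        | 8 => rfl | 9 => rfl | 10 => rfl | 11 => rfl | 12 => rfl | 13 => rfl
    · exact match i with
        | 0 => h2 | 1 => h2 | 2 => h2 | 3 => h2 | 4 => h2 | 5 => h1 | 6 => h1 | 7 => h2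
        | 8 => h2 | 9 => h1 | 10 => h2.trans h3 | 11 => h1 | 12 => h2.trans h4 | 13 => h2.trans h4
  have hloop := exists_run_of_loop
    (fun α x ↦ x = rest 1 (fun _ _ ↦ false) α false false)
    (fun α x m u ↦ m = rest 1 (fun _ _ ↦ false) α false false ∧
      u = rest 1 (fun _ _ ↦ false) α false false)
    (rest 1 (fun _ _ ↦ false) 0 false false) _ β rfl ?_ ?_ ?_ _ h0
  · obtain ⟨s, -, hs, _, rfl, h1, -⟩ := hloop
    -- The clock has length `β` at time `s ≥ β`. No program succeeds now, so the round ends in state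
    -- `2` with both registers lowered, where no instruction applies.
    obtain ⟨t, -, _, rfl, h2, -⟩ := Reach.round (α := β)
      (m := rest 1 (fun _ _ ↦ false) β false false)
      (p := (· = rest 2 (fun _ _ ↦ false) β false false)) (rest_le_rest le_rfl le_rfl le_rfl) false
      (by simpa using h) (Reach.refl rfl) s h1
    have h3 : ¬ univ.IsFinal (univ.run s) := by
      rw [h1]
      refine fun h' ↦ absurd ((X.isFinal_cfg _ (by simp [rest])).1 h') ?_
      simp [rest, table]
    have h4 : univ.IsFinal (univ.run t) := by
      rw [h2]
      refine (X.isFinal_cfg _ (by simp [rest])).2 ?_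
      simp [rest, table, X.scan]
    obtain ⟨r, h5, h6⟩ := univ.clockable_of_isFinal h3 h4
    exact ⟨r, hs.trans_lt h5, h6⟩
  · rintro α hα _ rfl
    refine ⟨_, _, ⟨rfl, rfl⟩, SReach.toU (Reach.strict ?_ ?_)⟩
    · refine Reach.round (rest_le_rest le_rfl le_rfl le_rfl) true (by simpa using hβ α hα)
        (Reach.step _ ?_ (rest_le_rest (by decide) le_self_add (Bool.false_le _)) (Reach.refl rfl))
      · simp [X.next, table, X.app, Scan.go, X.scan, X.hb, rest]
    · rintro _ rfl he
      have : below (α + 1) = below α := congrArg (fun c : Config 14 ↦ c.tape 10) he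
      have := congrFun this α
      simp [below] at this
  · intro l _ hl xs ms us h1
    refine ⟨rest 1 (fun _ _ ↦ false) l false false,
      XLim.congr (f := fun α ↦ rest 1 (fun _ _ ↦ false) α false false)
        (g := fun α ↦ rest 1 (fun _ _ ↦ false) α false false)
      ⟨.const hl _, .const hl _, .const hl _, .const hl _, .const hl _,
        fun _ _ ↦ .const hl _, fun _ ↦ .const hl _, (isLim_id hl).below, .const hl _,
        .const hl _⟩ (fun α hα ↦ (h1 α hα).2.1) (fun α hα ↦ (h1 α hα).2.2), fun D _ h2 ↦ ?_⟩
    have : D = fun _ ↦ false := by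
      funext y
      by_contra hy
      obtain ⟨α, hα, h3⟩ := (h2 y (by simpa using hy)).exists
      rw [(h1 α hα).2.2] at h3
      exact Bool.false_ne_true h3
    rw [this]
    rfl
  · rintro α _ _ _ _ rfl ⟨rfl, -⟩
    exact rest_le_rest le_rfl zero_le le_rfl

/-! ### Building blocks of the simulating program -/

/-- While `l` is executed from `a`, the data satisfy `M`, and afterwards `p` holds. -/
def Wp (κ : Ordinal.{0}) (M : (Ordinal.{0} → Bool) → Prop) : List Op → Mem → (Mem → Prop) → Prop
  | [], a, p => M a.D ∧ p a
  | o :: l, a, p => M a.D ∧ Wp κ M l (o.exec κ (lead l) a) p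

theorem Wp.runOps {κ : Ordinal.{0}} {M : (Ordinal.{0} → Bool) → Prop} {l : List Op} {a : Mem}
    {p : Mem → Prop} (h : Wp κ M l a p) : p (runOps κ l a) := by
  induction l generalizing a with
  | nil => exact h.2
  | cons o l ih => exact ih h.2

/-- The purpose of `M`: whatever it forces to be `1` survives the whole pass and thus counts at
limits. -/
theorem Wp.common {κ : Ordinal.{0}} {M : (Ordinal.{0} → Bool) → Prop} {l : List Op} {a : Mem}
    {p : Mem → Prop} (h : Wp κ M l a p) {y : Ordinal.{0}} (hy : ∀ D, M D → D y = true) :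
    common κ l a y = true := by
  induction l generalizing a with
  | nil => exact hy _ h.1
  | cons o l ih => exact Bool.and_eq_true_iff.2 ⟨hy _ h.1, ih h.2⟩

theorem lead_replicate {o : Op} (ho : o ≠ .right) (n : ℕ) (l : List Op) :
    lead (List.replicate n .right ++ o :: l) = n := by
  induction n with
  | zero => exact lead_cons_of_ne ho l
  | succ n ih => exact congrArg (· + 1) ih

/-- The cell in column `x` and row `r`, when there are `g + 1` rows. -/
noncomputable def cell (g : ℕ) (x : Ordinal.{0}) (r : ℕ) : Ordinal.{0} :=
  ((g + 1 : ℕ) : Ordinal.{0}) * x + r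

theorem cell_inj {g : ℕ} {x x' : Ordinal.{0}} {r r' : ℕ} (hr : r ≤ g) (hr' : r' ≤ g)
    (h : cell g x r = cell g x' r') : x = x' ∧ r = r' := by
  have h0 : ((g + 1 : ℕ) : Ordinal.{0}) ≠ 0 := by simp
  have key : ∀ (x : Ordinal.{0}) (r : ℕ), r ≤ g → cell g x r / (g + 1 : ℕ) = x := fun x r hr ↦ by
    rw [cell, Ordinal.mul_add_div _ h0, Ordinal.div_eq_zero_of_lt, add_zero]
    exact_mod_cast Nat.lt_succ_of_le hr
  obtain rfl : x = x' := by rw [← key x r hr, h, key x' r' hr']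
  refine ⟨rfl, ?_⟩
  have := add_left_cancel (a := ((g + 1 : ℕ) : Ordinal.{0}) * x) h
  exact_mod_cast this

theorem cell_zero (g r : ℕ) : cell g 0 r = r := by
  simp [cell]

section
variable {g : ℕ} {M : (Ordinal.{0} → Bool) → Prop} {D : Ordinal.{0} → Bool} {x : Ordinal.{0}}
  {l : List Op} {p : Mem → Prop}

theorem Wp.skip {κ : Ordinal.{0}} (hM : M D) (l' : List Op) (hl' : Op.nop ∉ l')
    (h : Wp κ M l ⟨D, x, true⟩ p) : Wp κ M (l' ++ l) ⟨D, x, true⟩ p := by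
  induction l' with
  | nil => exact h
  | cons o l' ih =>
    simp only [List.mem_cons, not_or] at hl'
    refine ⟨hM, ?_⟩
    have : o.exec κ (lead (l' ++ l)) ⟨D, x, true⟩ = ⟨D, x, true⟩ := by
      simp [Op.exec, Ne.symm hl'.1]
    change Wp κ M (l' ++ l) (o.exec κ (lead (l' ++ l)) ⟨D, x, true⟩) p
    rw [this]
    exact ih hl'.2

theorem Wp.rights {κ : Ordinal.{0}} (hM : M D) (n : ℕ) (h : Wp κ M l ⟨D, x + n, false⟩ p) :
    Wp κ M (List.replicate n .right ++ l) ⟨D, x, false⟩ p := by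
  induction n generalizing x with
  | zero => simpa using h
  | succ n ih =>
    refine ⟨hM, ?_⟩
    refine ih (x := x + 1) ?_
    rwa [add_assoc, show (1 : Ordinal.{0}) + n = (n + 1 : ℕ) by exact_mod_cast Nat.add_comm 1 n]

theorem Wp.lefts {κ : Ordinal.{0}} (hM : M D) (n : ℕ)
    (h : Wp κ M l ⟨D, Move.left.apply^[n] x, false⟩ p) :
    Wp κ M (List.replicate n .left ++ l) ⟨D, x, false⟩ p := by
  induction n generalizing x with
  | zero => exact h
  | succ n ih => exact ⟨hM, ih h⟩

theorem left_iterate_add (x : Ordinal.{0}) (n : ℕ) : Move.left.apply^[n] (x + n) = x := by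
  induction n with
  | zero => simp
  | succ n ih =>
    rw [Function.iterate_succ_apply, Nat.cast_add, Nat.cast_one, ← add_assoc,
      Move.apply_left_add_one, ih]

theorem left_iterate_zero (n : ℕ) : Move.left.apply^[n] 0 = 0 := by
  induction n with
  | zero => rfl
  | succ n ih => rw [Function.iterate_succ_apply, Move.apply_left_zero, ih]

/-- A column has `g + 1` cells, so `g + 1` moves on the data imitate one move of the simulated head.
At a limit column the first move already leads to `0`, as it should. -/
theorem left_iterate_mul (g : ℕ) (h : Ordinal.{0}) :
    Move.left.apply^[g + 1] (((g + 1 : ℕ) : Ordinal.{0}) * h) =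
      ((g + 1 : ℕ) : Ordinal.{0}) * Move.left.apply h := by
  induction h using Ordinal.limitRecOn with
  | zero => rw [mul_zero, left_iterate_zero, Move.apply_left_zero, mul_zero]
  | add_one h _ => rw [mul_add_one, left_iterate_add, Move.apply_left_add_one]
  | limit h hl _ =>
    have h0 : (0 : Ordinal.{0}) < (g + 1 : ℕ) := by simp
    rw [Function.iterate_succ_apply,
      Move.apply_left_limit ((Ordinal.isNormal_mul_right h0).map_isSuccLimit hl),
      left_iterate_zero, Move.apply_left_limit hl, mul_zero]

/-- Row `i` of `D` describes a head in position `h`. -/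
def HeadRow (g : ℕ) (D : Ordinal.{0} → Bool) (i : ℕ) (h : Ordinal.{0}) : Prop :=
  ∀ x, D (cell g x i) = below h x

/-- A head position is stored in unary, so its column is that of the first `0` in its row. -/
theorem HeadRow.gapIndex {i : ℕ} {h : Ordinal.{0}} (hD : HeadRow g D i h) :
    gapIndex (g + 1 : ℕ) i D 0 = h := by
  have : {η : Ordinal.{0} | D (0 + (g + 1 : ℕ) * η + i) = false} = Set.Ici h := by
    ext η
    have := hD η
    rw [cell] at this
    simp only [zero_add, Set.mem_ofPred_eq, this, below, Set.mem_Ici, decide_eq_false_iff_not,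
      not_lt]
  rw [OTM.gapIndex, this]
  exact csInf_Ici

/-- Moving the pointer to the position of a head. -/
theorem Wp.seek {i : ℕ} {h : Ordinal.{0}} (hM : M D) (hD : HeadRow g D i h) {o : Op}
    (ho : o ≠ .right)
    (hw : Wp (g + 1 : ℕ) M (o :: l) ⟨D, cell g h i, false⟩ p) :
    Wp (g + 1 : ℕ) M (.reset :: .seek :: (List.replicate i .right ++ o :: l)) ⟨D, x, false⟩ p := by
  refine ⟨hM, hM, ?_⟩
  rw [lead_replicate ho]
  have : Op.seek.exec (g + 1 : ℕ) i (Op.reset.exec (g + 1 : ℕ)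
      (lead (Op.seek :: (List.replicate i Op.right ++ o :: l))) ⟨D, x, false⟩) =
      ⟨D, ((g + 1 : ℕ) : Ordinal.{0}) * h, false⟩ := by
    simp only [Op.exec, Bool.false_eq_true, if_false, hD.gapIndex, zero_add]
  rw [this]
  exact Wp.rights hM i hw

end

/-- Cells of the data: one in a given row, or one that is scanned by a head. -/
inductive Loc (k : ℕ) where
  | row (r : ℕ)
  | scan (i : Fin k)

section
variable {k : ℕ}

def Loc.code : Loc k → List Op
  | .row r => .reset :: List.replicate r .right
  | .scan i => .reset :: .seek :: (List.replicate i .right ++ .idle :: List.replicate k .right)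

noncomputable def Loc.pos (g : ℕ) (h : Fin k → Ordinal.{0}) : Loc k → Ordinal.{0}
  | .row r => r
  | .scan i => cell g (h i) (k + i)

theorem Loc.nop_notMem_code (L : Loc k) : Op.nop ∉ L.code := by
  cases L <;> simp [Loc.code, List.mem_replicate]

variable {g : ℕ} {M : (Ordinal.{0} → Bool) → Prop} {D : Ordinal.{0} → Bool} {x : Ordinal.{0}}
  {l : List Op} {p : Mem → Prop} {h : Fin k → Ordinal.{0}}

theorem Wp.locate (hM : M D) (hD : ∀ i : Fin k, HeadRow g D i (h i)) (L : Loc k)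
    (hw : Wp (g + 1 : ℕ) M l ⟨D, L.pos g h, false⟩ p) :
    Wp (g + 1 : ℕ) M (L.code ++ l) ⟨D, x, false⟩ p := by
  cases L with
  | row r =>
    refine ⟨hM, Wp.rights (x := 0) hM r ?_⟩
    rw [zero_add]
    exact hw
  | scan i =>
    rw [Loc.code, List.cons_append, List.cons_append, List.append_assoc, List.cons_append]
    refine Wp.seek hM (hD i) (by decide) ⟨hM, Wp.rights hM k ?_⟩
    have : cell g (h i) i + k = cell g (h i) (k + i) := by
      rw [cell, cell, add_assoc]
      congr 1
      exact_mod_cast Nat.add_comm i k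
    exact this ▸ hw

/-- Compare cells with given symbols, and start skipping if they are different. -/
def checkCode (cs : List (Loc k × Bool)) : List Op :=
  cs.flatMap fun c ↦ c.1.code ++ [if c.2 then .test else .testNot]

theorem nop_notMem_checkCode (cs : List (Loc k × Bool)) : Op.nop ∉ checkCode cs := by
  simp only [checkCode, List.mem_flatMap, not_exists, not_and, List.mem_append, not_or]
  refine fun c _ ↦ ⟨c.1.nop_notMem_code, ?_⟩
  split_ifs <;> simp

/-- The remaining comparisons contain no `nop`, so after a failure everything up to the end of the
list is skipped. -/
theorem Wp.check (hM : M D) (hD : ∀ i : Fin k, HeadRow g D i (h i)) (cs : List (Loc k × Bool))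
    (h1 : (∀ c ∈ cs, D (c.1.pos g h) = c.2) → ∀ x, Wp (g + 1 : ℕ) M l ⟨D, x, false⟩ p)
    (h2 : (∃ c ∈ cs, D (c.1.pos g h) ≠ c.2) → ∀ x, Wp (g + 1 : ℕ) M l ⟨D, x, true⟩ p) :
    Wp (g + 1 : ℕ) M (checkCode cs ++ l) ⟨D, x, false⟩ p := by
  induction cs generalizing x with
  | nil => exact h1 (by simp) x
  | cons c cs ih =>
    have hc : checkCode (c :: cs) ++ l =
        c.1.code ++ (if c.2 then .test else .testNot) :: (checkCode cs ++ l) := by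
      simp [checkCode]
    rw [hc]
    refine Wp.locate hM hD c.1 ⟨hM, ?_⟩
    have hx : ∀ n, (if c.2 then Op.test else Op.testNot).exec (g + 1 : ℕ) n
        ⟨D, c.1.pos g h, false⟩ = ⟨D, c.1.pos g h, decide (D (c.1.pos g h) ≠ c.2)⟩ := fun n ↦ by
      cases hc2 : c.2 <;> cases hd : D (c.1.pos g h) <;> simp [Op.exec, hd]
    rw [hx]
    by_cases hc : D (c.1.pos g h) = c.2
    · rw [decide_eq_false (not_not.2 hc)]
      refine ih (fun h3 ↦ h1 ?_) (fun ⟨d, h3, h4⟩ ↦ h2 ⟨d, List.mem_cons_of_mem _ h3, h4⟩)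
      exact List.forall_mem_cons.2 ⟨hc, h3⟩
    · rw [decide_eq_true hc]
      exact Wp.skip hM _ (nop_notMem_checkCode cs) (h2 ⟨c, List.mem_cons_self, hc⟩ _)

end

open Classical in
/-- The data `D` where the cells in `S` have been changed to their values in `W`. -/
noncomputable def mix (S : Set Ordinal.{0}) (D W : Ordinal.{0} → Bool) (y : Ordinal.{0}) : Bool :=
  if y ∈ S then W y else D y

theorem mix_empty (D W : Ordinal.{0} → Bool) : mix ∅ D W = D := by
  funext y
  simp [mix]

theorem mix_eq {S : Set Ordinal.{0}} {D W : Ordinal.{0} → Bool} (h : ∀ y ∉ S, D y = W y) :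
    mix S D W = W := by
  funext y
  by_cases hy : y ∈ S <;> simp [mix, hy, h]

theorem update_mix {S : Set Ordinal.{0}} {D W : Ordinal.{0} → Bool} {y : Ordinal.{0}} {v : Bool}
    (h : W y = v) : Function.update (mix S D W) y v = mix (insert y S) D W := by
  funext z
  rcases eq_or_ne z y with rfl | hz
  · simp [mix, h]
  · rw [Function.update_of_ne hz]
    by_cases hS : z ∈ S
    · exact (if_pos hS).trans (if_pos (Set.mem_insert_of_mem y hS)).symm
    · exact (if_neg hS).trans (if_neg fun h' ↦ h'.elim hz hS).symm

theorem HeadRow.mix {g i : ℕ} {D W : Ordinal.{0} → Bool} {h : Ordinal.{0}} (hD : HeadRow g D i h)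
    {S : Set Ordinal.{0}} (hS : ∀ x, cell g x i ∉ S) : HeadRow g (mix S D W) i h := fun x ↦ by
  rw [← hD x]
  exact if_neg (hS x)

section
variable {k g : ℕ} {M : (Ordinal.{0} → Bool) → Prop} {D W : Ordinal.{0} → Bool} {x : Ordinal.{0}}
  {l : List Op} {p : Mem → Prop} {h : Fin k → Ordinal.{0}}

/-- Write symbols into given cells. -/
def writeCode (ws : List (Loc k × Bool)) : List Op :=
  ws.flatMap fun c ↦ c.1.code ++ [if c.2 then .set else .clear]

theorem nop_notMem_writeCode (ws : List (Loc k × Bool)) : Op.nop ∉ writeCode ws := by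
  simp only [writeCode, List.mem_flatMap, not_exists, not_and, List.mem_append, not_or]
  refine fun c _ ↦ ⟨c.1.nop_notMem_code, ?_⟩
  split_ifs <;> simp

/-- Each written cell jumps from its old to its final value, so all intermediate data are mixtures
of `D` and `W`. The head rows are avoided, so that scanned cells can still be found. -/
theorem Wp.write (hM : ∀ S, M (mix S D W)) (hD : ∀ i : Fin k, HeadRow g D i (h i))
    (S : Set Ordinal.{0}) (hS : ∀ (i : Fin k) x, cell g x i ∉ S) (ws : List (Loc k × Bool))
    (hws : ∀ c ∈ ws, W (c.1.pos g h) = c.2 ∧ ∀ (i : Fin k) x, cell g x i ≠ c.1.pos g h)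
    (hp : ∀ x, Wp (g + 1 : ℕ) M l ⟨mix (S ∪ {y | ∃ c ∈ ws, y = c.1.pos g h}) D W, x, false⟩ p) :
    Wp (g + 1 : ℕ) M (writeCode ws ++ l) ⟨mix S D W, x, false⟩ p := by
  induction ws generalizing S x with
  | nil => simpa [writeCode] using hp x
  | cons c ws ih =>
    have hc : writeCode (c :: ws) ++ l =
        c.1.code ++ (if c.2 then .set else .clear) :: (writeCode ws ++ l) := by
      simp [writeCode]
    obtain ⟨h1, h2⟩ := List.forall_mem_cons.1 hws
    rw [hc]
    refine Wp.locate (hM S) (fun i ↦ (hD i).mix (hS i)) c.1 ⟨hM S, ?_⟩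
    have hx : ∀ n, (if c.2 then Op.set else Op.clear).exec (g + 1 : ℕ) n
        ⟨mix S D W, c.1.pos g h, false⟩ =
        ⟨mix (insert (c.1.pos g h) S) D W, c.1.pos g h, false⟩ := fun n ↦ by
      rw [← update_mix h1.1]
      cases hc2 : c.2 <;> simp [Op.exec]
    rw [hx]
    refine ih _ (fun i x ↦ ?_) h2 fun x ↦ ?_
    · rw [Set.mem_insert_iff, not_or]
      exact ⟨h1.2 i x, hS i x⟩
    · have : insert (c.1.pos g h) S ∪ {y | ∃ c ∈ ws, y = c.1.pos g h} =
          S ∪ {y | ∃ d ∈ c :: ws, y = d.1.pos g h} := by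
        ext y
        simp only [Set.mem_union, Set.mem_insert_iff, Set.mem_ofPred_eq, List.mem_cons,
          exists_eq_or_imp]
        tauto
      rw [this]
      exact hp x

/-- Move a head. -/
def moveCode (g i : ℕ) : Move → List Op
  | .stay => []
  | .right => .reset :: .seek :: (List.replicate i .right ++ [.set])
  | .left => .reset :: .seek :: (List.replicate i .right ++ .left ::
      (List.replicate (g + i) .left ++ .erase :: (List.replicate i .right ++ [.idle])))

theorem nop_notMem_moveCode (g i : ℕ) (mv : Move) : Op.nop ∉ moveCode g i mv := by
  cases mv <;> simp [moveCode, List.mem_replicate]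

theorem left_iterate_cell (g i : ℕ) (h : Ordinal.{0}) :
    Move.left.apply^[g + i + 1] (cell g h i) = ((g + 1 : ℕ) : Ordinal.{0}) * Move.left.apply h := by
  rw [show g + i + 1 = g + 1 + i by ring, Function.iterate_add_apply, cell, left_iterate_add,
    left_iterate_mul]

theorem Wp.move (hM : ∀ S, M (mix S D W)) {i : ℕ} {h : Ordinal.{0}} (mv : Move)
    (hD : HeadRow g D i h) (hW : HeadRow g W i (mv.apply h)) {S : Set Ordinal.{0}}
    (hS : ∀ x, cell g x i ∉ S) : ∃ S', S ⊆ S' ∧ (∀ y ∈ S', y ∈ S ∨ ∃ x, y = cell g x i) ∧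
      (∀ x, cell g x i ∉ S' → D (cell g x i) = W (cell g x i)) ∧ ∀ {l p x},
      (∀ x, Wp (g + 1 : ℕ) M l ⟨mix S' D W, x, false⟩ p) →
      Wp (g + 1 : ℕ) M (moveCode g i mv ++ l) ⟨mix S D W, x, false⟩ p := by
  have hm : HeadRow g (OTM.mix S D W) i h := hD.mix hS
  cases mv with
  | stay =>
    exact ⟨S, subset_rfl, fun y hy ↦ Or.inl hy, fun x _ ↦ (hD x).trans (hW x).symm, fun hw ↦ hw _⟩
  | right =>
    refine ⟨insert (cell g h i) S, Set.subset_insert _ _, fun y hy ↦ ?_, fun x hx ↦ ?_, ?_⟩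
    · rcases hy with rfl | hy
      · exact Or.inr ⟨h, rfl⟩
      · exact Or.inl hy
    · have hxh : x ≠ h := by
        rintro rfl
        exact hx (Set.mem_insert _ _)
      rw [hD, hW, Move.apply_right]
      simp [below, Order.lt_add_one_iff, le_iff_lt_or_eq, hxh]
    · intro l p x hw
      rw [moveCode, List.cons_append, List.cons_append, List.append_assoc, List.singleton_append]
      refine Wp.seek (hM S) hm (by decide) ⟨hM S, ?_⟩
      have h1 : W (cell g h i) = true := by
        rw [hW, Move.apply_right]
        simp [below]
      have h2 := update_mix (S := S) (D := D) h1
      have := hw (cell g h i)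
      rwa [← h2] at this
  | left =>
    have hle := Move.apply_left_le h
    set h' := Move.left.apply h
    set N := OTM.gapIndex (g + 1 : ℕ) i (OTM.mix S D W) (((g + 1 : ℕ) : Ordinal.{0}) * h')
    have hcell : ∀ η : Ordinal.{0}, ((g + 1 : ℕ) : Ordinal.{0}) * h' + (g + 1 : ℕ) * η + i =
        cell g (h' + η) i := fun η ↦ by rw [cell, mul_add]
    -- The erasing loop stops only at a `0`, and its row has none before column `h`; so everything
    -- from `h'` up to `h` is erased.
    have hN : h ≤ h' + N := by
      have hne : {η : Ordinal.{0} | OTM.mix S D W (((g + 1 : ℕ) : Ordinal.{0}) * h' +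
          (g + 1 : ℕ) * η + i) = false}.Nonempty := by
        refine ⟨h, ?_⟩
        rw [Set.mem_ofPred_eq, hcell, hm]
        simp [below]
      have : OTM.mix S D W (((g + 1 : ℕ) : Ordinal.{0}) * h' + (g + 1 : ℕ) * N + i) = false :=
        csInf_mem hne
      rw [hcell, hm] at this
      simpa [below] using this
    have hWf : ∀ η, W (cell g (h' + η) i) = false := fun η ↦ by
      rw [hW]
      simp [below]
    refine ⟨S ∪ {y | ∃ η < N, y = cell g (h' + η) i}, Set.subset_union_left, fun y hy ↦ ?_,
      fun x hx ↦ ?_, ?_⟩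
    · rcases hy with hy | ⟨η, -, hy⟩
      · exact Or.inl hy
      · exact Or.inr ⟨_, hy⟩
    · rw [hD]
      rcases lt_or_ge x h' with hx' | hx'
      · rw [hW]
        simp [below, hx', hx'.trans_le hle]
      · obtain ⟨η, rfl⟩ := exists_add_of_le hx'
        rw [hWf]
        have : N ≤ η := not_lt.1 fun h ↦ hx (Or.inr ⟨η, h, rfl⟩)
        simpa [below] using hN.trans (add_le_add_right this h')
    · intro l p x hw
      rw [moveCode, List.cons_append, List.cons_append, List.append_assoc, List.cons_append,
        List.append_assoc, List.cons_append, List.append_assoc, List.singleton_append]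
      refine Wp.seek (hM S) hm (by decide) ⟨hM S, Wp.lefts (hM S) (g + i) ⟨?_, ?_⟩⟩
      · exact hM S
      -- Of the `g + i + 1` moves, `i` lead down to row `0` of column `h`, and `g + 1` lead on to
      -- column `h'`.
      rw [← Function.iterate_succ_apply (f := Move.left.apply), left_iterate_cell,
        lead_replicate (by decide)]
      have h1 : Op.erase.exec (g + 1 : ℕ) i ⟨mix S D W, ((g + 1 : ℕ) : Ordinal.{0}) * h', false⟩ =
          ⟨mix (S ∪ {y | ∃ η < N, y = cell g (h' + η) i}) D W,
            ((g + 1 : ℕ) : Ordinal.{0}) * h' + (g + 1 : ℕ) * N, false⟩ := by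
        have : eraseRun (g + 1 : ℕ) i (mix S D W) (((g + 1 : ℕ) : Ordinal.{0}) * h') N =
            mix (S ∪ {y | ∃ η < N, y = cell g (h' + η) i}) D W := by
          funext y
          have hiff : (∃ η < N, y = ((g + 1 : ℕ) : Ordinal.{0}) * h' + (g + 1 : ℕ) * η + i) ↔
              ∃ η < N, y = cell g (h' + η) i := by simp only [hcell]
          by_cases hy : ∃ η < N, y = cell g (h' + η) i
          · refine (if_pos (hiff.2 hy)).trans (Eq.symm ((if_pos (Or.inr hy)).trans ?_))
            obtain ⟨η, -, rfl⟩ := hy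
            exact hWf η
          · refine (if_neg fun hy' ↦ hy (hiff.1 hy')).trans ?_
            by_cases hyS : y ∈ S
            · exact (if_pos hyS).trans (if_pos (Or.inl hyS)).symm
            · exact (if_neg hyS).trans (if_neg fun h' ↦ h'.elim hyS hy).symm
        rw [← this]
        simp [Op.exec, N]
      change Wp _ _ _ (Op.erase.exec (g + 1 : ℕ) i ⟨mix S D W, _ * h', false⟩) _
      rw [h1]
      exact Wp.rights (hM _) i ⟨hM _, hw _⟩

/-- Different heads use different rows, so moving one of them leaves the others as they were. -/
theorem Wp.moves (hM : ∀ S, M (mix S D W)) (hkg : k ≤ g) (mv : Fin k → Move)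
    (hD : ∀ i : Fin k, HeadRow g D i (h i)) (hW : ∀ i : Fin k, HeadRow g W i ((mv i).apply (h i)))
    (L : List (Fin k)) (hL : L.Nodup) (S : Set Ordinal.{0}) (hS : ∀ i ∈ L, ∀ x, cell g x i ∉ S)
    (hp : ∀ S', S ⊆ S' → (∀ i ∈ L, ∀ x, cell g x i ∉ S' → D (cell g x i) = W (cell g x i)) →
      ∀ x, Wp (g + 1 : ℕ) M l ⟨mix S' D W, x, false⟩ p) :
    Wp (g + 1 : ℕ) M ((L.flatMap fun i : Fin k ↦ moveCode g i (mv i)) ++ l) ⟨mix S D W, x, false⟩ p := by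
  induction L generalizing S x with
  | nil => exact hp S subset_rfl (by simp) x
  | cons i L ih =>
    obtain ⟨h1, h2⟩ := List.nodup_cons.1 hL
    obtain ⟨h3, h4⟩ := List.forall_mem_cons.1 hS
    obtain ⟨S', h5, h6, h7, h8⟩ := Wp.move hM (mv i) (hD i) (hW i) h3
    rw [List.flatMap_cons, List.append_assoc]
    refine h8 fun x ↦ ih h2 S' (fun j hj x hx ↦ ?_) fun S'' h9 h10 x ↦ hp S'' (h5.trans h9)
      (List.forall_mem_cons.2 ⟨fun x hx ↦ h7 x fun h ↦ hx (h9 h), h10⟩) x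
    rcases h6 _ hx with h9 | ⟨x', h9⟩
    · exact h4 j hj x h9
    · have := (cell_inj (j.2.le.trans hkg) (i.2.le.trans hkg) h9).2
      exact h1 (Fin.ext this ▸ hj)

end

/-! ### Encoding configurations and simulating one instruction -/

section
variable {k : ℕ}

/-- The number of the last row in the encoding of a configuration with `k` tapes and the states up
to `N`. The rows are: the heads, the tapes, the states, and a flag. -/
abbrev lastRow (k N : ℕ) : ℕ := 2 * k + N + 1

def Atom.Valid (N : ℕ) : Atom k → Prop
  | .state n => n ≤ N
  | _ => True

def Atom.col : Atom k → Ordinal.{0}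
  | .state _ => 0
  | .head _ b => b
  | .tape _ y => y

def Atom.row : Atom k → ℕ
  | .state n => 2 * k + n
  | .head i _ => i
  | .tape i _ => k + i

noncomputable def Atom.cell (N : ℕ) (a : Atom k) : Ordinal.{0} :=
  OTM.cell (lastRow k N) a.col a.row

theorem Atom.row_lt {N : ℕ} {a : Atom k} (ha : a.Valid N) : a.row < lastRow k N := by
  unfold lastRow
  cases a with
  | state n =>
    have : n ≤ N := ha
    simp only [Atom.row]
    omega
  | head i b => simp only [Atom.row]; omega
  | tape i y => simp only [Atom.row]; omega

theorem Atom.cell_inj {N : ℕ} {a b : Atom k} (ha : a.Valid N) (hb : b.Valid N)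
    (h : a.cell N = b.cell N) : a = b := by
  obtain ⟨h1, h2⟩ := OTM.cell_inj (Atom.row_lt ha).le (Atom.row_lt hb).le h
  cases a <;> cases b <;> simp only [Atom.row, Atom.col] at h1 h2
  · rw [Nat.add_left_cancel h2]
  all_goals try (exfalso; omega)
  · rw [h1, Fin.ext h2]
  · rw [h1, Fin.ext (Nat.add_left_cancel h2)]

theorem Atom.cell_ne {N : ℕ} {a : Atom k} (ha : a.Valid N) :
    a.cell N ≠ (lastRow k N : ℕ) := by
  rw [← cell_zero (lastRow k N)]
  exact fun h ↦ (Atom.row_lt ha).ne (OTM.cell_inj (Atom.row_lt ha).le le_rfl h).2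

open Classical in
/-- The encoding of a configuration together with a flag. -/
noncomputable def Config.enc (N : ℕ) (c : Config k) (b : Bool) (y : Ordinal.{0}) : Bool :=
  decide ((∃ a : Atom k, a.Valid N ∧ y = a.cell N ∧ c.Holds a) ∨ y = (lastRow k N : ℕ) ∧ b = true)

variable {N : ℕ}

theorem Config.enc_eq_true (c : Config k) (b : Bool) (y : Ordinal.{0}) : c.enc N b y = true ↔
    (∃ a : Atom k, a.Valid N ∧ y = a.cell N ∧ c.Holds a) ∨ y = (lastRow k N : ℕ) ∧ b = true := by
  classical
  exact decide_eq_true_iff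

theorem Config.enc_cell (c : Config k) (b : Bool) {a : Atom k} (ha : a.Valid N) :
    c.enc N b (a.cell N) = true ↔ c.Holds a := by
  rw [Config.enc_eq_true]
  refine ⟨?_, fun h ↦ Or.inl ⟨a, ha, rfl, h⟩⟩
  rintro (⟨a', h1, h2, h3⟩ | ⟨h1, -⟩)
  · rwa [Atom.cell_inj ha h1 h2]
  · exact absurd h1 (Atom.cell_ne ha)

theorem Config.enc_lastRow (c : Config k) (b : Bool) : c.enc N b (lastRow k N : ℕ) = b := by
  rw [Bool.eq_iff_iff, Config.enc_eq_true]
  refine ⟨?_, fun h ↦ Or.inr ⟨rfl, h⟩⟩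
  rintro (⟨a', h1, h2, h3⟩ | ⟨-, h⟩)
  · exact absurd h2.symm (Atom.cell_ne h1)
  · exact h

theorem Config.enc_congr {c c' : Config k} {b b' : Bool} {y : Ordinal.{0}}
    (h : ∀ a : Atom k, a.Valid N → y = a.cell N → (c.Holds a ↔ c'.Holds a))
    (h' : y = (lastRow k N : ℕ) → b = b') : c.enc N b y = c'.enc N b' y := by
  rw [Bool.eq_iff_iff, Config.enc_eq_true, Config.enc_eq_true]
  refine or_congr (exists_congr fun a ↦ and_congr_right fun h1 ↦ and_congr_right fun h2 ↦
    h a h1 h2) (and_congr_right fun h3 ↦ ?_)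
  rw [h' h3]

theorem Config.headRow_enc (c : Config k) (b : Bool) (i : Fin k) :
    HeadRow (lastRow k N) (c.enc N b) i (c.head i) := fun x ↦ by
  rw [Bool.eq_iff_iff]
  refine (c.enc_cell (N := N) b (a := .head i x) trivial).trans ?_
  simp [below, Config.Holds]

theorem Config.enc_scan (c : Config k) (b : Bool) (i : Fin k) :
    c.enc N b ((Loc.scan i).pos (lastRow k N) c.head) = c.scanned i := by
  rw [Bool.eq_iff_iff]
  exact c.enc_cell (N := N) b (a := .tape i (c.head i)) trivial

theorem Config.enc_state (c : Config k) (b : Bool) (j : ℕ) (hj : j ≤ N) :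
    c.enc N b ((Loc.row (2 * k + j)).pos (lastRow k N) c.head) = decide (j < c.state) := by
  rw [Bool.eq_iff_iff, decide_eq_true_eq]
  refine Iff.trans ?_ (c.enc_cell (N := N) b (a := .state j) hj)
  rw [Loc.pos, Atom.cell, Atom.col, cell_zero, Atom.row]

/-- Whether a configuration is in state `q` and scans the symbols `s`. -/
def checks (N q : ℕ) (s : Fin k → Bool) : List (Loc k × Bool) :=
  (.row (lastRow k N), false) :: (.row (2 * k + q), false) ::
    ((match q with
      | 0 => []
      | q + 1 => [(.row (2 * k + q), true)]) ++ (List.finRange k).map fun i ↦ (.scan i, s i))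

/-- As the state is stored in unary, two bits identify it: that of `q` is `0` and, unless `q = 0`,
that of `q - 1` is `1`. -/
theorem forall_checks_iff (c : Config k) (b : Bool) {q : ℕ} (hq : q ≤ N) (s : Fin k → Bool) :
    (∀ d ∈ checks N q s, c.enc N b (d.1.pos (lastRow k N) c.head) = d.2) ↔
      b = false ∧ c.state = q ∧ c.scanned = s := by
  unfold checks
  rw [List.forall_mem_cons, List.forall_mem_cons, List.forall_mem_append,
    List.forall_mem_map]
  refine and_congr ?_ ?_
  · rw [Loc.pos, c.enc_lastRow]
  · rw [← and_assoc]
    refine and_congr ?_ ?_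
    · simp only [c.enc_state b q hq, decide_eq_false_iff_not, not_lt]
      cases q with
      | zero => simp
      | succ q =>
        have hq' : q ≤ N := by omega
        simp only [List.mem_singleton, forall_eq, c.enc_state b q hq', decide_eq_true_eq]
        omega
    · simp only [List.mem_finRange, forall_true_left, c.enc_scan, funext_iff]

/-- The cells that are written for an action. -/
def writes (N : ℕ) (act : Action k) : List (Loc k × Bool) :=
  (.row (lastRow k N), true) ::
    ((List.range (N + 1)).map (fun j ↦ (.row (2 * k + j), decide (j < act.state))) ++
      (List.finRange k).map fun i ↦ (.scan i, act.write i))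

/-- The code for an instruction. -/
def entryCode (N q : ℕ) (s : Fin k → Bool) (act : Action k) : List Op :=
  checkCode (checks N q s) ++ (writeCode (writes N act) ++
    (((List.finRange k).flatMap fun i : Fin k ↦ moveCode (lastRow k N) i (act.move i)) ++ [.nop]))

variable {M : (Ordinal.{0} → Bool) → Prop} {x : Ordinal.{0}} {l : List Op} {p : Mem → Prop}

theorem Wp.entry_of_ne (c : Config k) (b : Bool) (hM : M (c.enc N b)) {q : ℕ} (hq : q ≤ N)
    (s : Fin k → Bool) (act : Action k) (h : ¬ (b = false ∧ c.state = q ∧ c.scanned = s))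
    (hp : ∀ x, Wp (lastRow k N + 1 : ℕ) M l ⟨c.enc N b, x, false⟩ p) :
    Wp (lastRow k N + 1 : ℕ) M (entryCode N q s act ++ l) ⟨c.enc N b, x, false⟩ p := by
  rw [entryCode, List.append_assoc]
  refine Wp.check hM (c.headRow_enc b) _ (fun h' ↦ absurd ((forall_checks_iff c b hq s).1 h') h)
    fun _ x ↦ ?_
  rw [List.append_assoc, List.append_assoc]
  refine Wp.skip hM _ (nop_notMem_writeCode _) (Wp.skip hM _ ?_ ⟨hM, hp x⟩)
  simp only [List.mem_flatMap, not_exists, not_and]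
  exact fun i _ ↦ nop_notMem_moveCode _ _ _

theorem Wp.entry (c : Config k) (act : Action k)
    (hM : ∀ S, M (mix S (c.enc N false) ((c.perform act).enc N true))) (hq : c.state ≤ N)
    (hp : ∀ x, Wp (lastRow k N + 1 : ℕ) M l ⟨(c.perform act).enc N true, x, false⟩ p) :
    Wp (lastRow k N + 1 : ℕ) M (entryCode N c.state c.scanned act ++ l)
      ⟨c.enc N false, x, false⟩ p := by
  have hD := c.headRow_enc (N := N) false
  have hM0 : M (c.enc N false) := by simpa [mix_empty] using hM ∅
  rw [entryCode, List.append_assoc]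
  refine Wp.check hM0 hD _ (fun _ x ↦ ?_) fun ⟨d, h1, h2⟩ ↦
    absurd ((forall_checks_iff c false hq c.scanned).2 ⟨rfl, rfl, rfl⟩ d h1) h2
  rw [List.append_assoc, List.append_assoc]
  have hws : ∀ d ∈ writes N act,
      (c.perform act).enc N true (d.1.pos (lastRow k N) c.head) = d.2 ∧
        ∀ (i : Fin k) x, OTM.cell (lastRow k N) x i ≠ d.1.pos (lastRow k N) c.head := by
    rw [writes, List.forall_mem_cons, List.forall_mem_append, List.forall_mem_map,
      List.forall_mem_map]
    refine ⟨⟨(c.perform act).enc_lastRow true, fun i x h ↦ ?_⟩, fun j hj ↦ ⟨?_, fun i x h ↦ ?_⟩,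
      fun i _ ↦ ⟨?_, fun i' x h ↦ ?_⟩⟩
    · exact Atom.cell_ne (N := N) (a := .head i x) trivial h
    · exact (c.perform act).enc_state true j (Nat.lt_succ_iff.1 (List.mem_range.1 hj))
    · rw [Loc.pos, ← cell_zero (lastRow k N)] at h
      have h1 : j ≤ N := Nat.lt_succ_iff.1 (List.mem_range.1 hj)
      exact absurd (Atom.cell_inj (N := N) (a := .head i x) (b := .state j) trivial h1 h) nofun
    · rw [Bool.eq_iff_iff]
      refine ((c.perform act).enc_cell (N := N) true (a := .tape i (c.head i)) trivial).trans ?_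
      simp [Config.Holds, Config.perform]
    · exact absurd (Atom.cell_inj (N := N) (a := .head i' x) (b := .tape i (c.head i))
        trivial trivial h) nofun
  have key := Wp.write (x := x) (p := p)
    (l := ((List.finRange k).flatMap fun i : Fin k ↦ moveCode (lastRow k N) i (act.move i)) ++
      ([.nop] ++ l)) hM hD ∅ (by simp) (writes N act) hws fun x ↦ ?_
  · rwa [mix_empty] at key
  · refine Wp.moves hM (by unfold lastRow; omega) act.move hD
      (fun i ↦ (c.perform act).headRow_enc true i) _
      (List.nodup_finRange k) _ (fun i _ x h ↦ ?_) fun S' h1 h2 x ↦ ?_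
    · rcases h with h | ⟨d, h3, h4⟩
      · exact h
      · exact (hws d h3).2 i x h4
    · have hS : ∀ d ∈ writes N act, d.1.pos (lastRow k N) c.head ∈ S' :=
        fun d hd ↦ h1 (Or.inr ⟨d, hd, rfl⟩)
      rw [writes, List.forall_mem_cons, List.forall_mem_append, List.forall_mem_map,
        List.forall_mem_map] at hS
      obtain ⟨h3, h4, h5⟩ := hS
      -- Cells outside `S'` were not touched. They lie in head rows, where the new value agrees with
      -- the old, or on the tapes away from the heads, or encode nothing.
      have : mix S' (c.enc N false) ((c.perform act).enc N true) = (c.perform act).enc N true := by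
        refine mix_eq fun y hy ↦ Config.enc_congr (fun a ha hya ↦ ?_) fun h ↦ ?_
        · subst hya
          cases a with
          | state j =>
            refine absurd ?_ hy
            have := h4 j (List.mem_range.2 (Nat.lt_succ_iff.2 ha))
            rwa [Loc.pos, ← cell_zero (lastRow k N)] at this
          | head i b =>
            have := h2 i (List.mem_finRange i) b hy
            rw [← c.enc_cell false (a := .head i b) trivial,
              ← (c.perform act).enc_cell true (a := .head i b) trivial]
            exact Bool.eq_iff_iff.1 this
          | tape i z =>
            have hz : z ≠ c.head i := by
              rintro rfl
              exact hy (h5 i (List.mem_finRange i))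
            simp [Config.Holds, Config.perform, hz]
        · rw [h] at hy
          exact absurd h3 hy
      rw [this]
      refine ⟨?_, hp x⟩
      rw [← this]
      exact hM _

end

/-! ### The program that simulates a machine pass by pass -/

/-- The code for the instructions of `P` with given arguments. -/
def Program.entries (P : Program) (N : ℕ) (L : List (ℕ × (Fin P.tapes → Bool))) : List Op :=
  L.flatMap fun d ↦ (P.instr d.1 d.2).elim [] (entryCode N d.1 d.2)

/-- The straight-line program that simulates one step of `P`, and signals if `P` has halted. -/
noncomputable def Program.code (P : Program) (N : ℕ) : List Op :=
  (Loc.row (k := P.tapes) (lastRow P.tapes N)).code ++ .clear ::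
    (P.entries N P.finite_instr.toFinset.toList ++
      ((Loc.row (k := P.tapes) (lastRow P.tapes N)).code ++ [.test]))

section
variable {k : ℕ}

theorem Loc.halt_notMem_code (L : Loc k) : Op.halt ∉ L.code := by
  cases L <;> simp [Loc.code, List.mem_replicate]

theorem halt_notMem_checkCode (cs : List (Loc k × Bool)) : Op.halt ∉ checkCode cs := by
  simp only [checkCode, List.mem_flatMap, not_exists, not_and, List.mem_append, not_or]
  refine fun c _ ↦ ⟨c.1.halt_notMem_code, ?_⟩
  split_ifs <;> simp

theorem halt_notMem_writeCode (ws : List (Loc k × Bool)) : Op.halt ∉ writeCode ws := by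
  simp only [writeCode, List.mem_flatMap, not_exists, not_and, List.mem_append, not_or]
  refine fun c _ ↦ ⟨c.1.halt_notMem_code, ?_⟩
  split_ifs <;> simp

theorem halt_notMem_moveCode (g i : ℕ) (mv : Move) : Op.halt ∉ moveCode g i mv := by
  cases mv <;> simp [moveCode, List.mem_replicate]

theorem halt_notMem_entryCode (N q : ℕ) (s : Fin k → Bool) (act : Action k) :
    Op.halt ∉ entryCode N q s act := by
  simp [entryCode, halt_notMem_checkCode, halt_notMem_writeCode, halt_notMem_moveCode]

end

theorem Program.halt_notMem_code (P : Program) (N : ℕ) : Op.halt ∉ P.code N := by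
  simp only [Program.code, Program.entries, List.mem_append, List.mem_cons, List.mem_flatMap,
    Loc.halt_notMem_code, reduceCtorEq, List.not_mem_nil, false_or, or_false, not_exists, not_and]
  intro d _
  cases P.instr d.1 d.2 with
  | none => simp
  | some act => exact halt_notMem_entryCode _ _ _ _

section
variable {P : Program} {N : ℕ} {M : (Ordinal.{0} → Bool) → Prop} {x : Ordinal.{0}} {l : List Op}
  {p : Mem → Prop} {L : List (ℕ × (Fin P.tapes → Bool))}

/-- A raised flag makes the checks of all entries fail. This prevents a second instruction in the
same pass if the new configuration matches a later entry. -/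
theorem Wp.entries_of_ne (c : Config P.tapes) (b : Bool) (hM : M (c.enc N b))
    (hL : ∀ d ∈ L, d.1 ≤ N) (h : b = true ∨ (c.state, c.scanned) ∉ L)
    (hp : ∀ x, Wp (lastRow P.tapes N + 1 : ℕ) M l ⟨c.enc N b, x, false⟩ p) :
    Wp (lastRow P.tapes N + 1 : ℕ) M (P.entries N L ++ l) ⟨c.enc N b, x, false⟩ p := by
  induction L generalizing x with
  | nil => exact hp x
  | cons d L ih =>
    obtain ⟨h1, h2⟩ := List.forall_mem_cons.1 hL
    rw [List.mem_cons, not_or] at h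
    have ih := fun x ↦ ih (x := x) h2 (h.imp_right And.right)
    rw [Program.entries, List.flatMap_cons, List.append_assoc]
    cases P.instr d.1 d.2 with
    | none => exact ih x
    | some act =>
      refine Wp.entry_of_ne c b hM h1 d.2 act (fun h' ↦ ?_) ih
      rcases h with h | h
      · exact Bool.false_ne_true (h'.1.symm.trans h)
      · exact h.1 (Prod.ext h'.2.1 h'.2.2)

theorem Wp.entries (c : Config P.tapes) {act : Action P.tapes}
    (hact : P.instr c.state c.scanned = some act)
    (hM : ∀ S, M (mix S (c.enc N false) ((c.perform act).enc N true)))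
    (hL : ∀ d ∈ L, d.1 ≤ N) (h : (c.state, c.scanned) ∈ L)
    (hp : ∀ x, Wp (lastRow P.tapes N + 1 : ℕ) M l ⟨(c.perform act).enc N true, x, false⟩ p) :
    Wp (lastRow P.tapes N + 1 : ℕ) M (P.entries N L ++ l) ⟨c.enc N false, x, false⟩ p := by
  have hM0 : M (c.enc N false) := by simpa [mix_empty] using hM ∅
  have hM1 : M ((c.perform act).enc N true) := by
    simpa [mix_eq (S := Set.univ)] using hM Set.univ
  induction L generalizing x with
  | nil => simp at h
  | cons d L ih =>
    obtain ⟨h1, h2⟩ := List.forall_mem_cons.1 hL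
    rw [Program.entries, List.flatMap_cons, List.append_assoc]
    by_cases hd : d = (c.state, c.scanned)
    · subst hd
      rw [hact]
      exact Wp.entry c act hM h1 fun x ↦ Wp.entries_of_ne _ _ hM1 h2 (Or.inl rfl) hp
    · have ih := fun x ↦ ih (x := x) h2 (List.mem_of_ne_of_mem (Ne.symm hd) h)
      cases P.instr d.1 d.2 with
      | none => exact ih x
      | some act =>
        refine Wp.entry_of_ne c _ hM0 h1 d.2 act (fun h' ↦ ?_) ih
        exact hd (Prod.ext h'.2.1.symm h'.2.2.symm)

theorem Config.enc_of_ne (c : Config P.tapes) (b b' : Bool) {y : Ordinal.{0}}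
    (hy : y ≠ (lastRow P.tapes N : ℕ)) : c.enc N b y = c.enc N b' y :=
  Config.enc_congr (fun _ _ _ ↦ Iff.rfl) fun h ↦ absurd h hy

/-- The flag is cleared at the start and raised by the entry that applies, so the closing `test`
sets the skip flag exactly if no instruction applied. The first condition expresses that cells
common to both encodings never drop to `0` during the pass; the flag itself is exempt. -/
theorem Program.step_code (P : Program) {N : ℕ} (hN : ∀ q s, P.instr q s ≠ none → q ≤ N)
    (c : Config P.tapes) (b : Bool) :
    Wp (lastRow P.tapes N + 1 : ℕ) (fun D ↦ ∀ y : Ordinal.{0}, y ≠ (lastRow P.tapes N : ℕ) →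
        c.enc N false y = true → (P.next c).enc N false y = true → D y = true)
      (P.code N) ⟨c.enc N b, 0, false⟩
      fun a ↦ (∃ b', a.D = (P.next c).enc N b') ∧ (a.skip = true ↔ P.IsFinal c) := by
  have hM : ∀ b (y : Ordinal.{0}), y ≠ (lastRow P.tapes N : ℕ) →
      c.enc N false y = true → (P.next c).enc N false y = true → c.enc N b y = true :=
    fun b y hy h _ ↦ (c.enc_of_ne b false hy).trans h
  have hM' : ∀ b (y : Ordinal.{0}), y ≠ (lastRow P.tapes N : ℕ) →
      c.enc N false y = true → (P.next c).enc N false y = true → (P.next c).enc N b y = true :=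
    fun b y hy _ h ↦ ((P.next c).enc_of_ne b false hy).trans h
  have hL : ∀ d ∈ P.finite_instr.toFinset.toList, d.1 ≤ N := fun d hd ↦
    hN d.1 d.2 (by simpa using hd)
  have hclear : Function.update (c.enc N b) ((Loc.row (lastRow P.tapes N)).pos
      (lastRow P.tapes N) c.head) false = c.enc N false := by
    funext y
    rw [Loc.pos]
    rcases eq_or_ne y (lastRow P.tapes N : ℕ) with rfl | hy
    · rw [Function.update_self, c.enc_lastRow]
    · rw [Function.update_of_ne hy, c.enc_of_ne b false hy]
  rw [Program.code]
  refine Wp.locate (hM b) (fun i ↦ c.headRow_enc b i) _ ⟨hM b, ?_⟩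
  simp only [Op.exec, Bool.false_eq_true, if_false, hclear]
  have hend : ∀ b', (∀ y : Ordinal.{0}, y ≠ (lastRow P.tapes N : ℕ) → c.enc N false y = true →
        (P.next c).enc N false y = true → (P.next c).enc N b' y = true) →
      (b' = false ↔ P.IsFinal c) → ∀ x,
      Wp (lastRow P.tapes N + 1 : ℕ) (fun D ↦ ∀ y : Ordinal.{0}, y ≠ (lastRow P.tapes N : ℕ) →
        c.enc N false y = true → (P.next c).enc N false y = true → D y = true)
      ((Loc.row (k := P.tapes) (lastRow P.tapes N)).code ++ [.test])
      ⟨(P.next c).enc N b', x, false⟩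
      fun a ↦ (∃ b', a.D = (P.next c).enc N b') ∧ (a.skip = true ↔ P.IsFinal c) := by
    intro b' h h' x
    refine Wp.locate h (fun i ↦ (P.next c).headRow_enc b' i) _ ⟨h, ?_, ⟨b', ?_⟩, ?_⟩
    · simpa [Op.exec] using h
    · simp [Op.exec]
    · have := (P.next c).enc_lastRow (N := N) b'
      simp only [Op.exec, Bool.false_eq_true, if_false, Loc.pos, this, Bool.not_eq_true', h']
  cases hact : P.instr c.state c.scanned with
  | none =>
    have hnext : P.next c = c := by rw [Program.next, hact]
    have := hend false (hM' false) (by simp [Program.IsFinal, hact])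
    rw [hnext] at this ⊢
    rw [hnext] at hM
    exact Wp.entries_of_ne c false (hM false) hL (Or.inr (by simpa using hact)) this
  | some act =>
    have hnext : P.next c = c.perform act := Program.next_of_instr hact
    have := hend true (hM' true) (by simp [Program.IsFinal, hact])
    rw [hnext] at this hM hM' ⊢
    refine Wp.entries c hact (fun S y hy h1 h2 ↦ ?_) hL (by simp [hact]) this
    unfold mix
    split_ifs
    · exact hM' true y hy h1 h2
    · exact hM false y hy h1 h2

/-- The program `P.code N` simulates `P`. -/
theorem Program.exists_dataAt_eq (P : Program) {N : ℕ}
    (hN : ∀ q s, P.instr q s ≠ none → q ≤ N) (t : Ordinal.{0}) :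
    ∃ b, dataAt (lastRow P.tapes N + 1 : ℕ) (P.code N) t = (P.run t).enc N b := by
  induction t using Ordinal.limitRecOn with
  | zero =>
    refine ⟨false, ?_⟩
    funext y
    rw [dataAt_zero, P.run_zero, Bool.eq_iff_iff, Config.enc_eq_true]
    simp only [Bool.false_eq_true, and_false, or_false, false_iff, not_exists, not_and]
    rintro (n | ⟨i, b⟩ | ⟨i, z⟩) - - h
    · exact Nat.not_lt_zero n h
    · exact not_lt_zero h
    · exact Bool.false_ne_true h
  | add_one t ih =>
    obtain ⟨b, hb⟩ := ih
    rw [dataAt_add_one, P.run_succ, startAt, hb]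
    exact (P.step_code hN (P.run t) b).runOps.1
  | limit t ht ih =>
    -- The value of the flag at a limit does not matter, since every pass begins by clearing it.
    refine ⟨dataAt (lastRow P.tapes N + 1 : ℕ) (P.code N) t (lastRow P.tapes N : ℕ), ?_⟩
    funext y
    rcases eq_or_ne y (lastRow P.tapes N : ℕ) with rfl | hy
    · rw [Config.enc_lastRow]
    rw [Bool.eq_iff_iff, dataAt_limit _ _ ht, Config.enc_eq_true]
    have hle : ∀ s < t, common (lastRow P.tapes N + 1 : ℕ) (P.code N)
        (startAt (lastRow P.tapes N + 1 : ℕ) (P.code N) s) y = true →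
        ∃ a : Atom P.tapes, a.Valid N ∧ y = a.cell N ∧ (P.run s).Holds a := fun s hs h ↦ by
      obtain ⟨b, hb⟩ := ih s hs
      have := Bool.le_iff_imp.1 (common_le _ _ _ y) h
      rw [startAt, hb, Config.enc_eq_true] at this
      exact this.resolve_right fun h ↦ hy h.1
    simp only [hy, false_and, or_false]
    constructor
    · intro h
      obtain ⟨s, hs, h'⟩ := h.exists
      obtain ⟨a, ha, rfl, -⟩ := hle s hs h'
      refine ⟨a, ha, rfl, (P.run_limit_holds ht a).2 (h.mono fun s hs h ↦ ?_)⟩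
      obtain ⟨a', ha', h1, h2⟩ := hle s hs h
      rwa [Atom.cell_inj ha ha' h1]
    · rintro ⟨a, ha, rfl, h⟩
      have h := (P.run_limit_holds ht a).1 h
      -- An atom that holds eventually holds both at `s` and at `s + 1`, so its cell stays `1`
      -- during the whole pass `s`.
      refine (h.and (h.shift ht)).mono fun s hs ⟨h1, h2⟩ ↦ ?_
      obtain ⟨b, hb⟩ := ih s hs
      rw [startAt, hb]
      rw [P.run_succ] at h2
      exact (P.step_code hN (P.run s) b).common fun D hD ↦
        hD _ hy ((Config.enc_cell _ _ ha).2 h1) ((Config.enc_cell _ _ ha).2 h2)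

theorem Program.signalsAt_code (P : Program) {N : ℕ} (hN : ∀ q s, P.instr q s ≠ none → q ≤ N)
    {α : Ordinal.{0}} (h : P.HaltsAt (α + 1)) :
    SignalsAt (lastRow P.tapes N + 1 : ℕ) (P.code N) α := by
  have key : ∀ t, (runOps (lastRow P.tapes N + 1 : ℕ) (P.code N)
      (startAt (lastRow P.tapes N + 1 : ℕ) (P.code N) t)).skip = true ↔ P.IsFinal (P.run t) :=
    fun t ↦ by
      obtain ⟨b, hb⟩ := P.exists_dataAt_eq hN t
      rw [startAt, hb]
      exact (P.step_code hN (P.run t) b).runOps.2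
  obtain ⟨t, h1, h2⟩ := h
  obtain rfl : α = t := Order.succ_injective (by simpa using h1)
  exact ⟨(key α).2 h2.1, fun t ht ↦ Bool.eq_false_iff.2 fun h' ↦
    ht.not_ge (h2.2 ((key t).1 h'))⟩

end

/-! ### Unsignalled ordinals and the gap -/

theorem Loaded.unique {B : Fin 5 → Ordinal.{0} → Bool} {l l' : List Op} (h : Loaded B l)
    (h' : Loaded B l') : l = l' := by
  have key : ∀ {l l' : List Op}, Loaded B l → Loaded B l' → l.length ≤ l'.length :=
    fun {l l'} h h' ↦ not_lt.1 fun hlt ↦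
      h.ne_halt l[l'.length] (List.getElem_mem hlt) ((h.decode _ hlt).symm.trans h'.halt)
  exact List.ext_getElem ((key h h').antisymm (key h' h)) fun i h1 h2 ↦
    (h.decode i h1).symm.trans (h'.decode i h2)

/-- Every program is loaded by some number. -/
theorem exists_digits (l : List Op) (hl : Op.halt ∉ l) (g : ℕ) :
    ∃ n, Loaded (digits n) l ∧ (∀ i : ℕ, i < g → digits n 4 i = true) ∧ digits n 4 g = false := by
  -- Enough digits for the program with its closing `halt` and for the stride with its closing `0`;
  -- of the five digits of a cell, the last carries the stride.
  let w := 5 * (l.length + g + 1)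
  let f : Fin w → Bool := fun i ↦ if i.1 % 5 = 4 then decide (i.1 / 5 < g) else
    (l.getD (i.1 / 5) .halt).bits ⟨i.1 % 5, Nat.mod_lt _ (by decide)⟩
  have hd4 : ∀ i : ℕ, i ≤ g → digits (Nat.ofBits f) 4 i = decide (i < g) := fun i hi ↦ by
    have h1 : 5 * i + ((4 : Fin 5) : ℕ) < w := by simp only [w]; omega
    rw [digits_natCast, Nat.testBit_ofBits_lt f _ h1]
    simp only [f]
    rw [if_pos (by simp)]
    congr 2
    change (5 * i + 4) / 5 = i
    omega
  have hd : ∀ i : ℕ, i ≤ l.length →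
      Op.decode (fun j ↦ digits (Nat.ofBits f) j i) = l.getD i .halt := fun i hi ↦ by
    refine Op.decode_eq _ _ fun j hj ↦ ?_
    have hj : (j : ℕ) < 4 := hj
    have h1 : 5 * i + (j : ℕ) < w := by simp only [w]; omega
    rw [digits_natCast, Nat.testBit_ofBits_lt f _ h1]
    simp only [f]
    have h2 : (5 * i + (j : ℕ)) % 5 = j := by omega
    have h3 : (5 * i + (j : ℕ)) / 5 = i := by omega
    rw [if_neg (by omega), h3]
    congr 1
    exact Fin.ext h2
  refine ⟨Nat.ofBits f, ⟨fun i hi ↦ ?_, ?_, fun o ho h ↦ hl (h ▸ ho)⟩, fun i hi ↦ ?_, ?_⟩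
  · rw [hd i hi.le]
    simp [hi]
  · rw [hd _ le_rfl]
    simp
  · rw [hd4 i hi.le]
    simpa using hi
  · rw [hd4 g le_rfl]
    simp

theorem exists_succeeds {α : Ordinal.{0}} (h : Clockable α) : ∃ n, Succeeds n α := by
  obtain ⟨P, hP⟩ := h
  obtain ⟨N, hN, -⟩ := P.exists_bound
  obtain ⟨n, h1, h2, h3⟩ := exists_digits (P.code N) (P.halt_notMem_code N) (lastRow P.tapes N)
  refine ⟨n, ?_⟩
  obtain ⟨h4, h5⟩ := (exists_stride n).choose_spec
  have hg : (exists_stride n).choose = lastRow P.tapes N := by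
    rcases lt_trichotomy (exists_stride n).choose (lastRow P.tapes N) with h | h | h
    · exact absurd ((h2 _ h).symm.trans h5) (by decide)
    · exact h
    · exact absurd ((h4 _ h).symm.trans h3) (by decide)
  rw [Succeeds, hg, (exists_loaded n).choose_spec.unique h1]
  exact P.signalsAt_code hN hP

theorem clockable_zero : Clockable 0 :=
  ⟨{ tapes := 1
     tapes_pos := Nat.one_pos
     instr := fun _ _ ↦ none
     finite_instr := by simp }, 0, rfl, rfl, fun _ _ ↦ zero_le⟩

/-- Otherwise, since a number signals at most one ordinal, choosing numbers would embed the ordinals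
into `ℕ`. -/
theorem exists_not_succeeds : ∃ β : Ordinal.{0}, ∀ n, ¬ Succeeds n β := by
  by_contra! h
  choose f hf using h
  exact not_injective_of_ordinal f fun α β hαβ ↦ SignalsAt.unique (hf α) (hαβ ▸ hf β)

theorem exists_clockable_gap : ∃ σ γ : Ordinal.{0}, 0 < σ ∧ IsGap σ γ := by
  have hne : {β : Ordinal.{0} | ∀ n, ¬ Succeeds n β}.Nonempty := exists_not_succeeds
  set β := sInf {β : Ordinal.{0} | ∀ n, ¬ Succeeds n β}
  have hβ : ∀ n, ¬ Succeeds n β := csInf_mem hne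
  have hβ' : ¬ Clockable β := fun h ↦ by
    obtain ⟨n, hn⟩ := exists_succeeds h
    exact hβ n hn
  obtain ⟨r, h1, h2⟩ := exists_clockable_of_not_succeeds hβ fun α hα ↦ by
    simpa using notMem_of_lt_csInf' hα
  have hne' : {ξ : Ordinal.{0} | ¬ Clockable ξ}.Nonempty := ⟨β, hβ'⟩
  -- `σ ≤ β < r`, so there are clockable ordinals above `σ`. All ordinals below `σ` are clockable,
  -- which gives cofinality at once.
  set σ := sInf {ξ : Ordinal.{0} | ¬ Clockable ξ}
  have hσ : ¬ Clockable σ := csInf_mem hne'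
  have hlt : ∀ ξ < σ, Clockable ξ := fun ξ hξ ↦ by simpa using notMem_of_lt_csInf' hξ
  have hσβ : σ ≤ β := csInf_le' hβ'
  have hne'' : {ξ : Ordinal.{0} | σ < ξ ∧ Clockable ξ}.Nonempty := ⟨r, hσβ.trans_lt h1, h2⟩
  set γ := sInf {ξ : Ordinal.{0} | σ < ξ ∧ Clockable ξ}
  have hγ : σ < γ ∧ Clockable γ := csInf_mem hne''
  refine ⟨σ, γ, ?_, hγ.1, fun ξ hξ ↦ ?_, fun ξ hξ ↦ ⟨ξ, ⟨le_rfl, hξ⟩, hlt ξ hξ⟩, hγ.2⟩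
  · refine pos_iff_ne_zero.2 fun h0 ↦ hσ ?_
    rw [h0]
    exact clockable_zero
  · rcases hξ.1.eq_or_lt with rfl | h3
    · exact hσ
    · exact fun h4 ↦ notMem_of_lt_csInf' hξ.2 ⟨h3, h4⟩

end OTM

/-- There are gaps in the OTM-clockable ordinals. -/
theorem mainTheorem8 :
    (∃ α β : Ordinal.{0}, OTM.IsGap α β) ∧
    (∃ α β γ : Ordinal.{0}, α < β ∧ β < γ ∧
      OTM.Clockable α ∧ ¬ OTM.Clockable β ∧ OTM.Clockable γ) := by
  obtain ⟨σ, γ, h0, h⟩ := OTM.exists_clockable_gap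
  exact ⟨⟨σ, γ, h⟩, 0, σ, γ, h0, h.lt, OTM.clockable_zero, h.not_clockable σ ⟨le_rfl, h.lt⟩,
    h.clockable⟩
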